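/- Let $\mathbf{k}$ be an algebraically closed field (of any characteristic). An algebra is a vector space over $\mathbf{k}$ with a bilinear multiplication (not necessarily associative). It is anticommutative if $a^2=0$ for all $a$, and Engel if there is $m>0$ such that $(L_a)^m=0$ for all $a$, where $L_a(b)=ab$. Put $V=\mathbf{k}^n$ with standard basis $e_1,\dots,e_n$; an $n$-dimensional algebra structure is a bilinear map $V\times V\to V$, and via structure constants these form the affine space $\mathbf{k}^{n^3}$, on which $GL(V)$ acts by $(g*\mu)(x,y)=g\mu(g^{-1}x,g^{-1}y)$. A structure $\mu$ represents an algebra $A$ if $(V,\mu)\cong A$. For $n$-dimensional algebras $A$, $B$ represented by $\mu$, $\chi$, one says that $A$ degenerates to $B$ if $\chi$ lies in the Zariski closure of the orbit of $\mu$; the degeneration is non-trivial if $A\not\cong B$. The level of an $n$-dimensional algebra $A$ is the maximal $m$ for which there is a sequence of non-trivial degenerations $A\to A_{m-1}\to\dots\to A_1\to A_0$ of $n$-dimensional algebras. In the following anticommutative structures on $V$, the nonzero products $e_ie_j$ with $i<j$ are: - $\eta_3$: $e_1e_2=e_3e_4=e_5e_6=e_7$ ($n\ge 7$); - $T^3$: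 $e_1e_2=e_3$, $e_1e_3=e_n$ ($n\ge 4$); - $T^{2,2}(\epsilon_{23}^{n-2})$: $e_1e_2=e_{n-1}$, $e_1e_3=e_n$, $e_2e_3=e_{n-2}$ ($n\ge 6$); - $T^{2,2}(\epsilon_{24}^{n})$: $e_1e_2=e_{n-1}$, $e_1e_3=e_2e_4=e_n$ ($n\ge 6$); - $T^{2,2,2}$: $e_1e_2=e_{n-2}$, $e_1e_3=e_{n-1}$, $e_1e_4=e_n$ ($n\ge 7$). **Theorem.** Let $A$ be an $n$-dimensional anticommutative Engel algebra over $\mathbf{k}$. - If $n\le 4$, then $A$ has level at most $2$. - If $n=5$, then $A$ has level $3$ if and only if it can be represented by $T^3$. - If $n=6$, then $A$ has level $3$ if and only if it can be represented by $T^{2,2}(\epsilon_{23}^{4})$, $T^{2,2}(\epsilon_{24}^{6})$ or $T^3$. - If $n\ge 7$, then $A$ has level $3$ if and only if it can be represented by $\eta_3$, $T^{2,2}(\epsilon_{23}^{n-2})$, $T^{2,2}(\epsilon_{24}^{n})$, $T^3$ or $T^{2,2,2}$. -/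

import Mathlib

namespace EngelLevel

/-- The set of `n`-dimensional algebra structures: bilinear multiplications on `V = k ^ n`, with
no further axioms. -/
abbrev AlgStr (k : Type*) [Field k] (n : ℕ) :=
  (Fin n → k) →ₗ[k] (Fin n → k) →ₗ[k] (Fin n → k)

section Degeneration

variable {k : Type*} [Field k] {n : ℕ}

/-- The action of `GL(V)` on algebra structures: `(g * μ)(x, y) = g (μ (g⁻¹ x, g⁻¹ y))`. -/
def act (g : (Fin n → k) ≃ₗ[k] (Fin n → k)) (μ : AlgStr k n) : AlgStr k n :=
  (μ.compl₁₂ g.symm.toLinearMap g.symm.toLinearMap).compr₂ g.toLinearMap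

/-- The orbit of a structure under `GL(V)`. -/
def orbit (μ : AlgStr k n) : Set (AlgStr k n) :=
  {χ | ∃ g : (Fin n → k) ≃ₗ[k] (Fin n → k), act g μ = χ}

/-- The structure constants of `μ` in the standard basis: the coefficient of `e_l` in `e_i e_j`.
They identify the set of structures with the affine space of dimension `n ^ 3`. -/
def structConst (μ : AlgStr k n) : Fin n × Fin n × Fin n → k :=
  fun p => μ (Pi.single p.1 1) (Pi.single p.2.1 1) p.2.2

/-- `Degenerates μ χ`: the structure `χ` lies in the Zariski closure of the orbit of `μ`. -/
def Degenerates (μ χ : AlgStr k n) : Prop :=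
  structConst χ ∈
    MvPolynomial.zeroLocus k (MvPolynomial.vanishingIdeal k (structConst '' orbit μ))

/-- A non-trivial degeneration: a degeneration between non-isomorphic algebras. -/
def ProperlyDegenerates (μ χ : AlgStr k n) : Prop :=
  Degenerates μ χ ∧ χ ∉ orbit μ

end Degeneration

section Algebras

variable (k : Type*) [Field k] (A : Type*) [NonUnitalNonAssocRing A] [Module k A]

/-- The structure `μ` on `k ^ n` represents the algebra `A`. -/
def Represents {k : Type*} [Field k] {n : ℕ} (μ : AlgStr k n)
    (A : Type*) [NonUnitalNonAssocRing A] [Module k A] : Prop :=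
  ∃ f : (Fin n → k) ≃ₗ[k] A, ∀ x y, f (μ x y) = f x * f y

/-- `A` is anticommutative: all squares are zero. -/
def IsAnticommutative (A : Type*) [NonUnitalNonAssocRing A] : Prop :=
  ∀ a : A, a * a = 0

/-- `A` is Engel: for some `m > 0`, the `m`-th power of every left multiplication is zero. -/
def IsEngel [SMulCommClass k A A] : Prop :=
  ∃ m : ℕ, 0 < m ∧ ∀ a : A, LinearMap.mulLeft k a ^ m = 0

/-- The lengths `m` of sequences of non-trivial degenerations
`A → A_{m-1} → ⋯ → A_1 → A_0` of `n`-dimensional algebras, where `n = dim A`. The algebra in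
position `i` of the sequence is given by a structure `c i` representing it. -/
def chainLengths : Set ℕ :=
  {m | ∃ c : ℕ → AlgStr k (Module.finrank k A),
    Represents (c 0) A ∧ ∀ i < m, ProperlyDegenerates (c i) (c (i + 1))}

/-- `A` has level `m`: `m` is the maximal length of a sequence of non-trivial degenerations
that starts at `A`. -/
def HasLevel (m : ℕ) : Prop :=
  IsGreatest (chainLengths k A) m

end Algebras

section Tables

variable (k : Type*) [Field k] (n : ℕ)

/-- The `i`-th coordinate, with `i` counted from `1` (zero if `i` is out of range). -/
def coord {k : Type*} [Field k] {n : ℕ} (i : ℕ) (x : Fin n → k) : k :=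
  ∑ p : Fin n, if p.val + 1 = i then x p else 0

/-- For `1 ≤ i < j ≤ n` and `1 ≤ l ≤ n`, the anticommutative structure whose only nonzero
products of basic vectors are `e_i e_j = e_l` and `e_j e_i = - e_l`. -/
def eps (i j l : ℕ) : AlgStr k n :=
  LinearMap.mk₂ k
    (fun x y p => if p.val + 1 = l then coord i x * coord j y - coord j x * coord i y else 0)
    (by
      intro x x' y; funext p
      simp only [coord, Pi.add_apply, ← Finset.sum_filter, Finset.sum_add_distrib]
      split_ifs <;> ring)
    (by
      intro c x y; funext p
      simp only [coord, Pi.smul_apply, smul_eq_mul, ← Finset.sum_filter, ← Finset.mul_sum]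
      split_ifs <;> ring)
    (by
      intro x y y'; funext p
      simp only [coord, Pi.add_apply, ← Finset.sum_filter, Finset.sum_add_distrib]
      split_ifs <;> ring)
    (by
      intro c x y; funext p
      simp only [coord, Pi.smul_apply, smul_eq_mul, ← Finset.sum_filter, ← Finset.mul_sum]
      split_ifs <;> ring)

/-- `η_m`: `e_{2i-1} e_{2i} = e_{2m+1}` for `1 ≤ i ≤ m` (`n ≥ 2m + 1`). -/
def eta (m : ℕ) : AlgStr k n :=
  ∑ i ∈ Finset.Icc 1 m, eps k n (2 * i - 1) (2 * i) (2 * m + 1)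

/-- `T^3`: `e_1 e_2 = e_3`, `e_1 e_3 = e_n` (`n ≥ 4`). -/
def T3 : AlgStr k n :=
  eps k n 1 2 3 + eps k n 1 3 n

/-- `T^{2,2}`: `e_1 e_2 = e_{n-1}`, `e_1 e_3 = e_n` (`n ≥ 5`). -/
def T22 : AlgStr k n :=
  eps k n 1 2 (n - 1) + eps k n 1 3 n

/-- `T^{2,2}(ε_{23}^{n-2})`: `e_1 e_2 = e_{n-1}`, `e_1 e_3 = e_n`, `e_2 e_3 = e_{n-2}`
(`n ≥ 6`). -/
def T22eps23 : AlgStr k n :=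
  T22 k n + eps k n 2 3 (n - 2)

/-- `T^{2,2}(ε_{24}^n)`: `e_1 e_2 = e_{n-1}`, `e_1 e_3 = e_2 e_4 = e_n` (`n ≥ 6`). -/
def T22eps24 : AlgStr k n :=
  T22 k n + eps k n 2 4 n

/-- `T^{2,2,2}`: `e_1 e_2 = e_{n-2}`, `e_1 e_3 = e_{n-1}`, `e_1 e_4 = e_n` (`n ≥ 7`). -/
def T222 : AlgStr k n :=
  eps k n 1 2 (n - 2) + eps k n 1 3 (n - 1) + eps k n 1 4 n

end Tables

end EngelLevel

namespace EngelLevel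

/-! ### Orbits, and polynomial functions of the structure constants -/

section Structures

variable {k : Type*} [Field k] {n : ℕ}

theorem act_apply (g : (Fin n → k) ≃ₗ[k] (Fin n → k)) (μ : AlgStr k n) (x y : Fin n → k) :
    act g μ x y = g (μ (g.symm x) (g.symm y)) := rfl

theorem mem_orbit_iff {μ χ : AlgStr k n} :
    χ ∈ orbit μ ↔ ∃ g : (Fin n → k) ≃ₗ[k] (Fin n → k), ∀ x y, χ (g x) (g y) = g (μ x y) := by
  constructor
  · rintro ⟨g, rfl⟩
    exact ⟨g, fun x y => by simp [act_apply]⟩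
  · rintro ⟨g, hg⟩
    refine ⟨g, ?_⟩
    refine LinearMap.ext₂ fun x y => ?_
    rw [act_apply, ← hg]
    simp

theorem orbit_refl (μ : AlgStr k n) : μ ∈ orbit μ :=
  mem_orbit_iff.2 ⟨LinearEquiv.refl k _, fun _ _ => rfl⟩

theorem orbit_symm {μ χ : AlgStr k n} (h : χ ∈ orbit μ) : μ ∈ orbit χ := by
  obtain ⟨g, hg⟩ := mem_orbit_iff.1 h
  refine mem_orbit_iff.2 ⟨g.symm, fun x y => ?_⟩
  rw [LinearEquiv.eq_symm_apply, ← hg]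
  simp

theorem orbit_trans {μ χ ψ : AlgStr k n} (h : χ ∈ orbit μ) (h' : ψ ∈ orbit χ) : ψ ∈ orbit μ := by
  obtain ⟨g, hg⟩ := mem_orbit_iff.1 h
  obtain ⟨g', hg'⟩ := mem_orbit_iff.1 h'
  exact mem_orbit_iff.2 ⟨g.trans g', fun x y => by simp [hg, hg']⟩

/-- The algebra of polynomial functions in the structure constants. -/
noncomputable def polyFun (k : Type*) [Field k] (n : ℕ) : Subalgebra k (AlgStr k n → k) :=
  (AlgHom.pi (fun μ : AlgStr k n => MvPolynomial.aeval (R := k) (structConst μ))).range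

theorem structConst_mem_polyFun (p : Fin n × Fin n × Fin n) :
    (fun μ : AlgStr k n => structConst μ p) ∈ polyFun k n :=
  ⟨MvPolynomial.X p, by ext μ; simp⟩

/-- All closedness statements below reduce to this one: exhibit a polynomial function that vanishes
on the orbit. -/
theorem eq_zero_of_degenerates {F : AlgStr k n → k} (hF : F ∈ polyFun k n) {μ χ : AlgStr k n}
    (h : ∀ ν ∈ orbit μ, F ν = 0) (hd : Degenerates μ χ) : F χ = 0 := by
  obtain ⟨p, rfl⟩ := hF
  refine hd p ?_
  rintro _ ⟨ν, hν, rfl⟩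
  exact h ν hν

/-- The structure constants as a linear map. -/
def structConstLin (k : Type*) [Field k] (n : ℕ) :
    AlgStr k n →ₗ[k] (Fin n × Fin n × Fin n → k) where
  toFun := structConst
  map_add' _ _ := rfl
  map_smul' _ _ := rfl

theorem ext_structConst {μ χ : AlgStr k n}
    (h : ∀ i j, μ (Pi.single i 1) (Pi.single j 1) = χ (Pi.single i 1) (Pi.single j 1)) : μ = χ := by
  refine (Pi.basisFun k (Fin n)).ext fun i => (Pi.basisFun k (Fin n)).ext fun j => ?_
  simpa using h i j

theorem map_eq_sum_single {ι : Type*} [Fintype ι] [DecidableEq ι] {W : Type*} [AddCommGroup W]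
    [Module k W] (φ : (ι → k) →ₗ[k] W) (x : ι → k) : φ x = ∑ i, x i • φ (Pi.single i 1) := by
  conv_lhs => rw [pi_eq_sum_univ' x]
  simp only [map_sum, map_smul]

/-- Structure constants determine a structure linearly and injectively, so every linear functional
factors through them. -/
theorem linear_mem_polyFun (φ : AlgStr k n →ₗ[k] k) :
    (fun μ => φ μ) ∈ polyFun k n := by
  have hinj : Function.Injective (structConstLin k n) := fun μ χ h =>
    ext_structConst fun i j => funext fun l => congrFun h (i, j, l)
  obtain ⟨L, hL⟩ := LinearMap.exists_leftInverse_of_injective (K := k) (V := AlgStr k n)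
    (structConstLin k n) (LinearMap.ker_eq_bot.2 hinj)
  have : (fun μ => φ μ) = ∑ p : Fin n × Fin n × Fin n,
      φ (L (Pi.single p 1)) • (fun μ : AlgStr k n => structConst μ p) := by
    ext μ
    have h1 : φ μ = (φ ∘ₗ L) (structConstLin k n μ) := by
      rw [LinearMap.comp_apply]
      exact congrArg φ (LinearMap.congr_fun hL μ).symm
    rw [h1, map_eq_sum_single]
    simp only [Finset.sum_apply, Pi.smul_apply, smul_eq_mul, mul_comm, LinearMap.comp_apply]
    rfl
  rw [this]
  exact Subalgebra.sum_mem _ fun p _ => Subalgebra.smul_mem _ (structConst_mem_polyFun p) _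

theorem apply_mem_polyFun (f : (Fin n → k) →ₗ[k] k) (x y : Fin n → k) :
    (fun μ : AlgStr k n => f (μ x y)) ∈ polyFun k n :=
  linear_mem_polyFun (f ∘ₗ LinearMap.applyₗ y ∘ₗ LinearMap.applyₗ x)

/-- Multiplying a polynomial family of vectors by a fixed vector gives a polynomial family. -/
theorem mul_mem_polyFun (x : Fin n → k) {v : AlgStr k n → Fin n → k}
    (hv : ∀ l, (fun μ => v μ l) ∈ polyFun k n) (l : Fin n) :
    (fun μ : AlgStr k n => μ x (v μ) l) ∈ polyFun k n := by
  have : (fun μ : AlgStr k n => μ x (v μ) l) =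
      ∑ p, (fun μ => v μ p) * (fun μ : AlgStr k n => μ x (Pi.single p 1) l) := by
    ext μ
    conv_lhs => rw [map_eq_sum_single (μ x) (v μ)]
    simp only [Finset.sum_apply, Pi.smul_apply, smul_eq_mul, Pi.mul_apply]
  rw [this]
  exact Subalgebra.sum_mem _ fun p _ => Subalgebra.mul_mem _ (hv p)
    (apply_mem_polyFun (LinearMap.proj l) x _)

/-- Rank is lower semicontinuous. If the vectors at `χ` were independent, some `φ` would send them
to the standard basis; the determinant of the images under `φ` is polynomial in the structure,
vanishes on the orbit and equals one at `χ`. -/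
theorem not_linearIndependent_of_degenerates {ι : Type*} [Fintype ι] [DecidableEq ι]
    {W : Type*} [AddCommGroup W] [Module k W] (v : ι → AlgStr k n →ₗ[k] W) {μ χ : AlgStr k n}
    (h : ∀ ν ∈ orbit μ, ¬ LinearIndependent k (fun i => v i ν)) (hd : Degenerates μ χ) :
    ¬ LinearIndependent k (fun i => v i χ) := by
  intro hli
  obtain ⟨φ, hφ⟩ := (Fintype.linearCombination k (fun i => v i χ)).exists_leftInverse_of_injective
    (LinearMap.ker_eq_bot.2 hli.fintypeLinearCombination_injective)
  have hφ' : ∀ i, φ (v i χ) = Pi.single i 1 := by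
    intro i
    have := LinearMap.congr_fun hφ (Pi.single i 1)
    simpa using this
  have hF : (fun ν => Matrix.det (Matrix.of fun i j => φ (v i ν) j)) ∈ polyFun k n := by
    have : (fun ν => Matrix.det (Matrix.of fun i j => φ (v i ν) j)) =
        ∑ σ : Equiv.Perm ι, ((Equiv.Perm.sign σ : ℤ) : k) •
          ∏ i, (fun ν => φ (v (σ i) ν) i) := by
      ext ν
      simp [Matrix.det_apply', Finset.sum_apply, Finset.prod_apply]
    rw [this]
    exact Subalgebra.sum_mem _ fun σ _ => Subalgebra.smul_mem _
      (Subalgebra.prod_mem _ fun i _ => linear_mem_polyFun (LinearMap.proj i ∘ₗ φ ∘ₗ v (σ i))) _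
  have h0 := eq_zero_of_degenerates hF (fun ν hν => ?_) hd
  · have h1 : (Matrix.of fun i j => φ (v i χ) j) = (1 : Matrix ι ι k) := by
      ext i j
      simp [hφ', Matrix.one_apply, Pi.single_apply, eq_comm]
    simp only [h1, Matrix.det_one, one_ne_zero] at h0
  · by_contra hne
    have := Matrix.linearIndependent_rows_of_det_ne_zero hne
    exact h ν hν (LinearIndependent.of_comp φ this)

end Structures

/-! ### Conditions inherited by degenerations -/

section Conditions

variable {k : Type*} [Field k] {n : ℕ}

/-- All squares are zero. -/
def Alternating (μ : AlgStr k n) : Prop := ∀ x, μ x x = 0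

/-- All left multiplications have zero `m`-th power. -/
def EngelOf (m : ℕ) (μ : AlgStr k n) : Prop := ∀ x, μ x ^ m = 0

/-- The identity `a (a b) = 0`. -/
def TwoEngel (μ : AlgStr k n) : Prop := ∀ a b, μ a (μ a b) = 0

/-- The identity `(x y) z = 0`. -/
def TwoStep (μ : AlgStr k n) : Prop := ∀ x y z, μ (μ x y) z = 0

/-- Any `r + 1` products are linearly dependent. -/
def DerivedRankLE (r : ℕ) (μ : AlgStr k n) : Prop :=
  ∀ x y : Fin (r + 1) → Fin n → k, ¬ LinearIndependent k (fun i => μ (x i) (y i))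

/-- Any `r + 1` left multiplications are linearly dependent. -/
def AnnCorankLE (r : ℕ) (μ : AlgStr k n) : Prop :=
  ∀ x : Fin (r + 1) → Fin n → k, ¬ LinearIndependent k (fun i => μ (x i))

/-- The three pairwise products of any three vectors are linearly dependent. -/
def TriangleDep (μ : AlgStr k n) : Prop :=
  ∀ x : Fin 3 → Fin n → k,
    ¬ LinearIndependent k (fun i : Fin 3 => μ (x (![0, 0, 1] i)) (x (![1, 2, 2] i)))

/-- The Pfaffian of the form `f (x y)` on four vectors. -/
def pf (μ : AlgStr k n) (f : (Fin n → k) →ₗ[k] k) (x y z w : Fin n → k) : k :=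
  f (μ x y) * f (μ z w) - f (μ x z) * f (μ y w) + f (μ x w) * f (μ y z)

/-- All the forms `f (x y)` have rank at most two. -/
def PfZero (μ : AlgStr k n) : Prop := ∀ f x y z w, pf μ f x y z w = 0

/-- The Pfaffian, as a quadratic form in `f`, has zero discriminant on every pencil. -/
def PfSquare (μ : AlgStr k n) : Prop := ∀ f g x y z w,
  (pf μ (f + g) x y z w - pf μ f x y z w - pf μ g x y z w) ^ 2 =
    4 * pf μ f x y z w * pf μ g x y z w

/-- A property of structures that is inherited by all degenerations. -/
def Closed (P : AlgStr k n → Prop) : Prop := ∀ μ χ, P μ → Degenerates μ χ → P χ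

theorem degenerates_of_mem_orbit {μ χ : AlgStr k n} (h : χ ∈ orbit μ) : Degenerates μ χ := by
  intro p hp
  exact hp _ ⟨χ, h, rfl⟩

theorem Closed.of_orbit {P : AlgStr k n → Prop} (h : Closed P) {μ χ : AlgStr k n} (hμ : P μ)
    (hχ : χ ∈ orbit μ) : P χ := h μ χ hμ (degenerates_of_mem_orbit hχ)

theorem closed_alternating : Closed (Alternating : AlgStr k n → Prop) := by
  intro μ χ hμ hd x
  ext l
  refine eq_zero_of_degenerates (apply_mem_polyFun (LinearMap.proj l) x x) ?_ hd
  intro ν hν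
  obtain ⟨g, hg⟩ := mem_orbit_iff.1 hν
  obtain ⟨x, rfl⟩ := g.surjective x
  simp [hg, hμ x]

theorem pow_mem_polyFun (m : ℕ) (x y : Fin n → k) (l : Fin n) :
    (fun μ : AlgStr k n => (μ x ^ m) y l) ∈ polyFun k n := by
  induction m generalizing l with
  | zero =>
    exact Subalgebra.algebraMap_mem (polyFun k n) (y l)
  | succ m ih =>
    have : (fun μ : AlgStr k n => (μ x ^ (m + 1)) y l) = fun μ => μ x ((μ x ^ m) y) l := by
      ext μ
      rw [pow_succ', Module.End.mul_apply]
    rw [this]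
    exact mul_mem_polyFun x ih l

/-- With the exponent fixed, nilpotency of all left multiplications is a polynomial identity. -/
theorem closed_engelOf (m : ℕ) : Closed (EngelOf m : AlgStr k n → Prop) := by
  intro μ χ hμ hd x
  refine LinearMap.ext fun y => ?_
  ext l
  refine eq_zero_of_degenerates (pow_mem_polyFun m x y l) ?_ hd
  intro ν hν
  obtain ⟨g, hg⟩ := mem_orbit_iff.1 hν
  obtain ⟨x, rfl⟩ := g.surjective x
  obtain ⟨y, rfl⟩ := g.surjective y
  have : ∀ m, (ν (g x) ^ m) (g y) = g ((μ x ^ m) y) := by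
    intro m
    induction m with
    | zero => simp
    | succ m ih => rw [pow_succ', Module.End.mul_apply, ih, hg, pow_succ', Module.End.mul_apply]
  simp [this, hμ x]

/-- Alternation is carried along because `mul_mem_polyFun` handles a variable factor on the right
only; anticommutativity turns `(x y) z` into `- z (x y)`. -/
theorem closed_twoStep : Closed (fun μ : AlgStr k n => Alternating μ ∧ TwoStep μ) := by
  rintro μ χ ⟨ha, hμ⟩ hd
  have ha' := closed_alternating μ χ ha hd
  refine ⟨ha', fun x y z => ?_⟩
  have hz : χ z (χ x y) = 0 := by
    ext l
    refine eq_zero_of_degenerates (F := fun χ => χ z (χ x y) l)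
      (mul_mem_polyFun z (fun l => apply_mem_polyFun (LinearMap.proj l) x y) l) ?_ hd
    intro ν hν
    obtain ⟨g, hg⟩ := mem_orbit_iff.1 hν
    obtain ⟨x, rfl⟩ := g.surjective x
    obtain ⟨y, rfl⟩ := g.surjective y
    obtain ⟨z, rfl⟩ := g.surjective z
    have : μ z (μ x y) = 0 := by
      have := ha (z + μ x y)
      simpa [ha z, ha (μ x y), hμ x y z] using this
    simp [hg, this]
  have := ha' (χ x y + z)
  simpa [ha' z, ha' (χ x y), hz] using this

theorem closed_derivedRankLE (r : ℕ) : Closed (DerivedRankLE r : AlgStr k n → Prop) := by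
  intro μ χ hμ hd x y
  refine not_linearIndependent_of_degenerates
    (fun i => LinearMap.applyₗ (y i) ∘ₗ LinearMap.applyₗ (x i)) ?_ hd
  intro ν hν hli
  obtain ⟨g, hg⟩ := mem_orbit_iff.1 hν
  refine hμ (fun i => g.symm (x i)) (fun i => g.symm (y i)) (LinearIndependent.of_comp g.toLinearMap ?_)
  have he : (g.toLinearMap ∘ fun i => μ (g.symm (x i)) (g.symm (y i))) =
      fun i => ν (x i) (y i) := by funext i; simp [← hg]
  rw [he]
  exact hli

theorem closed_triangleDep : Closed (TriangleDep : AlgStr k n → Prop) := by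
  intro μ χ hμ hd x
  refine not_linearIndependent_of_degenerates
    (fun i : Fin 3 => LinearMap.applyₗ (x (![1, 2, 2] i)) ∘ₗ
      LinearMap.applyₗ (x (![0, 0, 1] i))) ?_ hd
  intro ν hν hli
  obtain ⟨g, hg⟩ := mem_orbit_iff.1 hν
  refine hμ (fun i => g.symm (x i)) (LinearIndependent.of_comp g.toLinearMap ?_)
  have he : (g.toLinearMap ∘ fun i : Fin 3 => μ (g.symm (x (![0, 0, 1] i)))
      (g.symm (x (![1, 2, 2] i)))) =
      fun i : Fin 3 => ν (x (![0, 0, 1] i)) (x (![1, 2, 2] i)) := by funext i; simp [← hg]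
  rw [he]
  exact hli

theorem closed_annCorankLE (r : ℕ) : Closed (AnnCorankLE r : AlgStr k n → Prop) := by
  intro μ χ hμ hd x
  refine not_linearIndependent_of_degenerates (fun i => LinearMap.applyₗ (x i)) ?_ hd
  intro ν hν hli
  obtain ⟨g, hg⟩ := mem_orbit_iff.1 hν
  refine hμ (fun i => g.symm (x i)) ?_
  rw [Fintype.linearIndependent_iff] at hli ⊢
  intro c hc
  refine hli c (LinearMap.ext fun y => ?_)
  have := congrArg g (LinearMap.congr_fun hc (g.symm y))
  simpa [← hg] using this

theorem pf_mem_polyFun (f : (Fin n → k) →ₗ[k] k) (x y z w : Fin n → k) :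
    (fun μ : AlgStr k n => pf μ f x y z w) ∈ polyFun k n :=
  Subalgebra.add_mem _ (Subalgebra.sub_mem _
    (Subalgebra.mul_mem _ (apply_mem_polyFun f x y) (apply_mem_polyFun f z w))
    (Subalgebra.mul_mem _ (apply_mem_polyFun f x z) (apply_mem_polyFun f y w)))
    (Subalgebra.mul_mem _ (apply_mem_polyFun f x w) (apply_mem_polyFun f y z))

theorem exists_pf_eq {μ ν : AlgStr k n} (hν : ν ∈ orbit μ) (x y z w : Fin n → k) :
    ∃ (g : (Fin n → k) →ₗ[k] (Fin n → k)) (x' y' z' w' : Fin n → k),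
      ∀ f, pf ν f x y z w = pf μ (f ∘ₗ g) x' y' z' w' := by
  obtain ⟨g, hg⟩ := mem_orbit_iff.1 hν
  refine ⟨g, g.symm x, g.symm y, g.symm z, g.symm w, fun f => ?_⟩
  simp [pf, ← hg]

theorem closed_pfZero : Closed (PfZero : AlgStr k n → Prop) := by
  intro μ χ hμ hd f x y z w
  refine eq_zero_of_degenerates (pf_mem_polyFun f x y z w) ?_ hd
  intro ν hν
  obtain ⟨g, x', y', z', w', h⟩ := exists_pf_eq hν x y z w
  rw [h, hμ]

theorem closed_pfSquare : Closed (PfSquare : AlgStr k n → Prop) := by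
  intro μ χ hμ hd f g x y z w
  refine sub_eq_zero.1 (eq_zero_of_degenerates (F := fun χ =>
    (pf χ (f + g) x y z w - pf χ f x y z w - pf χ g x y z w) ^ 2 -
      4 * pf χ f x y z w * pf χ g x y z w) ?_ ?_ hd)
  · have hp := fun f => pf_mem_polyFun f x y z w
    exact Subalgebra.sub_mem _ (Subalgebra.pow_mem _ (Subalgebra.sub_mem _ (Subalgebra.sub_mem _
      (hp _) (hp _)) (hp _)) 2) (Subalgebra.mul_mem _ (Subalgebra.mul_mem _
        (Subalgebra.algebraMap_mem _ (4 : k)) (hp _)) (hp _))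
  · intro ν hν
    obtain ⟨a, x', y', z', w', h⟩ := exists_pf_eq hν x y z w
    rw [h, h, h, LinearMap.add_comp, hμ, sub_self]

end Conditions
-- Adapted bases and contraction by weights
section Bases

open Module

variable {k : Type*} [Field k] {n : ℕ}

theorem mem_orbit_of_basis {μ X : AlgStr k n} (e : Basis (Fin n) k (Fin n → k))
    (h : ∀ i j, μ (e i) (e j) = e.equivFun.symm (X (Pi.single i 1) (Pi.single j 1))) :
    X ∈ orbit μ := by
  refine mem_orbit_iff.2 ⟨e.equivFun, fun x y => ?_⟩
  have : X.compl₁₂ e.equivFun.toLinearMap e.equivFun.toLinearMap =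
      μ.compr₂ e.equivFun.toLinearMap := by
    refine e.ext fun i => e.ext fun j => ?_
    have hs : ∀ i, e.equivFun (e i) = Pi.single i 1 := fun i => by
      ext l; simp [Pi.single_apply, eq_comm]
    simp only [LinearMap.compl₁₂_apply, LinearMap.compr₂_apply, LinearEquiv.coe_coe, hs, h,
      LinearEquiv.apply_symm_apply]
  exact LinearMap.congr_fun₂ this x y

theorem Alternating.swap {μ : AlgStr k n} (h : Alternating μ) (x y : Fin n → k) :
    μ x y = - μ y x := by
  have := h (x + y)
  simp only [map_add, LinearMap.add_apply, h x, h y, zero_add, add_zero] at this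
  exact eq_neg_of_add_eq_zero_right this

/-- When all basic vectors from position `m` on annihilate, alternation leaves only the products
with `i < j < m` to compare. -/
theorem mem_orbit_of_active {μ X : AlgStr k n} (hμ : Alternating μ) (hX : Alternating X)
    (e : Basis (Fin n) k (Fin n → k)) (m : ℕ) (h0 : ∀ j : Fin n, m ≤ j.val → μ (e j) = 0)
    (hX0 : ∀ j : Fin n, m ≤ j.val → X (Pi.single j 1) = 0)
    (h : ∀ i j : Fin n, i.val < j.val → j.val < m →
      μ (e i) (e j) = e.equivFun.symm (X (Pi.single i 1) (Pi.single j 1))) :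
    X ∈ orbit μ := by
  refine mem_orbit_of_basis e fun i j => ?_
  by_cases hi : m ≤ i.val
  · simp [h0 i hi, hX0 i hi]
  by_cases hj : m ≤ j.val
  · rw [hμ.swap, hX.swap, h0 j hj, hX0 j hj]
    simp
  push Not at hi hj
  rcases lt_trichotomy i j with hij | rfl | hij
  · exact h i j hij hj
  · rw [hμ, hX, map_zero]
  · rw [hμ.swap, hX.swap, h j i hij hi, map_neg]

theorem mem_span_image_of_forall_lt (e : Basis (Fin n) k (Fin n → k)) {w : Fin n → ℕ} {c : ℕ}
    (h : ∀ l, w l < c) (v : Fin n → k) : v ∈ Submodule.span k (e '' {l | w l < c}) := by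
  have : {l | w l < c} = Set.univ := Set.eq_univ_of_forall h
  rw [this, Set.image_univ, e.span_eq]
  trivial

/-- A one-parameter torus acting with weights `w` on a basis `e` contracts `μ` to `X`. -/
theorem degenerates_of_weights [Infinite k] {μ X : AlgStr k n} (e : Basis (Fin n) k (Fin n → k))
    (w : Fin n → ℕ)
    (hX : ∀ i j, e.equivFun.symm (X (Pi.single i 1) (Pi.single j 1)) ∈
      Submodule.span k (e '' {l | w l = w i + w j}))
    (hlt : ∀ i j, μ (e i) (e j) - e.equivFun.symm (X (Pi.single i 1) (Pi.single j 1)) ∈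
      Submodule.span k (e '' {l | w l < w i + w j})) : Degenerates μ X := by
  have hr : ∀ x l, e.repr (e.equivFun.symm x) l = x l := fun x l => by
    rw [← Basis.equivFun_apply, LinearEquiv.apply_symm_apply]
  have h1 : ∀ i j l, w l ≠ w i + w j → X (Pi.single i 1) (Pi.single j 1) l = 0 := by
    intro i j l hl
    have := (e.mem_span_image).1 (hX i j)
    by_contra hne
    refine hl (this ?_)
    rwa [Finset.mem_coe, Finsupp.mem_support_iff, hr]
  have h2 : ∀ i j l, w i + w j ≤ w l →
      e.repr (μ (e i) (e j)) l = X (Pi.single i 1) (Pi.single j 1) l := by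
    intro i j l hl
    have := (e.mem_span_image).1 (hlt i j)
    by_contra hne
    refine absurd (this (a := l) ?_) (not_lt.2 hl)
    rwa [Finset.mem_coe, Finsupp.mem_support_iff, map_sub, Finsupp.sub_apply, hr, sub_ne_zero]
  intro p hp
  -- In the basis `t ^ w i • e i` the structure constants of `μ` are multiplied by `t ^ (w i + w j -
  -- w l)`. The truncated subtraction is harmless, since the constant is zero when `w l > w i + w
  -- j`. For `t ≠ 0` these are constants of a point of the orbit, so `q` has infinitely many roots.
  let q : Polynomial k := MvPolynomial.aeval (fun s : Fin n × Fin n × Fin n =>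
    Polynomial.C (e.repr (μ (e s.1) (e s.2.1)) s.2.2) *
      Polynomial.X ^ (w s.1 + w s.2.1 - w s.2.2)) p
  have hq : ∀ t : k, q.eval t = MvPolynomial.aeval (fun s : Fin n × Fin n × Fin n =>
    e.repr (μ (e s.1) (e s.2.1)) s.2.2 * t ^ (w s.1 + w s.2.1 - w s.2.2)) p := by
    intro t
    have : q.eval t = Polynomial.aeval t q := by simp [Polynomial.aeval_def, Polynomial.eval₂_id]
    rw [this, ← AlgHom.comp_apply, MvPolynomial.comp_aeval]
    congr 2
    ext s
    simp
  have hz : q = 0 := by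
    refine Polynomial.eq_zero_of_infinite_isRoot _ (Set.Infinite.mono ?_
      (Set.Finite.infinite_compl (Set.finite_singleton (0 : k))))
    intro t ht
    have ht : t ≠ 0 := ht
    rw [Set.mem_ofPred_eq, Polynomial.IsRoot, hq]
    refine hp _ ⟨act ((e.unitsSMul fun i => Units.mk0 (t ^ w i) (pow_ne_zero _ ht)).equivFun) μ,
      ⟨_, rfl⟩, ?_⟩
    ext ⟨i, j, l⟩
    simp only [structConst, act_apply, Basis.equivFun_symm_apply]
    have hs : ∀ i : Fin n, ∑ x, (Pi.single i (1 : k) : Fin n → k) x •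
        (e.unitsSMul fun i => Units.mk0 (t ^ w i) (pow_ne_zero _ ht)) x = t ^ w i • e i := by
      intro i
      rw [Finset.sum_eq_single i]
      · simp [Basis.unitsSMul_apply, Units.smul_def]
      · intro b _ hb
        simp [hb]
      · simp
    rw [hs, hs]
    simp only [map_smul, LinearMap.smul_apply, Pi.smul_apply, smul_eq_mul, Basis.equivFun_apply,
      Basis.repr_unitsSMul, Units.smul_def, Units.val_inv_eq_inv_val, Units.val_mk0]
    by_cases hc : e.repr (μ (e i) (e j)) l = 0
    · simp [hc]
    · have hle : w l ≤ w i + w j := by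
        by_contra hgt
        push Not at hgt
        exact hc (by rw [h2 i j l hgt.le, h1 i j l hgt.ne'])
      have : t ^ (w i + w j) = t ^ (w i + w j - w l) * t ^ w l := by
        rw [← pow_add, Nat.sub_add_cancel hle]
      have htl := pow_ne_zero (w l) ht
      field_simp
      rw [← pow_add, add_comm (w j), this, mul_comm]
  -- At `t = 0` exactly the constants with `w l = w i + w j` survive, as `0 ^ 0 = 1`, and these are
  -- the constants of `X`.
  have h0 := hq 0
  rw [hz, Polynomial.eval_zero] at h0
  rw [h0]
  congr 2
  ext ⟨i, j, l⟩
  simp only [structConst]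
  rcases lt_trichotomy (w l) (w i + w j) with h | h | h
  · rw [h1 i j l h.ne, zero_pow (Nat.sub_pos_of_lt h).ne', mul_zero]
  · rw [h2 i j l h.ge, h]
    simp
  · rw [h2 i j l h.le, h1 i j l h.ne', zero_mul]

theorem degenerates_of_weights_active [Infinite k] {μ X : AlgStr k n} (hμ : Alternating μ)
    (hX : Alternating X) (e : Basis (Fin n) k (Fin n → k)) (w : Fin n → ℕ) (m : ℕ)
    (hX0 : ∀ j : Fin n, m ≤ j.val → X (Pi.single j 1) = 0)
    (h1 : ∀ i j : Fin n, m ≤ j.val →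
      μ (e i) (e j) ∈ Submodule.span k (e '' {l | w l < w i + w j}))
    (h2 : ∀ i j : Fin n, i.val < j.val → j.val < m →
      e.equivFun.symm (X (Pi.single i 1) (Pi.single j 1)) ∈
        Submodule.span k (e '' {l | w l = w i + w j}) ∧
      μ (e i) (e j) - e.equivFun.symm (X (Pi.single i 1) (Pi.single j 1)) ∈
        Submodule.span k (e '' {l | w l < w i + w j})) : Degenerates μ X := by
  have key : ∀ i j : Fin n, e.equivFun.symm (X (Pi.single i 1) (Pi.single j 1)) ∈
        Submodule.span k (e '' {l | w l = w i + w j}) ∧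
      μ (e i) (e j) - e.equivFun.symm (X (Pi.single i 1) (Pi.single j 1)) ∈
        Submodule.span k (e '' {l | w l < w i + w j}) := by
    intro i j
    by_cases hj : m ≤ j.val
    · rw [hX.swap, hX0 j hj]
      simpa using h1 i j hj
    by_cases hi : m ≤ i.val
    · rw [hX0 i hi, hμ.swap, add_comm (w i)]
      simpa using h1 j i hi
    push Not at hi hj
    rcases lt_trichotomy i j with hij | rfl | hij
    · exact h2 i j hij hj
    · rw [hμ, hX]
      simp
    · rw [hμ.swap, hX.swap, add_comm (w i), map_neg, neg_sub_neg]
      have := h2 j i hij hi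
      refine ⟨Submodule.neg_mem _ this.1, ?_⟩
      rw [← neg_sub]
      exact Submodule.neg_mem _ this.2
  exact degenerates_of_weights e w (fun i j => (key i j).1) fun i j => (key i j).2

theorem exists_perm_comp_eq {p : ℕ} {σ ρ : Fin p → Fin n} (hσ : Function.Injective σ)
    (hρ : Function.Injective ρ) : ∃ π : Equiv.Perm (Fin n), ∀ s, π (σ s) = ρ s := by
  classical
  let τ : {x // x ∈ Set.range σ} ≃ {x // x ∈ Set.range ρ} :=
    (Equiv.ofInjective σ hσ).symm.trans (Equiv.ofInjective ρ hρ)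
  refine ⟨τ.extendSubtype, fun s => ?_⟩
  rw [Equiv.extendSubtype_apply_of_mem τ (σ s) ⟨s, rfl⟩]
  have : (⟨σ s, ⟨s, rfl⟩⟩ : {x // x ∈ Set.range σ}) = Equiv.ofInjective σ hσ s := rfl
  rw [this]
  simp [τ]

/-- A linearly independent family can be placed at prescribed positions of a basis whose remaining
members lie in a given supplementary subspace. -/
theorem exists_basis_extension {p : ℕ} {v : Fin p → Fin n → k} (hv : LinearIndependent k v)
    {σ : Fin p → Fin n} (hσ : Function.Injective σ) (S : Submodule k (Fin n → k))
    (hS : ∀ x, ∃ s ∈ S, x - s ∈ Submodule.span k (Set.range v)) :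
    ∃ e : Basis (Fin n) k (Fin n → k), (∀ s, e (σ s) = v s) ∧
      ∀ j, j ∉ Set.range σ → e j ∈ S := by
  -- Extending inside the union of the family and `S` makes every added basic vector lie in `S`; a
  -- permutation then brings the family to its prescribed positions.
  obtain ⟨b, hb, hvb, hspan, hli⟩ := exists_linearIndepOn_id_extension
    (hv.linearIndepOn_id) (Set.subset_union_left (t := (S : Set (Fin n → k))))
  have htop : ⊤ ≤ Submodule.span k (Set.range ((↑) : b → Fin n → k)) := by
    rintro x -
    obtain ⟨s, hs, hxs⟩ := hS x
    rw [Subtype.range_coe]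
    have h1 : s ∈ Submodule.span k b := hspan (Or.inr hs)
    have h2 : x - s ∈ Submodule.span k b :=
      Submodule.span_mono hvb hxs
    simpa using Submodule.add_mem _ h2 h1
  let e0 : Basis b k (Fin n → k) := Basis.mk hli htop
  have : Fintype b := FiniteDimensional.fintypeBasisIndex e0
  have hcard : Fintype.card b = n := by
    rw [← Module.finrank_eq_card_basis e0, Module.finrank_fin_fun]
  let e1 : Basis (Fin n) k (Fin n → k) := e0.reindex (Fintype.equivFinOfCardEq hcard)
  have hmem : ∀ j, e1 j ∈ b := by
    intro j
    simp [e1, e0]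
  have hrho : ∀ s, ∃ j, e1 j = v s := by
    intro s
    refine ⟨Fintype.equivFinOfCardEq hcard ⟨v s, hvb ⟨s, rfl⟩⟩, ?_⟩
    simp [e1, e0]
  choose ρ hρ using hrho
  have hρi : Function.Injective ρ := by
    intro s t hst
    apply hv.injective
    rw [← hρ, hst, hρ]
  obtain ⟨π, hπ⟩ := exists_perm_comp_eq hσ hρi
  refine ⟨e1.reindex π.symm, fun s => by simp [hπ, hρ], fun j hj => ?_⟩
  have hm := hb (hmem (π j))
  rcases hm with ⟨s, hs⟩ | hm
  · exfalso
    rw [← hρ, ← hπ] at hs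
    exact hj ⟨s, π.injective (e1.injective hs)⟩
  · simpa using hm

end Bases
-- The model structures on basic vectors
section Tables

open Module

variable {k : Type*} [Field k] {n : ℕ}

/-- The standard basic vector `e_l`, with `l` counted from `1`. -/
def vec (k : Type*) [Field k] (n l : ℕ) : Fin n → k := fun r => if r.val + 1 = l then 1 else 0

theorem coord_single (i : ℕ) (p : Fin n) :
    coord i (Pi.single p 1 : Fin n → k) = if p.val + 1 = i then 1 else 0 := by
  rw [coord, Finset.sum_eq_single p]
  · simp
  · intro b _ hb
    simp [hb]
  · simp

theorem coord_vec {i l : ℕ} (hl : 1 ≤ l) (hln : l ≤ n) :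
    coord i (vec k n l) = if l = i then 1 else 0 := by
  obtain ⟨l, rfl⟩ := Nat.exists_eq_add_of_le' hl
  have : vec k n (l + 1) = Pi.single (⟨l, hln⟩ : Fin n) 1 := by
    ext r
    simp [vec, Pi.single_apply, Fin.ext_iff]
  rw [this, coord_single]

theorem coord_add (i : ℕ) (x y : Fin n → k) : coord i (x + y) = coord i x + coord i y := by
  simp only [coord, Pi.add_apply, ← Finset.sum_filter, Finset.sum_add_distrib]

theorem coord_smul (i : ℕ) (c : k) (x : Fin n → k) : coord i (c • x) = c * coord i x := by
  simp only [coord, Pi.smul_apply, smul_eq_mul, ← Finset.sum_filter, ← Finset.mul_sum]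

theorem eps_apply (i j l : ℕ) (x y : Fin n → k) :
    eps k n i j l x y = (coord i x * coord j y - coord j x * coord i y) • vec k n l := by
  ext r
  simp [eps, vec, LinearMap.mk₂_apply]

theorem eps_single (i j l : ℕ) (p q : Fin n) :
    eps k n i j l (Pi.single p 1) (Pi.single q 1) =
      ((if p.val + 1 = i then 1 else 0) * (if q.val + 1 = j then 1 else 0) -
        (if p.val + 1 = j then 1 else 0) * (if q.val + 1 = i then 1 else 0) : k) • vec k n l := by
  rw [eps_apply, coord_single, coord_single, coord_single, coord_single]

theorem eps_single_eq_zero {i j : ℕ} (l : ℕ) {p : Fin n} (hi : p.val + 1 ≠ i)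
    (hj : p.val + 1 ≠ j) : eps k n i j l (Pi.single p 1) = 0 := by
  refine LinearMap.ext fun y => ?_
  rw [eps_apply, coord_single, coord_single, if_neg hi, if_neg hj]
  simp

theorem Alternating.add {μ ν : AlgStr k n} (h : Alternating μ) (h' : Alternating ν) :
    Alternating (μ + ν) := fun x => by simp [h x, h' x]

theorem alternating_eps (i j l : ℕ) : Alternating (eps k n i j l) := fun x => by
  rw [eps_apply, mul_comm, sub_self, zero_smul]

theorem alternating_zero : Alternating (0 : AlgStr k n) := fun _ => rfl

theorem alternating_eta (m : ℕ) : Alternating (eta k n m) := by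
  unfold eta
  refine Finset.sum_induction _ _ (fun _ _ => Alternating.add) alternating_zero
    fun i _ => alternating_eps _ _ _

theorem alternating_T3 : Alternating (T3 k n) := (alternating_eps _ _ _).add (alternating_eps _ _ _)

theorem alternating_T22 : Alternating (T22 k n) :=
  (alternating_eps _ _ _).add (alternating_eps _ _ _)

theorem alternating_T22eps23 : Alternating (T22eps23 k n) :=
  alternating_T22.add (alternating_eps _ _ _)

theorem alternating_T22eps24 : Alternating (T22eps24 k n) :=
  alternating_T22.add (alternating_eps _ _ _)

theorem alternating_T222 : Alternating (T222 k n) :=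
  ((alternating_eps _ _ _).add (alternating_eps _ _ _)).add (alternating_eps _ _ _)

theorem T3_single {j : Fin n} (hj : 3 ≤ j.val) : T3 k n (Pi.single j 1) = 0 := by
  rw [T3, LinearMap.add_apply, eps_single_eq_zero, eps_single_eq_zero, add_zero] <;> omega

theorem T22_single {j : Fin n} (hj : 3 ≤ j.val) : T22 k n (Pi.single j 1) = 0 := by
  rw [T22, LinearMap.add_apply, eps_single_eq_zero, eps_single_eq_zero, add_zero] <;> omega

theorem T22eps23_single {j : Fin n} (hj : 3 ≤ j.val) : T22eps23 k n (Pi.single j 1) = 0 := by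
  rw [T22eps23, LinearMap.add_apply, T22_single hj, eps_single_eq_zero, add_zero] <;> omega

theorem T22eps24_single {j : Fin n} (hj : 4 ≤ j.val) : T22eps24 k n (Pi.single j 1) = 0 := by
  rw [T22eps24, LinearMap.add_apply, T22_single (by omega), eps_single_eq_zero, add_zero] <;> omega

theorem T222_single {j : Fin n} (hj : 4 ≤ j.val) : T222 k n (Pi.single j 1) = 0 := by
  rw [T222, LinearMap.add_apply, LinearMap.add_apply, eps_single_eq_zero, eps_single_eq_zero,
    eps_single_eq_zero, add_zero, add_zero] <;> omega

theorem eta_single_eq_zero {m : ℕ} {j : Fin n} (hj : 2 * m ≤ j.val) :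
    eta k n m (Pi.single j 1) = 0 := by
  rw [eta, LinearMap.sum_apply]
  refine Finset.sum_eq_zero fun i hi => eps_single_eq_zero _ ?_ ?_ <;>
  · rw [Finset.mem_Icc] at hi
    omega

/-- Indices of `Fin n` start at zero, so the pairs `(2r - 1, 2r)` of `eta` become pairs `(i, i + 1)`
with `i` even, and the only summand that can contribute has index `i / 2 + 1`. -/
theorem eta_single_single {m : ℕ} {i j : Fin n} (hij : i.val < j.val) (hj : j.val < 2 * m) :
    eta k n m (Pi.single i 1) (Pi.single j 1) =
      if i.val % 2 = 0 ∧ j.val = i.val + 1 then vec k n (2 * m + 1) else 0 := by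
  rw [eta, LinearMap.sum_apply, LinearMap.sum_apply]
  rw [Finset.sum_eq_single (i.val / 2 + 1)]
  · rw [eps_single]
    split_ifs <;> first | omega | simp
  · intro b hb hbi
    rw [eps_single]
    rw [Finset.mem_Icc] at hb
    split_ifs <;> first | omega | simp
  · intro h
    exact absurd (Finset.mem_Icc.2 ⟨by omega, by omega⟩) h

theorem symm_vec (e : Basis (Fin n) k (Fin n → k)) (r : Fin n) {l : ℕ} (h : r.val + 1 = l) :
    e.equivFun.symm (vec k n l) = e r := by
  have : vec k n l = Pi.single r 1 := by
    ext s
    simp [vec, Pi.single_apply, Fin.ext_iff, ← h]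
  rw [this, Basis.equivFun_symm_apply, Finset.sum_eq_single r]
  · simp
  · intro b _ hb
    simp [hb]
  · simp

end Tables

/-! ### Criteria for isomorphism with a model -/

section Isomorphisms

open Module

variable {k : Type*} [Field k] {n : ℕ}

/-- An alternating structure is isomorphic to `X` if its products on a linearly independent family,
placed at the positions `σ`, are those of `X`, and this family spans modulo the annihilator. -/
theorem mem_orbit_of_family {μ X : AlgStr k n} (hμ : Alternating μ) (hX : Alternating X) {p m : ℕ}
    (hmp : m ≤ p) {v : Fin p → Fin n → k} (hli : LinearIndependent k v) (σ : Fin p → Fin n)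
    (hσ : Function.Injective σ) (hlt : ∀ s : Fin p, s.val < m → (σ s).val = s.val)
    (hX0 : ∀ j : Fin n, m ≤ j.val → X (Pi.single j 1) = 0)
    (hann : ∀ s : Fin p, m ≤ s.val → μ (v s) = 0)
    (hS : ∀ x, ∃ y ∈ Submodule.span k (Set.range v), μ (x - y) = 0)
    (h : ∀ e : Basis (Fin n) k (Fin n → k), (∀ s, e (σ s) = v s) →
      ∀ s t : ℕ, (hst : s < t) → (ht : t < m) →
        μ (v ⟨s, by omega⟩) (v ⟨t, by omega⟩) =
          e.equivFun.symm (X (Pi.single (σ ⟨s, by omega⟩) 1) (Pi.single (σ ⟨t, by omega⟩) 1))) :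
    X ∈ orbit μ := by
  obtain ⟨e, he, heS⟩ := exists_basis_extension hli hσ (LinearMap.ker μ) (by
      intro x
      obtain ⟨y, hy, h⟩ := hS x
      exact ⟨_, h, by rwa [sub_sub_cancel]⟩)
  refine mem_orbit_of_active hμ hX e m ?_ hX0 ?_
  · intro j hj
    by_cases hr : j ∈ Set.range σ
    · obtain ⟨s, rfl⟩ := hr
      rw [he]
      refine hann s ?_
      by_contra hs
      push Not at hs
      have := hlt s hs
      omega
    · exact heS j hr
  · intro i j hij hj
    have hi : i = σ ⟨i.val, by omega⟩ := Fin.ext (hlt ⟨i.val, by omega⟩ (by simp; omega)).symm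
    have hj' : j = σ ⟨j.val, by omega⟩ := Fin.ext (hlt ⟨j.val, by omega⟩ hj).symm
    have := h e he i.val j.val hij hj
    rw [← he, ← he] at this
    rwa [← hi, ← hj'] at this

/-- The placement of five vectors at the positions `1, 2, 3, n - 1, n`. -/
def pos5 (hn : 5 ≤ n) : Fin 5 → Fin n :=
  ![⟨0, by omega⟩, ⟨1, by omega⟩, ⟨2, by omega⟩, ⟨n - 2, by omega⟩, ⟨n - 1, by omega⟩]

theorem pos5_injective (hn : 5 ≤ n) : Function.Injective (pos5 hn) := by
  intro s t hst
  fin_cases s <;> fin_cases t <;> simp [pos5] at hst ⊢ <;> omega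

/-- The placement of four vectors at the positions `1, 2, 3, n`. -/
def pos4 (hn : 4 ≤ n) : Fin 4 → Fin n :=
  ![⟨0, by omega⟩, ⟨1, by omega⟩, ⟨2, by omega⟩, ⟨n - 1, by omega⟩]

theorem pos4_injective (hn : 4 ≤ n) : Function.Injective (pos4 hn) := by
  intro s t hst
  fin_cases s <;> fin_cases t <;> simp [pos4] at hst ⊢ <;> omega

/-- The placement of six vectors at the positions `1, 2, 3, n - 2, n - 1, n`. -/
def pos33 (hn : 6 ≤ n) : Fin 6 → Fin n :=
  ![⟨0, by omega⟩, ⟨1, by omega⟩, ⟨2, by omega⟩, ⟨n - 3, by omega⟩, ⟨n - 2, by omega⟩,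
    ⟨n - 1, by omega⟩]

theorem pos33_injective (hn : 6 ≤ n) : Function.Injective (pos33 hn) := by
  intro s t hst
  fin_cases s <;> fin_cases t <;> simp [pos33] at hst ⊢ <;> omega

/-- The placement of six vectors at the positions `1, 2, 3, 4, n - 1, n`. -/
def pos42 (hn : 6 ≤ n) : Fin 6 → Fin n :=
  ![⟨0, by omega⟩, ⟨1, by omega⟩, ⟨2, by omega⟩, ⟨3, by omega⟩, ⟨n - 2, by omega⟩,
    ⟨n - 1, by omega⟩]

theorem pos42_injective (hn : 6 ≤ n) : Function.Injective (pos42 hn) := by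
  intro s t hst
  fin_cases s <;> fin_cases t <;> simp [pos42] at hst ⊢ <;> omega

/-- The placement of seven vectors at the positions `1, 2, 3, 4, n - 2, n - 1, n`. -/
def pos7 (hn : 7 ≤ n) : Fin 7 → Fin n :=
  ![⟨0, by omega⟩, ⟨1, by omega⟩, ⟨2, by omega⟩, ⟨3, by omega⟩, ⟨n - 3, by omega⟩,
    ⟨n - 2, by omega⟩, ⟨n - 1, by omega⟩]

theorem pos7_injective (hn : 7 ≤ n) : Function.Injective (pos7 hn) := by
  intro s t hst
  fin_cases s <;> fin_cases t <;> simp [pos7] at hst ⊢ <;> omega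

theorem T22_mem_orbit {μ : AlgStr k n} (hμ : Alternating μ) (hn : 5 ≤ n) {a b c : Fin n → k}
    (hli : LinearIndependent k ![a, b, c, μ a b, μ a c]) (hbc : μ b c = 0)
    (h1 : μ (μ a b) = 0) (h2 : μ (μ a c) = 0)
    (hS : ∀ x, ∃ α β γ : k, μ (x - (α • a + β • b + γ • c)) = 0) : T22 k n ∈ orbit μ := by
  refine mem_orbit_of_family hμ alternating_T22 (m := 3) (by norm_num) hli (pos5 hn)
    (pos5_injective hn) ?_ (fun j => T22_single) ?_ ?_ ?_
  · intro s hs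
    fin_cases s <;> simp [pos5] at hs ⊢
  · intro s hs
    fin_cases s <;> simp [h1, h2] at hs ⊢
  · intro x
    obtain ⟨α, β, γ, h⟩ := hS x
    exact ⟨_, Submodule.add_mem _ (Submodule.add_mem _
        (Submodule.smul_mem _ _ (Submodule.subset_span ⟨0, rfl⟩))
        (Submodule.smul_mem _ _ (Submodule.subset_span ⟨1, rfl⟩)))
        (Submodule.smul_mem _ _ (Submodule.subset_span ⟨2, rfl⟩)), h⟩
  · intro e he s t hst ht
    have h3 : e.equivFun.symm (vec k n (n - 1)) = μ a b :=
      (symm_vec e ⟨n - 2, by omega⟩ (by simp; omega)).trans (he 3)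
    have h4 : e.equivFun.symm (vec k n n) = μ a c :=
      (symm_vec e ⟨n - 1, by omega⟩ (by simp; omega)).trans (he 4)
    interval_cases t <;> interval_cases s <;>
      simp [-Basis.equivFun_symm_apply, pos5, T22, eps_single, h3, h4, hbc]

theorem T3_mem_orbit {μ : AlgStr k n} (hμ : Alternating μ) (hn : 4 ≤ n) {a b : Fin n → k}
    (hli : LinearIndependent k ![a, b, μ a b, μ a (μ a b)]) (hbc : μ b (μ a b) = 0)
    (h1 : μ (μ a (μ a b)) = 0)
    (hS : ∀ x, ∃ α β γ : k, μ (x - (α • a + β • b + γ • μ a b)) = 0) : T3 k n ∈ orbit μ := by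
  refine mem_orbit_of_family hμ alternating_T3 (m := 3) (by norm_num) hli (pos4 hn)
    (pos4_injective hn) ?_ (fun j => T3_single) ?_ ?_ ?_
  · intro s hs
    fin_cases s <;> simp [pos4] at hs ⊢
  · intro s hs
    fin_cases s <;> simp [h1] at hs ⊢
  · intro x
    obtain ⟨α, β, γ, h⟩ := hS x
    exact ⟨_, Submodule.add_mem _ (Submodule.add_mem _
        (Submodule.smul_mem _ _ (Submodule.subset_span ⟨0, rfl⟩))
        (Submodule.smul_mem _ _ (Submodule.subset_span ⟨1, rfl⟩)))
        (Submodule.smul_mem _ _ (Submodule.subset_span ⟨2, rfl⟩)), h⟩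
  · intro e he s t hst ht
    have h3 : e.equivFun.symm (vec k n 3) = μ a b :=
      (symm_vec e ⟨2, by omega⟩ rfl).trans (he 2)
    have h4 : e.equivFun.symm (vec k n n) = μ a (μ a b) :=
      (symm_vec e ⟨n - 1, by omega⟩ (by simp; omega)).trans (he 3)
    interval_cases t <;> interval_cases s <;>
      simp [-Basis.equivFun_symm_apply, pos4, T3, eps_single, h3, h4, hbc]

theorem T22eps23_mem_orbit {μ : AlgStr k n} (hμ : Alternating μ) (hn : 6 ≤ n) {a b c : Fin n → k}
    (hli : LinearIndependent k ![a, b, c, μ b c, μ a b, μ a c])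
    (h1 : μ (μ a b) = 0) (h2 : μ (μ a c) = 0) (h3 : μ (μ b c) = 0)
    (hS : ∀ x, ∃ α β γ : k, μ (x - (α • a + β • b + γ • c)) = 0) : T22eps23 k n ∈ orbit μ := by
  refine mem_orbit_of_family hμ alternating_T22eps23 (m := 3) (by norm_num) hli (pos33 hn)
    (pos33_injective hn) ?_ (fun j => T22eps23_single) ?_ ?_ ?_
  · intro s hs
    fin_cases s <;> simp [pos33] at hs ⊢
  · intro s hs
    fin_cases s <;> simp [h1, h2, h3] at hs ⊢
  · intro x
    obtain ⟨α, β, γ, h⟩ := hS x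
    exact ⟨_, Submodule.add_mem _ (Submodule.add_mem _
        (Submodule.smul_mem _ _ (Submodule.subset_span ⟨0, rfl⟩))
        (Submodule.smul_mem _ _ (Submodule.subset_span ⟨1, rfl⟩)))
        (Submodule.smul_mem _ _ (Submodule.subset_span ⟨2, rfl⟩)), h⟩
  · intro e he s t hst ht
    have h3 : e.equivFun.symm (vec k n (n - 2)) = μ b c :=
      (symm_vec e ⟨n - 3, by omega⟩ (by simp; omega)).trans (he 3)
    have h4 : e.equivFun.symm (vec k n (n - 1)) = μ a b :=
      (symm_vec e ⟨n - 2, by omega⟩ (by simp; omega)).trans (he 4)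
    have h5 : e.equivFun.symm (vec k n n) = μ a c :=
      (symm_vec e ⟨n - 1, by omega⟩ (by simp; omega)).trans (he 5)
    interval_cases t <;> interval_cases s <;>
      simp [-Basis.equivFun_symm_apply, pos33, T22eps23, T22, eps_single, h3, h4, h5]

theorem T22eps24_mem_orbit {μ : AlgStr k n} (hμ : Alternating μ) (hn : 6 ≤ n)
    {a b c d : Fin n → k} (hli : LinearIndependent k ![a, b, c, d, μ a b, μ a c])
    (hbc : μ b c = 0) (had : μ a d = 0) (hbd : μ b d = μ a c) (hcd : μ c d = 0)
    (h1 : μ (μ a b) = 0) (h2 : μ (μ a c) = 0)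
    (hS : ∀ x, ∃ α β γ δ : k, μ (x - (α • a + β • b + γ • c + δ • d)) = 0) :
    T22eps24 k n ∈ orbit μ := by
  refine mem_orbit_of_family hμ alternating_T22eps24 (m := 4) (by norm_num) hli (pos42 hn)
    (pos42_injective hn) ?_ (fun j => T22eps24_single) ?_ ?_ ?_
  · intro s hs
    fin_cases s <;> simp [pos42] at hs ⊢
  · intro s hs
    fin_cases s <;> simp [h1, h2] at hs ⊢
  · intro x
    obtain ⟨α, β, γ, δ, h⟩ := hS x
    exact ⟨_, Submodule.add_mem _ (Submodule.add_mem _ (Submodule.add_mem _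
        (Submodule.smul_mem _ _ (Submodule.subset_span ⟨0, rfl⟩))
        (Submodule.smul_mem _ _ (Submodule.subset_span ⟨1, rfl⟩)))
        (Submodule.smul_mem _ _ (Submodule.subset_span ⟨2, rfl⟩)))
        (Submodule.smul_mem _ _ (Submodule.subset_span ⟨3, rfl⟩)), h⟩
  · intro e he s t hst ht
    have h4 : e.equivFun.symm (vec k n (n - 1)) = μ a b :=
      (symm_vec e ⟨n - 2, by omega⟩ (by simp; omega)).trans (he 4)
    have h5 : e.equivFun.symm (vec k n n) = μ a c :=
      (symm_vec e ⟨n - 1, by omega⟩ (by simp; omega)).trans (he 5)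
    interval_cases t <;> interval_cases s <;>
      simp [-Basis.equivFun_symm_apply, pos42, T22eps24, T22, eps_single, h4, h5, hbc, had,
        hbd, hcd]

theorem T222_mem_orbit {μ : AlgStr k n} (hμ : Alternating μ) (hn : 7 ≤ n)
    {a b c d : Fin n → k} (hli : LinearIndependent k ![a, b, c, d, μ a b, μ a c, μ a d])
    (hbc : μ b c = 0) (hbd : μ b d = 0) (hcd : μ c d = 0)
    (h1 : μ (μ a b) = 0) (h2 : μ (μ a c) = 0) (h3 : μ (μ a d) = 0)
    (hS : ∀ x, ∃ α β γ δ : k, μ (x - (α • a + β • b + γ • c + δ • d)) = 0) :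
    T222 k n ∈ orbit μ := by
  refine mem_orbit_of_family hμ alternating_T222 (m := 4) (by norm_num) hli (pos7 hn)
    (pos7_injective hn) ?_ (fun j => T222_single) ?_ ?_ ?_
  · intro s hs
    fin_cases s <;> simp [pos7] at hs ⊢
  · intro s hs
    fin_cases s <;> simp [h1, h2, h3] at hs ⊢
  · intro x
    obtain ⟨α, β, γ, δ, h⟩ := hS x
    exact ⟨_, Submodule.add_mem _ (Submodule.add_mem _ (Submodule.add_mem _
        (Submodule.smul_mem _ _ (Submodule.subset_span ⟨0, rfl⟩))
        (Submodule.smul_mem _ _ (Submodule.subset_span ⟨1, rfl⟩)))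
        (Submodule.smul_mem _ _ (Submodule.subset_span ⟨2, rfl⟩)))
        (Submodule.smul_mem _ _ (Submodule.subset_span ⟨3, rfl⟩)), h⟩
  · intro e he s t hst ht
    have h4 : e.equivFun.symm (vec k n (n - 2)) = μ a b :=
      (symm_vec e ⟨n - 3, by omega⟩ (by simp; omega)).trans (he 4)
    have h5 : e.equivFun.symm (vec k n (n - 1)) = μ a c :=
      (symm_vec e ⟨n - 2, by omega⟩ (by simp; omega)).trans (he 5)
    have h6 : e.equivFun.symm (vec k n n) = μ a d :=
      (symm_vec e ⟨n - 1, by omega⟩ (by simp; omega)).trans (he 6)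
    interval_cases t <;> interval_cases s <;>
      simp [-Basis.equivFun_symm_apply, pos7, T222, eps_single, h4, h5, h6, hbc, hbd, hcd]

/-- The vectors `x 0, x 1, …` form `m` orthogonal hyperbolic pairs for a form with values in the
line spanned by the annihilating vector `z`. -/
structure HyperbolicPairs (μ : AlgStr k n) (z : Fin n → k) (m : ℕ)
    (x : Fin (2 * m) → Fin n → k) : Prop where
  ne_zero : z ≠ 0
  ann : μ z = 0
  mul : ∀ i j : Fin (2 * m), i.val < j.val →
    μ (x i) (x j) = if i.val % 2 = 0 ∧ j.val = i.val + 1 then z else 0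

/-- This is nondegeneracy in usable form: multiplying a combination by the partner of `x j` isolates
its `j`-th coefficient. -/
theorem HyperbolicPairs.mul_partner {μ : AlgStr k n} (hμ : Alternating μ) {z : Fin n → k} {m : ℕ}
    {x : Fin (2 * m) → Fin n → k} (h : HyperbolicPairs μ z m x) (j : Fin (2 * m)) :
    ∃ j' : Fin (2 * m), (μ (x j) (x j') = z ∨ μ (x j) (x j') = - z) ∧
      ∀ i, i ≠ j → μ (x i) (x j') = 0 := by
  have key : ∀ i j' : Fin (2 * m), ¬ (i.val % 2 = 0 ∧ j'.val = i.val + 1) →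
      ¬ (j'.val % 2 = 0 ∧ i.val = j'.val + 1) → μ (x i) (x j') = 0 := by
    intro i j' h1 h2
    rcases lt_trichotomy i j' with hij | rfl | hij
    · rw [h.mul _ _ hij, if_neg h1]
    · exact hμ _
    · rw [hμ.swap, h.mul _ _ hij, if_neg h2, neg_zero]
  by_cases hj : j.val % 2 = 0
  · refine ⟨⟨j.val + 1, by omega⟩, Or.inl ?_, fun i hi => key _ _ ?_ ?_⟩
    · rw [h.mul _ _ (by simp), if_pos ⟨hj, rfl⟩]
    · intro hh
      exact hi (Fin.ext (by have := hh.2; simp at this; omega))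
    · simp only
      omega
  · refine ⟨⟨j.val - 1, by omega⟩, Or.inr ?_, fun i hi => key _ _ ?_ ?_⟩
    · rw [hμ.swap, h.mul _ _ (by simp; omega), if_pos ⟨by simp; omega, by simp; omega⟩]
    · simp only
      omega
    · intro hh
      exact hi (Fin.ext (by have := hh.2; simp at this; omega))

theorem HyperbolicPairs.coeff_eq_zero {μ : AlgStr k n} (hμ : Alternating μ) {z : Fin n → k} {m : ℕ}
    {x : Fin (2 * m) → Fin n → k} (h : HyperbolicPairs μ z m x) {c : Fin (2 * m) → k}
    (hc : ∀ j, μ (∑ i, c i • x i) (x j) = 0) (j : Fin (2 * m)) : c j = 0 := by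
  obtain ⟨j', h1, h2⟩ := h.mul_partner hμ j
  have := hc j'
  simp only [map_sum, map_smul, LinearMap.sum_apply, LinearMap.smul_apply] at this
  rw [Finset.sum_eq_single j (fun i _ hi => by rw [h2 i hi, smul_zero]) (by simp)] at this
  rcases h1 with h1 | h1 <;> rw [h1] at this <;> simpa [h.ne_zero] using this

theorem HyperbolicPairs.linearIndependent {μ : AlgStr k n} (hμ : Alternating μ) {z : Fin n → k}
    {m : ℕ} {x : Fin (2 * m) → Fin n → k} (h : HyperbolicPairs μ z m x) :
    LinearIndependent k (Fin.snoc x z : Fin (2 * m + 1) → Fin n → k) := by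
  rw [Fintype.linearIndependent_iff]
  intro c hc
  rw [Fin.sum_univ_castSucc] at hc
  simp only [Fin.snoc_castSucc, Fin.snoc_last] at hc
  -- The combination of the `x i` is a multiple of `z`, hence annihilates.
  have h1 : μ (∑ i : Fin (2 * m), c i.castSucc • x i) = 0 := by
    rw [eq_neg_of_add_eq_zero_left hc]
    simp [h.ann]
  have h2 := h.coeff_eq_zero hμ (fun j => by rw [h1, LinearMap.zero_apply])
  have h3 : c (Fin.last _) = 0 := by
    simpa [h2, h.ne_zero] using hc
  intro i
  refine Fin.lastCases h3 h2 i

theorem HyperbolicPairs.two_mul_lt {μ : AlgStr k n} (hμ : Alternating μ) {z : Fin n → k}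
    {m : ℕ} {x : Fin (2 * m) → Fin n → k} (h : HyperbolicPairs μ z m x) : 2 * m < n := by
  have := (h.linearIndependent hμ).fintype_card_le_finrank
  simpa using this

theorem eta_mem_orbit {μ : AlgStr k n} (hμ : Alternating μ) {z : Fin n → k} {m : ℕ}
    {x : Fin (2 * m) → Fin n → k} (h : HyperbolicPairs μ z m x)
    (hS : ∀ y, ∃ c : Fin (2 * m) → k, μ (y - ∑ i, c i • x i) = 0) : eta k n m ∈ orbit μ := by
  have hn := h.two_mul_lt hμ
  refine mem_orbit_of_family hμ (alternating_eta m) (m := 2 * m) (by norm_num)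
    (h.linearIndependent hμ) (Fin.castLE hn) (Fin.castLE_injective hn) (fun s _ => rfl)
    (fun j => eta_single_eq_zero) ?_ ?_ ?_
  · intro s hs
    have : s = Fin.last _ := Fin.ext (by simp; omega)
    rw [this, Fin.snoc_last, h.ann]
  · intro y
    obtain ⟨c, hc⟩ := hS y
    refine ⟨_, Submodule.sum_mem _ fun i _ => Submodule.smul_mem _ _
      (Submodule.subset_span ⟨i.castSucc, by simp⟩), hc⟩
  · intro e he s t hst ht
    have hz : e.equivFun.symm (vec k n (2 * m + 1)) = z := by
      rw [symm_vec e (Fin.castLE hn (Fin.last _)) (by simp), he, Fin.snoc_last]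
    have hs : ∀ (s : ℕ) (hs : s < 2 * m), (Fin.snoc x z : Fin (2 * m + 1) → Fin n → k)
        ⟨s, by omega⟩ = x ⟨s, hs⟩ := fun s hs =>
      Fin.snoc_castSucc (α := fun _ => Fin n → k) z x ⟨s, hs⟩
    rw [hs s (by omega), hs t ht, h.mul _ _ (by simpa using hst),
      eta_single_single (by simpa using hst) (by simpa using ht)]
    simp only [Fin.val_castLE]
    split_ifs
    · exact hz.symm
    · simp

theorem HyperbolicPairs.castLE {μ : AlgStr k n} {z : Fin n → k} {m m' : ℕ}
    {x : Fin (2 * m) → Fin n → k} (h : HyperbolicPairs μ z m x) (hm : m' ≤ m) :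
    HyperbolicPairs μ z m' (x ∘ Fin.castLE (by omega)) :=
  ⟨h.ne_zero, h.ann, fun i j hij => h.mul _ _ (by simpa using hij)⟩

end Isomorphisms
-- Degenerations to the models
section Degenerations

open Module

variable {k : Type*} [Field k] [Infinite k] {n : ℕ}

/-- Contraction by weights on a linearly independent family placed at the positions `σ`, the
products with all remaining basic vectors being of too large weight to survive. -/
theorem degenerates_of_family {μ X : AlgStr k n} (hμ : Alternating μ) (hX : Alternating X)
    {p m : ℕ} (hmp : m ≤ p) {v : Fin p → Fin n → k} (hli : LinearIndependent k v)
    (σ : Fin p → Fin n) (hσ : Function.Injective σ)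
    (hlt : ∀ s : Fin p, s.val < m → (σ s).val = s.val)
    (hX0 : ∀ j : Fin n, m ≤ j.val → X (Pi.single j 1) = 0) (w : Fin n → ℕ)
    (hw : ∀ i j l : Fin n, m ≤ j.val → w l < w i + w j)
    (h : ∀ e : Basis (Fin n) k (Fin n → k), (∀ s, e (σ s) = v s) →
      ∀ s t : ℕ, (hst : s < t) → (ht : t < m) →
        (μ (v ⟨s, by omega⟩) (v ⟨t, by omega⟩) =
          e.equivFun.symm (X (Pi.single (σ ⟨s, by omega⟩) 1) (Pi.single (σ ⟨t, by omega⟩) 1)) ∧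
          μ (v ⟨s, by omega⟩) (v ⟨t, by omega⟩) ∈
            Submodule.span k (e '' {l | w l = w (σ ⟨s, by omega⟩) + w (σ ⟨t, by omega⟩)})) ∨
        (X (Pi.single (σ ⟨s, by omega⟩) 1) (Pi.single (σ ⟨t, by omega⟩) 1) = 0 ∧
          ∀ l, w l < w (σ ⟨s, by omega⟩) + w (σ ⟨t, by omega⟩))) :
    Degenerates μ X := by
  obtain ⟨e, he, -⟩ := exists_basis_extension hli hσ ⊤ (fun x => ⟨x, trivial, by simp⟩)
  refine degenerates_of_weights_active hμ hX e w m hX0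
    (fun i j hj => mem_span_image_of_forall_lt e (fun l => hw i j l hj) _) ?_
  intro i j hij hj
  have hi : i = σ ⟨i.val, by omega⟩ := Fin.ext (hlt ⟨i.val, by omega⟩ (by simp; omega)).symm
  have hj' : j = σ ⟨j.val, by omega⟩ := Fin.ext (hlt ⟨j.val, by omega⟩ hj).symm
  have := h e he i.val j.val hij hj
  rw [← he, ← he, ← hi, ← hj'] at this
  rcases this with ⟨h1, h2⟩ | ⟨h1, h2⟩
  · rw [← h1, sub_self]
    exact ⟨h2, Submodule.zero_mem _⟩
  · rw [h1, map_zero]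
    exact ⟨Submodule.zero_mem _, mem_span_image_of_forall_lt e h2 _⟩

/-- Weights `1, 2, 2` for `a, b, c` and `3` for everything else: `ab` and `ac` have weight `3 = 1 +
2`, and every other product of basic vectors would need weight at least four. -/
theorem degenerates_T22 {μ : AlgStr k n} (hμ : Alternating μ) (hn : 5 ≤ n) {a b c : Fin n → k}
    (hli : LinearIndependent k ![a, b, c, μ a b, μ a c]) : Degenerates μ (T22 k n) := by
  refine degenerates_of_family hμ alternating_T22 (m := 3) (by norm_num) hli (pos5 hn)
    (pos5_injective hn) ?_ (fun j => T22_single)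
    (fun j => if j.val = 0 then 1 else if j.val < 3 then 2 else 3) ?_ ?_
  · intro s hs
    fin_cases s <;> simp [pos5] at hs ⊢
  · intro i j l hj
    split_ifs <;> omega
  · intro e he s t hst ht
    have h3 : e.equivFun.symm (vec k n (n - 1)) = μ a b :=
      (symm_vec e ⟨n - 2, by omega⟩ (by simp; omega)).trans (he 3)
    have h4 : e.equivFun.symm (vec k n n) = μ a c :=
      (symm_vec e ⟨n - 1, by omega⟩ (by simp; omega)).trans (he 4)
    interval_cases t <;> interval_cases s
    · refine Or.inl ⟨?_, Submodule.subset_span ⟨⟨n - 2, by omega⟩, ?_, he 3⟩⟩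
      · simp [-Basis.equivFun_symm_apply, pos5, T22, eps_single, h3]
      · simp [pos5]
        split_ifs <;> omega
    · refine Or.inl ⟨?_, Submodule.subset_span ⟨⟨n - 1, by omega⟩, ?_, he 4⟩⟩
      · simp [-Basis.equivFun_symm_apply, pos5, T22, eps_single, h4]
      · simp [pos5]
        split_ifs <;> omega
    · refine Or.inr ⟨by simp [pos5, T22, eps_single], fun l => ?_⟩
      simp [pos5]
      split_ifs <;> omega

/-- Weights `1, 2, 3` for `a, b, ab` and `4` for everything else; the product of `b` and `ab` would
need weight five and disappears. -/
theorem degenerates_T3 {μ : AlgStr k n} (hμ : Alternating μ) (hn : 4 ≤ n) {a b : Fin n → k}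
    (hli : LinearIndependent k ![a, b, μ a b, μ a (μ a b)]) : Degenerates μ (T3 k n) := by
  refine degenerates_of_family hμ alternating_T3 (m := 3) (by norm_num) hli (pos4 hn)
    (pos4_injective hn) ?_ (fun j => T3_single)
    (fun j => if j.val = 0 then 1 else if j.val = 1 then 2 else if j.val = 2 then 3 else 4) ?_ ?_
  · intro s hs
    fin_cases s <;> simp [pos4] at hs ⊢
  · intro i j l hj
    split_ifs <;> omega
  · intro e he s t hst ht
    have h3 : e.equivFun.symm (vec k n 3) = μ a b :=
      (symm_vec e ⟨2, by omega⟩ rfl).trans (he 2)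
    have h4 : e.equivFun.symm (vec k n n) = μ a (μ a b) :=
      (symm_vec e ⟨n - 1, by omega⟩ (by simp; omega)).trans (he 3)
    interval_cases t <;> interval_cases s
    · refine Or.inl ⟨?_, Submodule.subset_span ⟨⟨2, by omega⟩, ?_, he 2⟩⟩
      · simp [-Basis.equivFun_symm_apply, pos4, T3, eps_single, h3]
      · simp [pos4]
    · refine Or.inl ⟨?_, Submodule.subset_span ⟨⟨n - 1, by omega⟩, ?_, he 3⟩⟩
      · simp [-Basis.equivFun_symm_apply, pos4, T3, eps_single, h4]
      · simp [pos4]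
        split_ifs <;> omega
    · refine Or.inr ⟨by simp [pos4, T3, eps_single], fun l => ?_⟩
      simp [pos4]
      split_ifs <;> omega

theorem degenerates_T22eps23 {μ : AlgStr k n} (hμ : Alternating μ) (hn : 6 ≤ n)
    {a b c : Fin n → k} (hli : LinearIndependent k ![a, b, c, μ b c, μ a b, μ a c]) :
    Degenerates μ (T22eps23 k n) := by
  refine degenerates_of_family hμ alternating_T22eps23 (m := 3) (by norm_num) hli (pos33 hn)
    (pos33_injective hn) ?_ (fun j => T22eps23_single)
    (fun j => if j.val < 3 then 1 else 2) ?_ ?_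
  · intro s hs
    fin_cases s <;> simp [pos33] at hs ⊢
  · intro i j l hj
    split_ifs <;> omega
  · intro e he s t hst ht
    have h3 : e.equivFun.symm (vec k n (n - 2)) = μ b c :=
      (symm_vec e ⟨n - 3, by omega⟩ (by simp; omega)).trans (he 3)
    have h4 : e.equivFun.symm (vec k n (n - 1)) = μ a b :=
      (symm_vec e ⟨n - 2, by omega⟩ (by simp; omega)).trans (he 4)
    have h5 : e.equivFun.symm (vec k n n) = μ a c :=
      (symm_vec e ⟨n - 1, by omega⟩ (by simp; omega)).trans (he 5)
    interval_cases t <;> interval_cases s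
    · refine Or.inl ⟨?_, Submodule.subset_span ⟨⟨n - 2, by omega⟩, ?_, he 4⟩⟩
      · simp [-Basis.equivFun_symm_apply, pos33, T22eps23, T22, eps_single, h4]
      · simp [pos33]
        omega
    · refine Or.inl ⟨?_, Submodule.subset_span ⟨⟨n - 1, by omega⟩, ?_, he 5⟩⟩
      · simp [-Basis.equivFun_symm_apply, pos33, T22eps23, T22, eps_single, h5]
      · simp [pos33]
        omega
    · refine Or.inl ⟨?_, Submodule.subset_span ⟨⟨n - 3, by omega⟩, ?_, he 3⟩⟩
      · simp [-Basis.equivFun_symm_apply, pos33, T22eps23, T22, eps_single, h3]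
      · simp [pos33]
        omega

/-- Weights for the contraction to `T22eps24`. -/
def weightEps24 (n j : ℕ) : ℕ :=
  if j = 0 then 2 else if j = 1 then 3 else if j = 2 then 4 else if j = 3 then 3 else
    if j = n - 2 then 5 else 6

theorem weightEps24_le (n j : ℕ) : weightEps24 n j ≤ 6 := by
  unfold weightEps24
  split_ifs <;> norm_num

theorem two_le_weightEps24 (n j : ℕ) : 2 ≤ weightEps24 n j := by
  unfold weightEps24
  split_ifs <;> norm_num

theorem five_le_weightEps24 (n : ℕ) {j : ℕ} (hj : 4 ≤ j) : 5 ≤ weightEps24 n j := by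
  unfold weightEps24
  split_ifs <;> omega

theorem weightEps24_sub_two (hn : 6 ≤ n) : weightEps24 n (n - 2) = 5 := by
  unfold weightEps24
  split_ifs <;> omega

theorem weightEps24_sub_one (hn : 6 ≤ n) : weightEps24 n (n - 1) = 6 := by
  unfold weightEps24
  split_ifs <;> omega

/-- Weights `2, 3, 4, 3` for `a, b, c, d`, then `5` for `ab` and `6` for the rest. Both `ac` and
`bd` get weight six, while `bc` and `cd` would need seven. The sum for `ad` is only five, so the
contraction does not remove this product and `had` is required. -/
theorem degenerates_T22eps24 {μ : AlgStr k n} (hμ : Alternating μ) (hn : 6 ≤ n)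
    {a b c d : Fin n → k} (hli : LinearIndependent k ![a, b, c, d, μ a b, μ a c])
    (had : μ a d = 0) (hbd : μ b d = μ a c) : Degenerates μ (T22eps24 k n) := by
  refine degenerates_of_family hμ alternating_T22eps24 (m := 4) (by norm_num) hli (pos42 hn)
    (pos42_injective hn) ?_ (fun j => T22eps24_single) (fun j => weightEps24 n j) ?_ ?_
  · intro s hs
    fin_cases s <;> simp [pos42] at hs ⊢
  · intro i j l hj
    have h1 := weightEps24_le n l
    have h2 := two_le_weightEps24 n i
    have h3 := five_le_weightEps24 n hj
    omega
  · intro e he s t hst ht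
    have h4 : e.equivFun.symm (vec k n (n - 1)) = μ a b :=
      (symm_vec e ⟨n - 2, by omega⟩ (by simp; omega)).trans (he 4)
    have h5 : e.equivFun.symm (vec k n n) = μ a c :=
      (symm_vec e ⟨n - 1, by omega⟩ (by simp; omega)).trans (he 5)
    have w0 : weightEps24 n 0 = 2 := rfl
    have w1 : weightEps24 n 1 = 3 := rfl
    have w2 : weightEps24 n 2 = 4 := rfl
    have w3 : weightEps24 n 3 = 3 := rfl
    have w4 := weightEps24_sub_two hn
    have w5 := weightEps24_sub_one hn
    interval_cases t <;> interval_cases s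
    · refine Or.inl ⟨?_, Submodule.subset_span ⟨⟨n - 2, by omega⟩, ?_, he 4⟩⟩
      · simp [-Basis.equivFun_symm_apply, pos42, T22eps24, T22, eps_single, h4]
      · simp [pos42, w4, w0, w1]
    · refine Or.inl ⟨?_, Submodule.subset_span ⟨⟨n - 1, by omega⟩, ?_, he 5⟩⟩
      · simp [-Basis.equivFun_symm_apply, pos42, T22eps24, T22, eps_single, h5]
      · simp [pos42, w5, w0, w2]
    · refine Or.inr ⟨by simp [pos42, T22eps24, T22, eps_single], fun l => ?_⟩
      exact (weightEps24_le n l).trans_lt (by simp [pos42, w1, w2])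
    · refine Or.inl ⟨?_, ?_⟩ <;> simp [pos42, T22eps24, T22, eps_single, had]
    · refine Or.inl ⟨?_, Submodule.subset_span ⟨⟨n - 1, by omega⟩, ?_, (he 5).trans hbd.symm⟩⟩
      · simp [-Basis.equivFun_symm_apply, pos42, T22eps24, T22, eps_single, h5, hbd]
      · simp [pos42, w5, w1, w3]
    · refine Or.inr ⟨by simp [pos42, T22eps24, T22, eps_single], fun l => ?_⟩
      exact (weightEps24_le n l).trans_lt (by simp [pos42, w2, w3])

theorem degenerates_T222 {μ : AlgStr k n} (hμ : Alternating μ) (hn : 7 ≤ n)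
    {a b c d : Fin n → k} (hli : LinearIndependent k ![a, b, c, d, μ a b, μ a c, μ a d]) :
    Degenerates μ (T222 k n) := by
  refine degenerates_of_family hμ alternating_T222 (m := 4) (by norm_num) hli (pos7 hn)
    (pos7_injective hn) ?_ (fun j => T222_single)
    (fun j => if j.val = 0 then 1 else if j.val < 4 then 2 else 3) ?_ ?_
  · intro s hs
    fin_cases s <;> simp [pos7] at hs ⊢
  · intro i j l hj
    split_ifs <;> omega
  · intro e he s t hst ht
    have h4 : e.equivFun.symm (vec k n (n - 2)) = μ a b :=
      (symm_vec e ⟨n - 3, by omega⟩ (by simp; omega)).trans (he 4)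
    have h5 : e.equivFun.symm (vec k n (n - 1)) = μ a c :=
      (symm_vec e ⟨n - 2, by omega⟩ (by simp; omega)).trans (he 5)
    have h6 : e.equivFun.symm (vec k n n) = μ a d :=
      (symm_vec e ⟨n - 1, by omega⟩ (by simp; omega)).trans (he 6)
    rcases Nat.eq_zero_or_pos s with rfl | hs
    · interval_cases t
      · refine Or.inl ⟨?_, Submodule.subset_span ⟨⟨n - 3, by omega⟩, ?_, he 4⟩⟩
        · simp [-Basis.equivFun_symm_apply, pos7, T222, eps_single, h4]
        · simp [pos7]
          split_ifs <;> omega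
      · refine Or.inl ⟨?_, Submodule.subset_span ⟨⟨n - 2, by omega⟩, ?_, he 5⟩⟩
        · simp [-Basis.equivFun_symm_apply, pos7, T222, eps_single, h5]
        · simp [pos7]
          split_ifs <;> omega
      · refine Or.inl ⟨?_, Submodule.subset_span ⟨⟨n - 1, by omega⟩, ?_, he 6⟩⟩
        · simp [-Basis.equivFun_symm_apply, pos7, T222, eps_single, h6]
        · simp [pos7]
          split_ifs <;> omega
    · interval_cases t <;> interval_cases s <;>
      · refine Or.inr ⟨by simp [pos7, T222, eps_single], fun l => ?_⟩
        simp [pos7]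
        split_ifs <;> omega

theorem degenerates_eta {μ : AlgStr k n} (hμ : Alternating μ) {z : Fin n → k} {m : ℕ}
    {x : Fin (2 * m) → Fin n → k} (h : HyperbolicPairs μ z m x) : Degenerates μ (eta k n m) := by
  have hn := h.two_mul_lt hμ
  refine degenerates_of_family hμ (alternating_eta m) (m := 2 * m) (by norm_num)
    (h.linearIndependent hμ) (Fin.castLE hn) (Fin.castLE_injective hn) (fun s _ => rfl)
    (fun j => eta_single_eq_zero) (fun j => if j.val < 2 * m then 1 else 2) ?_ ?_
  · intro i j l hj
    split_ifs <;> omega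
  · intro e he s t hst ht
    refine Or.inl ?_
    have hz : e.equivFun.symm (vec k n (2 * m + 1)) = z := by
      rw [symm_vec e (Fin.castLE hn (Fin.last _)) (by simp), he, Fin.snoc_last]
    have hs : ∀ (s : ℕ) (hs : s < 2 * m), (Fin.snoc x z : Fin (2 * m + 1) → Fin n → k)
        ⟨s, by omega⟩ = x ⟨s, hs⟩ := fun s hs =>
      Fin.snoc_castSucc (α := fun _ => Fin n → k) z x ⟨s, hs⟩
    rw [hs s (by omega), hs t ht, h.mul _ _ (by simpa using hst),
      eta_single_single (by simpa using hst) (by simpa using ht)]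
    simp only [Fin.val_castLE]
    split_ifs with h1
    · refine ⟨hz.symm, Submodule.subset_span ⟨Fin.castLE hn (Fin.last _), ?_, ?_⟩⟩
      · simp only [Set.mem_ofPred_eq, Fin.val_castLE, Fin.val_last]
        split_ifs <;> omega
      · rw [he, Fin.snoc_last]
    all_goals first | omega | simp

end Degenerations
-- Elementary linear dependence
section LinearIndependence

variable {k : Type*} [Field k] {V : Type*} [AddCommGroup V] [Module k V]

theorem linearIndependent_two_iff {x y : V} : LinearIndependent k ![x, y] ↔
    ∀ a b : k, a • x + b • y = 0 → a = 0 ∧ b = 0 :=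
  LinearIndependent.pair_iff

theorem linearIndependent_three_iff {x y z : V} : LinearIndependent k ![x, y, z] ↔
    ∀ a b c : k, a • x + b • y + c • z = 0 → a = 0 ∧ b = 0 ∧ c = 0 := by
  rw [Fintype.linearIndependent_iff]
  constructor
  · intro h a b c h0
    have := h ![a, b, c] (by simpa [Fin.sum_univ_three] using h0)
    exact ⟨this 0, this 1, this 2⟩
  · intro h g hg
    rw [Fin.sum_univ_three] at hg
    obtain ⟨h0, h1, h2⟩ := h _ _ _ hg
    intro i
    fin_cases i <;> assumption

theorem exists_eq_of_dependent_two {x w : V} (hx : x ≠ 0) (h : ¬ LinearIndependent k ![x, w]) :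
    ∃ p : k, w = p • x := by
  rw [linearIndependent_two_iff] at h
  push Not at h
  obtain ⟨a, b, h0, hne⟩ := h
  have hb : b ≠ 0 := by
    rintro rfl
    have : a = 0 := by simpa [hx] using h0
    exact hne this rfl
  refine ⟨- (b⁻¹ * a), ?_⟩
  have : b • w = - (a • x) := eq_neg_of_add_eq_zero_right h0
  rw [neg_smul, mul_smul, ← smul_neg, ← this, smul_smul, inv_mul_cancel₀ hb, one_smul]

theorem exists_eq_of_dependent_three {x y w : V} (hx : LinearIndependent k ![x, y])
    (h : ¬ LinearIndependent k ![x, y, w]) : ∃ p q : k, w = p • x + q • y := by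
  rw [linearIndependent_three_iff] at h
  rw [linearIndependent_two_iff] at hx
  push Not at h
  obtain ⟨a, b, c, h0, hne⟩ := h
  have hc : c ≠ 0 := by
    rintro rfl
    obtain ⟨ha, hb⟩ := hx a b (by simpa using h0)
    exact hne ha hb rfl
  refine ⟨- (c⁻¹ * a), - (c⁻¹ * b), ?_⟩
  have : c • w = - (a • x + b • y) := eq_neg_of_add_eq_zero_right h0
  rw [neg_smul, mul_smul, neg_smul, mul_smul, ← neg_add, ← smul_add, ← smul_neg, ← this, smul_smul,
    inv_mul_cancel₀ hc, one_smul]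

theorem linearIndependent_of_three_left {x y w : V} (h : LinearIndependent k ![x, y, w]) :
    LinearIndependent k ![x, y] := by
  rw [linearIndependent_three_iff] at h
  rw [linearIndependent_two_iff]
  intro a b h0
  have := h a b 0 (by simpa using h0)
  exact ⟨this.1, this.2.1⟩

theorem not_linearIndependent_of_mem_pair {x y u v w : V} (hu : ∃ p q : k, u = p • x + q • y)
    (hv : ∃ p q : k, v = p • x + q • y) (hw : ∃ p q : k, w = p • x + q • y) :
    ¬ LinearIndependent k ![u, v, w] := by
  classical
  intro h
  have h1 := finrank_span_eq_card h
  have h2 : Submodule.span k (Set.range ![u, v, w]) ≤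
      Submodule.span k ((({x, y} : Finset V) : Set V)) := by
    rw [Submodule.span_le]
    rintro _ ⟨i, rfl⟩
    rw [Finset.coe_pair, SetLike.mem_coe, Submodule.mem_span_pair]
    fin_cases i
    · obtain ⟨p, q, h⟩ := hu; exact ⟨p, q, h.symm⟩
    · obtain ⟨p, q, h⟩ := hv; exact ⟨p, q, h.symm⟩
    · obtain ⟨p, q, h⟩ := hw; exact ⟨p, q, h.symm⟩
  have h3 := Submodule.finrank_mono h2
  have h4 := (finrank_span_finset_le_card (R := k) ({x, y} : Finset V)).trans Finset.card_le_two
  rw [h1, Fintype.card_fin] at h3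
  simp only [Set.finrank] at h4
  omega

end LinearIndependence

/-! ### Independence forced by the Engel condition -/

section Engel

variable {k : Type*} [Field k] {n : ℕ} {μ : AlgStr k n}

/-- All left multiplications are nilpotent. -/
def Engel (μ : AlgStr k n) : Prop := ∀ x, IsNilpotent (μ x)

theorem Engel.eq_zero_of_eigen (hE : Engel μ) {x y : Fin n → k} {c : k} (h : μ x y = c • y)
    (hy : y ≠ 0) : c = 0 := by
  obtain ⟨m, hm⟩ := hE x
  have : ∀ m, (μ x ^ m) y = c ^ m • y := by
    intro m
    induction m with
    | zero => simp
    | succ m ih => rw [pow_succ', Module.End.mul_apply, ih, map_smul, h, smul_smul, pow_succ]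
  have h0 := this m
  rw [hm, LinearMap.zero_apply] at h0
  exact eq_zero_of_pow_eq_zero ((smul_eq_zero.1 h0.symm).resolve_right hy)

/-- The relation says `u a = α a`, and a nilpotent map has no nonzero eigenvalue. In particular a
nonzero `a` never lies in the image of its own left multiplication. -/
theorem Engel.coeff_eq_zero (hμ : Alternating μ) (hE : Engel μ) {a u : Fin n → k} {α : k}
    (ha : a ≠ 0) (h : α • a + μ a u = 0) : α = 0 := by
  refine hE.eq_zero_of_eigen (x := u) (y := a) ?_ ha
  rw [hμ.swap]
  exact (eq_neg_of_add_eq_zero_left h).symm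

/-- Replace `b` by its image under the power of `L_a` that leaves exactly three further steps before
vanishing. Applying `L_a` repeatedly to a relation then removes the coefficients of `b` and `ab`;
what is left relates `a` to the image of `L_a`. -/
theorem Engel.exists_T3_family (hμ : Alternating μ) (hE : Engel μ) {a b : Fin n → k}
    (h : μ a (μ a b) ≠ 0) : ∃ b, LinearIndependent k ![a, b, μ a b, μ a (μ a b)] ∧
      μ a (μ a (μ a b)) = 0 := by
  classical
  have hex : ∃ m, (μ a ^ m) b = 0 := by
    obtain ⟨m, hm⟩ := hE a
    exact ⟨m, by simp [hm]⟩
  have hmin := fun m => Nat.find_min hex (m := m)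
  have hsp := Nat.find_spec hex
  have hge : 3 ≤ Nat.find hex := by
    by_contra hlt
    have : ∀ m, m ≤ 2 → (μ a ^ m) b ≠ 0 := by
      intro m hm h0
      apply h
      have : (μ a ^ (2 - m)) ((μ a ^ m) b) = 0 := by rw [h0, map_zero]
      rw [← Module.End.mul_apply, ← pow_add, Nat.sub_add_cancel hm] at this
      simpa [pow_two, Module.End.mul_apply] using this
    exact this _ (by omega) hsp
  obtain ⟨m, hm⟩ := Nat.exists_eq_add_of_le' hge
  rw [hm] at hsp
  have h2 := hmin (m + 2) (by omega)
  simp only [pow_succ', Module.End.mul_apply] at hsp h2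
  refine ⟨(μ a ^ m) b, ?_, hsp⟩
  generalize (μ a ^ m) b = b at hsp h2
  have ha : a ≠ 0 := by
    rintro rfl
    simp at h2
  rw [Fintype.linearIndependent_iff]
  intro g hg
  rw [Fin.sum_univ_four] at hg
  simp only [Matrix.cons_val] at hg
  have e1 := congrArg (μ a) hg
  simp only [map_add, map_smul, hμ a, hsp, smul_zero, zero_add, add_zero, map_zero] at e1
  have e2 := congrArg (μ a) e1
  simp only [map_add, map_smul, hsp, smul_zero, add_zero, map_zero] at e2
  have g1 : g 1 = 0 := (smul_eq_zero.1 e2).resolve_right h2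
  rw [g1, zero_smul, zero_add] at e1
  have g2 : g 2 = 0 := (smul_eq_zero.1 e1).resolve_right h2
  rw [g1, g2, zero_smul, zero_smul, add_zero, add_zero, ← map_smul] at hg
  have g0 := hE.coeff_eq_zero hμ ha hg
  rw [g0, zero_smul, zero_add, map_smul] at hg
  have g3 : g 3 = 0 := (smul_eq_zero.1 hg).resolve_right h2
  intro i
  fin_cases i <;> assumption

/-- `L_a` kills `a` and all `a b_i`, so applying it leaves `∑ β i • a b_i = 0`. The remaining
relation puts `α a` in the image of `L_a`. -/
theorem Engel.coeffs_eq_zero (hμ : Alternating μ) (hE : Engel μ) (hT : TwoEngel μ) {r : ℕ}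
    {a : Fin n → k} {b : Fin r → Fin n → k} (hr : r ≠ 0)
    (hli : LinearIndependent k fun i => μ a (b i)) {α : k} {β γ : Fin r → k}
    (h : α • a + ∑ i, β i • b i + ∑ i, γ i • μ a (b i) = 0) :
    α = 0 ∧ (∀ i, β i = 0) ∧ ∀ i, γ i = 0 := by
  rw [Fintype.linearIndependent_iff] at hli
  have ha : a ≠ 0 := by
    rintro rfl
    have := hli 1 (by simp) ⟨0, Nat.pos_of_ne_zero hr⟩
    simp at this
  have e1 := congrArg (μ a) h
  simp only [map_add, map_smul, map_sum, hμ a, hT a, smul_zero, zero_add, add_zero, map_zero,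
    Finset.sum_const_zero] at e1
  have hβ := hli _ e1
  simp only [hβ, zero_smul, Finset.sum_const_zero, add_zero] at h
  have h' := h
  simp only [← map_smul, ← map_sum] at h'
  have hα := hE.coeff_eq_zero hμ ha h'
  rw [hα, zero_smul, zero_add] at h
  exact ⟨hα, hβ, hli _ h⟩

theorem Engel.linearIndependent_T22 (hμ : Alternating μ) (hE : Engel μ) (hT : TwoEngel μ)
    {a b c : Fin n → k} (h : LinearIndependent k ![μ a b, μ a c]) :
    LinearIndependent k ![a, b, c, μ a b, μ a c] := by
  have hli : LinearIndependent k (fun i => μ a (![b, c] i)) := by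
    convert h using 2 with i
    fin_cases i <;> rfl
  rw [Fintype.linearIndependent_iff]
  intro g hg
  obtain ⟨h0, h1, h2⟩ := hE.coeffs_eq_zero hμ hT two_ne_zero hli (α := g 0) (β := ![g 1, g 2])
    (γ := ![g 3, g 4]) (by
      rw [← hg, Fin.sum_univ_five, Fin.sum_univ_two, Fin.sum_univ_two]
      simp only [Matrix.cons_val]
      abel)
  intro i
  fin_cases i
  exacts [h0, h1 0, h1 1, h2 0, h2 1]

theorem Engel.linearIndependent_T222 (hμ : Alternating μ) (hE : Engel μ) (hT : TwoEngel μ)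
    {a b c d : Fin n → k} (h : LinearIndependent k ![μ a b, μ a c, μ a d]) :
    LinearIndependent k ![a, b, c, d, μ a b, μ a c, μ a d] := by
  have hli : LinearIndependent k (fun i => μ a (![b, c, d] i)) := by
    convert h using 2 with i
    fin_cases i <;> rfl
  rw [Fintype.linearIndependent_iff]
  intro g hg
  obtain ⟨h0, h1, h2⟩ := hE.coeffs_eq_zero hμ hT three_ne_zero hli (α := g 0)
    (β := ![g 1, g 2, g 3]) (γ := ![g 4, g 5, g 6]) (by
      rw [← hg, Fin.sum_univ_seven, Fin.sum_univ_three, Fin.sum_univ_three]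
      simp only [Matrix.cons_val]
      abel)
  intro i
  fin_cases i
  exacts [h0, h1 0, h1 1, h1 2, h2 0, h2 1, h2 2]

theorem TwoEngel.swap (hT : TwoEngel μ) (a b c : Fin n → k) : μ a (μ b c) = - μ b (μ a c) := by
  have := hT (a + b) c
  simp only [map_add, LinearMap.add_apply, hT a, hT b, zero_add, add_zero] at this
  exact eq_neg_of_add_eq_zero_left (by rw [add_comm]; exact this)

theorem TwoEngel.cycle (hμ : Alternating μ) (hT : TwoEngel μ) (a b c : Fin n → k) :
    μ a (μ b c) = μ b (μ c a) := by
  rw [hT.swap, hμ.swap c, map_neg]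

/-- By `TwoEngel.cycle` the vector `a (b c)` lies in the images of `L_a`, `L_b` and `L_c`. The rank
bound makes these the planes spanned by pairs among `ab, ac, bc`, whose common intersection is zero.
So `a (b c) = 0`, and applying `L_a` and `L_b` to a relation separates its coefficients. -/
theorem linearIndependent_T22eps23 (hμ : Alternating μ) (hT : TwoEngel μ)
    (hr : ∀ a b c d, ¬ LinearIndependent k ![μ a b, μ a c, μ a d])
    {a b c : Fin n → k} (h : LinearIndependent k ![μ a b, μ a c, μ b c]) :
    LinearIndependent k ![a, b, c, μ b c, μ a b, μ a c] := by
  have h3 := linearIndependent_three_iff.1 h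
  obtain ⟨p, q, hf⟩ := exists_eq_of_dependent_three (linearIndependent_of_three_left h)
    (hr a b c (μ b c))
  have hbl : LinearIndependent k ![μ b c, μ b a] := by
    rw [linearIndependent_two_iff]
    intro x y hxy
    rw [hμ.swap b a] at hxy
    have := h3 (-y) 0 x (by rw [← hxy]; module)
    exact ⟨this.2.2, by simpa using this.1⟩
  obtain ⟨p', q', hf'⟩ := exists_eq_of_dependent_three hbl (hr b c a (μ c a))
  rw [← hT.cycle hμ, hf, hμ.swap b a] at hf'
  have e1 := h3 (p + q') q (-p') (by
    have := sub_eq_zero.2 hf'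
    rw [← this]; module)
  have hcl : LinearIndependent k ![μ c a, μ c b] := by
    rw [linearIndependent_two_iff]
    intro x y hxy
    rw [hμ.swap c a, hμ.swap c b] at hxy
    have := h3 0 (-x) (-y) (by rw [← hxy]; module)
    exact ⟨by simpa using this.2.1, by simpa using this.2.2⟩
  obtain ⟨p'', q'', hf''⟩ := exists_eq_of_dependent_three hcl (hr c a b (μ a b))
  rw [← hT.cycle hμ, ← hT.cycle hμ, hf, hμ.swap c a, hμ.swap c b] at hf''
  have e2 := h3 p (q + p'') q'' (by
    have := sub_eq_zero.2 hf''
    rw [← this]; module)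
  rw [e1.2.1, e2.1, zero_smul, zero_smul, add_zero] at hf
  rw [Fintype.linearIndependent_iff]
  intro g hg
  rw [Fin.sum_univ_six] at hg
  simp only [Matrix.cons_val] at hg
  have ea := congrArg (μ a) hg
  simp only [map_add, map_smul, hμ a, hT a, hf, smul_zero, zero_add, add_zero, map_zero] at ea
  have ha := h3 (g 1) (g 2) 0 (by rw [← ea]; module)
  have eb := congrArg (μ b) hg
  have hbac : μ b (μ a c) = 0 := by rw [hT.swap, hf, neg_zero]
  have hbab : μ b (μ a b) = 0 := by rw [hT.swap, hμ b, map_zero, neg_zero]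
  simp only [map_add, map_smul, hT b, hbac, hbab, smul_zero, add_zero, map_zero,
    ha.1, ha.2.1, zero_smul, hμ.swap b a] at eb
  have hb := h3 (- g 0) 0 0 (by rw [← eb]; module)
  have g0 : g 0 = 0 := by simpa using hb.1
  rw [g0, ha.1, ha.2.1] at hg
  have hc := h3 (g 4) (g 5) (g 3) (by rw [← hg]; module)
  intro i
  fin_cases i
  exacts [g0, ha.1, ha.2.1, hc.2.2, hc.1, hc.2.1]

end Engel
-- The classification of alternating Engel structures
section Classification

variable {k : Type*} [Field k] {n : ℕ} {μ : AlgStr k n}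

theorem TwoStep.right (hμ : Alternating μ) (h : TwoStep μ) (x y z : Fin n → k) :
    μ z (μ x y) = 0 := by
  rw [hμ.swap, h, neg_zero]

theorem TwoStep.ann (h : TwoStep μ) (x y : Fin n → k) : μ (μ x y) = 0 :=
  LinearMap.ext fun z => h x y z

theorem le_of_linearIndependent {p : ℕ} {v : Fin p → Fin n → k} (h : LinearIndependent k v) :
    p ≤ n := by
  simpa using h.fintype_card_le_finrank

theorem TwoStep.linearIndependent_T22eps24 (hμ : Alternating μ) (h : TwoStep μ)
    {a b c d : Fin n → k} (hli : LinearIndependent k ![μ a b, μ a c]) (had : μ a d = 0)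
    (hbd : μ b d = μ a c) : LinearIndependent k ![a, b, c, d, μ a b, μ a c] := by
  rw [linearIndependent_two_iff] at hli
  rw [Fintype.linearIndependent_iff]
  intro g hg
  rw [Fin.sum_univ_six] at hg
  simp only [Matrix.cons_val] at hg
  have ea := congrArg (μ a) hg
  simp only [map_add, map_smul, hμ a, h.right hμ, had, smul_zero, zero_add, add_zero,
    map_zero] at ea
  have ha := hli _ _ ea
  have eb := congrArg (μ b) hg
  simp only [map_add, map_smul, h.right hμ, hbd, ha.1, ha.2, smul_zero, zero_smul, add_zero,
    map_zero, hμ.swap b a] at eb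
  have hb := hli (- g 0) (g 3) (by rw [← eb]; module)
  have g0 : g 0 = 0 := by simpa using hb.1
  rw [g0, ha.1, ha.2, hb.2] at hg
  have hc := hli (g 4) (g 5) (by rw [← hg]; module)
  intro i
  fin_cases i
  exacts [g0, ha.1, ha.2, hb.2, hc.1, hc.2]

/-- If `bd = p ab + q ac` with `q ≠ 0`, then `a, b, p b + q c, d` is the forbidden configuration. -/
theorem exists_smul_of_not_T22eps24 (hμ : Alternating μ) (h : TwoStep μ) {y z : Fin n → k}
    (hI : ∀ u v, ∃ p q : k, μ u v = p • y + q • z)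
    (hno : ¬ ∃ a b c d, LinearIndependent k ![a, b, c, d, μ a b, μ a c] ∧ μ a d = 0 ∧
      μ b d = μ a c)
    {a b c d : Fin n → k} (hli : LinearIndependent k ![μ a b, μ a c]) (had : μ a d = 0) :
    ∃ l : k, μ b d = l • μ a b := by
  obtain ⟨p, q, hpq⟩ := exists_eq_of_dependent_three hli
    (not_linearIndependent_of_mem_pair (hI a b) (hI a c) (hI b d))
  by_cases hq : q = 0
  · exact ⟨p, by rw [hpq, hq, zero_smul, add_zero]⟩
  · exfalso
    have hc : μ b d = μ a (p • b + q • c) := by rw [hpq, map_add, map_smul, map_smul]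
    refine hno ⟨a, b, p • b + q • c, d, h.linearIndependent_T22eps24 hμ ?_ had hc, had, hc⟩
    rw [linearIndependent_two_iff] at hli ⊢
    intro s t hst
    have := hli (s + t * p) (t * q) (by
      rw [← hst, map_add, map_smul, map_smul]; module)
    have ht : t = 0 := by simpa [hq] using this.2
    exact ⟨by simpa [ht] using this.1, ht⟩

/-- It suffices that `a, b, c` span modulo the annihilator. An element `d` of the kernel of `L_a`
sends each of `b`, `c`, `b + c` to a multiple of its product with `a`; the scalars agree, so `d + l
a` kills `a, b, c`. Elements killing `a, b, c` also kill each other. -/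
theorem T22_mem_orbit_of_not_T22eps24 (hμ : Alternating μ) (h : TwoStep μ) {a b c : Fin n → k}
    (hE : Engel μ) (hli : LinearIndependent k ![μ a b, μ a c])
    (hI : ∀ u v, ∃ p q : k, μ u v = p • μ a b + q • μ a c)
    (hK : ∀ x, ∃ β γ : k, μ a (x - (β • b + γ • c)) = 0) (hbc : μ b c = 0)
    (hno : ¬ ∃ a b c d, LinearIndependent k ![a, b, c, d, μ a b, μ a c] ∧ μ a d = 0 ∧
      μ b d = μ a c) : T22 k n ∈ orbit μ := by
  have hT : TwoEngel μ := fun x y => h.right hμ _ _ _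
  have h5 := hE.linearIndependent_T22 hμ hT hli
  have hli2 := linearIndependent_two_iff.1 hli
  have hcb : μ c b = 0 := by rw [hμ.swap, hbc, neg_zero]
  have hQ : ∀ x, ∃ α β γ : k, μ a (x - (α • a + β • b + γ • c)) = 0 ∧
      μ b (x - (α • a + β • b + γ • c)) = 0 ∧ μ c (x - (α • a + β • b + γ • c)) = 0 := by
    intro x
    obtain ⟨β, γ, hx⟩ := hK x
    set d := x - (β • b + γ • c) with hd
    obtain ⟨l, hl⟩ := exists_smul_of_not_T22eps24 hμ h hI hno hli hx
    obtain ⟨l', hl'⟩ := exists_smul_of_not_T22eps24 hμ h hI hno (a := a) (b := c) (c := b) (by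
      rw [linearIndependent_two_iff]
      intro s t hst
      have := hli2 t s (by rw [← hst, add_comm])
      exact this.symm) hx
    obtain ⟨l'', hl''⟩ := exists_smul_of_not_T22eps24 hμ h hI hno (a := a) (b := b + c) (c := c)
      (by
        rw [linearIndependent_two_iff]
        intro s t hst
        have := hli2 s (s + t) (by rw [← hst, map_add]; module)
        exact ⟨this.1, by simpa [this.1] using this.2⟩) hx
    rw [map_add, map_add, LinearMap.add_apply, hl, hl'] at hl''
    have hll := hli2 (l - l'') (l' - l'') (by
      have := sub_eq_zero.2 hl''
      rw [← this]; module)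
    have hl2 : l' = l := by
      rw [sub_eq_zero.1 hll.1, sub_eq_zero.1 hll.2]
    refine ⟨-l, β, γ, ?_⟩
    have hd' : x - (-l • a + β • b + γ • c) = d + l • a := by rw [hd]; module
    rw [hd']
    refine ⟨?_, ?_, ?_⟩
    · rw [map_add, map_smul, hx, hμ, smul_zero, add_zero]
    · rw [map_add, map_smul, hl, hμ.swap b a, smul_neg, add_neg_cancel]
    · rw [map_add, map_smul, hl', hμ.swap c a, smul_neg, hl2, add_neg_cancel]
  have hR : ∀ d d', μ a d = 0 → μ b d = 0 → μ c d = 0 → μ a d' = 0 → μ b d' = 0 → μ c d' = 0 →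
      μ d d' = 0 := by
    intro d d' had hbd hcd had' hbd' hcd'
    obtain ⟨p, q, hpq⟩ := hI d d'
    -- A nonzero `d d' = a b1` would make `a + d, c1 + d, b1, d' - b1` a forbidden configuration.
    have key : ∀ b1 c1, μ d d' = μ a b1 → μ c1 b1 = 0 → μ b1 d = 0 → μ c1 d = 0 → μ c1 d' = 0 →
        ¬ LinearIndependent k ![μ a c1, μ a b1] := by
      intro b1 c1 e1 e2 e3 e4 e5 hl
      have e3' : μ d b1 = 0 := by rw [hμ.swap, e3, neg_zero]
      have e4' : μ d c1 = 0 := by rw [hμ.swap, e4, neg_zero]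
      have f1 : μ (a + d) (c1 + d) = μ a c1 := by
        simp [had, e4', hμ d]
      have f2 : μ (a + d) b1 = μ a b1 := by simp [e3']
      have f3 : μ (a + d) (d' - b1) = 0 := by simp [had', e3', e1]
      have f4 : μ (c1 + d) (d' - b1) = μ a b1 := by simp [e5, e2, e3', e1]
      obtain ⟨l, hl'⟩ := exists_smul_of_not_T22eps24 hμ h hI hno (a := a + d) (b := c1 + d)
        (c := b1) (d := d' - b1) (by rwa [f1, f2]) f3
      rw [f4, f1] at hl'
      have := (linearIndependent_two_iff.1 hl) l (-1) (by rw [hl']; module)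
      simp at this
    by_cases hp : p = 0
    · by_cases hq : q = 0
      · rw [hpq, hp, hq, zero_smul, zero_smul, add_zero]
      · exfalso
        refine key (q • c) b (by rw [hpq, hp, map_smul, zero_smul, zero_add])
          (by simp [hbc]) (by simp [hcd]) hbd hbd' ?_
        rw [linearIndependent_two_iff]
        intro s t hst
        have := hli2 s (t * q) (by rw [← hst, map_smul]; module)
        exact ⟨this.1, by simpa [hq] using this.2⟩
    · exfalso
      refine key (p • b + q • c) c (by rw [hpq, map_add, map_smul, map_smul])
          (by simp [hcb, hμ c]) (by simp [hbd, hcd]) hcd hcd' ?_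
      rw [linearIndependent_two_iff]
      intro s t hst
      have := hli2 (t * p) (s + t * q) (by rw [← hst, map_add, map_smul, map_smul]; module)
      have ht : t = 0 := by simpa [hp] using this.1
      exact ⟨by simpa [ht] using this.2, ht⟩
  refine T22_mem_orbit hμ (le_of_linearIndependent h5) h5 hbc (h.ann _ _) (h.ann _ _) fun x => ?_
  obtain ⟨α, β, γ, h1, h2, h3⟩ := hQ x
  refine ⟨α, β, γ, LinearMap.ext fun w => ?_⟩
  obtain ⟨α', β', γ', h1', h2', h3'⟩ := hQ w
  set y := x - (α • a + β • b + γ • c)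
  have hw : w = (α' • a + β' • b + γ' • c) + (w - (α' • a + β' • b + γ' • c)) := by abel
  rw [hw, map_add, hR _ _ h1 h2 h3 h1' h2' h3', add_zero, map_add, map_add, map_smul, map_smul,
    map_smul, hμ.swap y a, hμ.swap y b, hμ.swap y c, h1, h2, h3]
  simp

/-- The span of `ab, ac` contains all products: adding elements of the kernel of `L_a` to `b` and
`c` keeps `ab, ac` fixed, so `hD` puts every perturbed `bc` in this span, and bilinearity isolates
each term. -/
theorem T22_or_T22eps24 (hμ : Alternating μ) (hE : Engel μ) (hT : TwoEngel μ)
    (hr : ∀ a b c d, ¬ LinearIndependent k ![μ a b, μ a c, μ a d])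
    (hD : ∀ a b c, ¬ LinearIndependent k ![μ a b, μ a c, μ b c])
    {a b c : Fin n → k} (hli : LinearIndependent k ![μ a b, μ a c]) :
    T22 k n ∈ orbit μ ∨ ∃ a b c d, LinearIndependent k ![a, b, c, d, μ a b, μ a c] ∧
      μ a d = 0 ∧ μ b d = μ a c := by
  have hK : ∀ x, ∃ β γ : k, μ a (x - (β • b + γ • c)) = 0 := by
    intro x
    obtain ⟨p, q, hpq⟩ := exists_eq_of_dependent_three hli (hr a b c x)
    exact ⟨p, q, by rw [map_sub, hpq, map_add, map_smul, map_smul, sub_self]⟩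
  have hI : ∀ u v, μ u v ∈ Submodule.span k {μ a b, μ a c} := by
    have hD' : ∀ y z, μ a y = μ a b → μ a z = μ a c → μ y z ∈ Submodule.span k {μ a b, μ a c} := by
      intro y z hy hz
      have := hD a y z
      rw [hy, hz] at this
      obtain ⟨p, q, hpq⟩ := exists_eq_of_dependent_three hli this
      exact Submodule.mem_span_pair.2 ⟨p, q, hpq.symm⟩
    have h1 : μ b c ∈ Submodule.span k {μ a b, μ a c} := hD' b c rfl rfl
    have h1' : μ c b ∈ Submodule.span k {μ a b, μ a c} := by
      rw [hμ.swap c b]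
      exact Submodule.neg_mem _ h1
    have h2 : ∀ w, μ a w = 0 → μ b w ∈ Submodule.span k {μ a b, μ a c} := by
      intro w hw
      have := hD' b (c + w) rfl (by rw [map_add, hw, add_zero])
      rw [map_add] at this
      exact (Submodule.add_mem_iff_right _ h1).1 this
    have h3 : ∀ w, μ a w = 0 → μ c w ∈ Submodule.span k {μ a b, μ a c} := by
      intro w hw
      have := hD' (b + w) c (by rw [map_add, hw, add_zero]) rfl
      rw [map_add, LinearMap.add_apply] at this
      have := (Submodule.add_mem_iff_right _ h1).1 this
      rw [hμ.swap c w]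
      exact Submodule.neg_mem _ this
    have h4 : ∀ w w', μ a w = 0 → μ a w' = 0 → μ w w' ∈ Submodule.span k {μ a b, μ a c} := by
      intro w w' hw hw'
      have := hD' (b + w) (c + w') (by rw [map_add, hw, add_zero]) (by rw [map_add, hw', add_zero])
      simp only [map_add, LinearMap.add_apply] at this
      have hwc : μ w c ∈ Submodule.span k {μ a b, μ a c} := by
        rw [hμ.swap w c]
        exact Submodule.neg_mem _ (h3 w hw)
      exact (Submodule.add_mem_iff_right _ (h2 w' hw')).1
        ((Submodule.add_mem_iff_right _ (Submodule.add_mem _ h1 hwc)).1 this)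
    have h5 : ∀ w v, μ a w = 0 → μ w v ∈ Submodule.span k {μ a b, μ a c} := by
      intro w v hw
      obtain ⟨β, γ, hv⟩ := hK v
      have e : v = (β • b + γ • c) + (v - (β • b + γ • c)) := by abel
      rw [e, map_add, map_add, map_smul, map_smul]
      refine Submodule.add_mem _ (Submodule.add_mem _ (Submodule.smul_mem _ _ ?_)
        (Submodule.smul_mem _ _ ?_)) (h4 _ _ hw hv)
      · rw [hμ.swap w b]
        exact Submodule.neg_mem _ (h2 w hw)
      · rw [hμ.swap w c]
        exact Submodule.neg_mem _ (h3 w hw)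
    intro u v
    obtain ⟨β, γ, hu⟩ := hK u
    obtain ⟨β', γ', hv⟩ := hK v
    have e : u = (β • b + γ • c) + (u - (β • b + γ • c)) := by abel
    have e' : v = (β' • b + γ' • c) + (v - (β' • b + γ' • c)) := by abel
    rw [e, map_add, LinearMap.add_apply]
    refine Submodule.add_mem _ ?_ (h5 _ _ hu)
    rw [e', map_add]
    refine Submodule.add_mem _ ?_ ?_
    · simp only [map_add, map_smul, LinearMap.add_apply, LinearMap.smul_apply, hμ b, hμ c,
        smul_zero, zero_add, add_zero]
      exact Submodule.add_mem _ (Submodule.smul_mem _ _ (Submodule.smul_mem _ _ h1'))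
        (Submodule.smul_mem _ _ (Submodule.smul_mem _ _ h1))
    · rw [hμ.swap (β • b + γ • c)]
      exact Submodule.neg_mem _ (h5 _ _ hv)
  have hI' : ∀ u v, ∃ p q : k, μ u v = p • μ a b + q • μ a c := fun u v => by
    obtain ⟨p, q, h⟩ := Submodule.mem_span_pair.1 (hI u v)
    exact ⟨p, q, h.symm⟩
  have haI : ∀ u v, μ a (μ u v) = 0 := by
    intro u v
    obtain ⟨p, q, h⟩ := hI' u v
    rw [h, map_add, map_smul, map_smul, hT, hT, smul_zero, smul_zero, add_zero]
  -- Products are combinations of `ab` and `ac`, and `x (a y) = - a (x y) = 0`.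
  have h2 : TwoStep μ := by
    have hx : ∀ x y, μ x (μ a y) = 0 := fun x y => by rw [hT.swap, haI, neg_zero]
    intro x y z
    rw [hμ.swap]
    obtain ⟨p, q, h⟩ := hI' x y
    rw [h, map_add, map_smul, map_smul, hx, hx, smul_zero, smul_zero, add_zero, neg_zero]
  by_contra hcon
  push Not at hcon
  obtain ⟨hc1, hno⟩ := hcon
  -- With `bc = u ab + v ac`, the vectors `b - v a` and `c + u a` have zero product and the same
  -- products with `a`.
  obtain ⟨u, v, huv⟩ := hI' b c
  have eb : μ a (b - v • a) = μ a b := by rw [map_sub, map_smul, hμ a, smul_zero, sub_zero]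
  have ec : μ a (c + u • a) = μ a c := by rw [map_add, map_smul, hμ a, smul_zero, add_zero]
  refine hc1 (T22_mem_orbit_of_not_T22eps24 hμ h2 hE (a := a) (b := b - v • a) (c := c + u • a)
    (by rwa [eb, ec]) (by rwa [eb, ec]) (fun x => ?_) ?_ ?_)
  · obtain ⟨β, γ, h⟩ := hK x
    refine ⟨β, γ, ?_⟩
    rw [map_sub, map_add, map_smul, map_smul, eb, ec]
    rwa [map_sub, map_add, map_smul, map_smul] at h
  · simp only [map_sub, map_add, map_smul, LinearMap.sub_apply, LinearMap.smul_apply, hμ a, huv,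
      hμ.swap b a]
    module
  · rintro ⟨a, b, c, d, h1, h2, h3⟩
    exact hno a b c d h1 h2 h3

/-- Suppose `xy` is off the line of `ab ≠ 0`. Then `ay` lies in the images of both `L_a` and `L_y`,
which are different lines, so it vanishes; likewise `xb = 0`. Now `L_{a+x}` sends `b, y` to `ab,
xy`, contradicting rank one. -/
theorem exists_products_eq_smul (hr : ∀ a b c, ¬ LinearIndependent k ![μ a b, μ a c])
    (hμ : Alternating μ) (h0 : μ ≠ 0) : ∃ z, z ≠ 0 ∧ ∀ x y, ∃ c : k, μ x y = c • z := by
  obtain ⟨a, b, hab⟩ : ∃ a b, μ a b ≠ 0 := by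
    by_contra hall
    push Not at hall
    exact h0 (LinearMap.ext₂ hall)
  refine ⟨μ a b, hab, fun x y => ?_⟩
  by_contra hxy
  have hw : μ x y ≠ 0 := fun h => hxy ⟨0, by rw [h, zero_smul]⟩
  have hzero : ∀ p q : k, p • μ a b = q • μ x y → q = 0 := by
    intro p q h
    by_contra hq
    exact hxy ⟨q⁻¹ * p, by rw [mul_smul, h, smul_smul, inv_mul_cancel₀ hq, one_smul]⟩
  have hba : μ b a ≠ 0 := by rwa [hμ.swap, neg_ne_zero]
  have hyx : μ y x ≠ 0 := by rwa [hμ.swap, neg_ne_zero]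
  have hya : μ a y = 0 := by
    obtain ⟨p, hp⟩ := exists_eq_of_dependent_two hab (hr a b y)
    obtain ⟨q, hq⟩ := exists_eq_of_dependent_two hyx (hr y x a)
    rw [hμ.swap y a, hμ.swap y x, smul_neg, neg_inj] at hq
    rw [hq, hzero p q (hp.symm.trans hq), zero_smul]
  have hxb : μ x b = 0 := by
    obtain ⟨p, hp⟩ := exists_eq_of_dependent_two hba (hr b a x)
    rw [hμ.swap b x, hμ.swap b a, smul_neg, neg_inj] at hp
    obtain ⟨q, hq⟩ := exists_eq_of_dependent_two hw (hr x y b)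
    rw [hq, hzero p q (hp.symm.trans hq), zero_smul]
  obtain ⟨p, hp⟩ := exists_eq_of_dependent_two (x := μ (a + x) b) (by simpa [hxb] using hab)
    (hr (a + x) b y)
  rw [map_add, LinearMap.add_apply, LinearMap.add_apply, hxb, hya, zero_add, add_zero] at hp
  exact hxy ⟨p, hp⟩

/-- Symplectic Gram-Schmidt, valid in every characteristic because the form is alternating. As long
as the structure is not `eta m`, the orthogonal complement of the pairs contains a new pair; the
bound `2 * m < n` stops the process. -/
theorem exists_hyperbolicPairs (hμ : Alternating μ) {z : Fin n → k} (hz : z ≠ 0) (hann : μ z = 0)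
    (hI : ∀ x y, ∃ c : k, μ x y = c • z) : ∃ (m : ℕ) (x : Fin (2 * m) → Fin n → k),
      HyperbolicPairs μ z m x ∧ eta k n m ∈ orbit μ := by
  obtain ⟨f, hf⟩ : ∃ f : (Fin n → k) →ₗ[k] k, f z = 1 := by
    obtain ⟨i, hi⟩ := Function.ne_iff.1 hz
    exact ⟨(z i)⁻¹ • LinearMap.proj i, by simpa using inv_mul_cancel₀ hi⟩
  have hfz : ∀ x y, μ x y = f (μ x y) • z := by
    intro x y
    obtain ⟨c, hc⟩ := hI x y
    rw [hc, map_smul, hf, smul_eq_mul, mul_one]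
  have step : ∀ (m : ℕ) (x : Fin (2 * m) → Fin n → k), HyperbolicPairs μ z m x →
      eta k n m ∉ orbit μ → ∃ x', HyperbolicPairs μ z (m + 1) x' := by
    intro m x hx hno
    have hproj : ∀ y, ∃ c : Fin (2 * m) → k, ∀ j, μ (y - ∑ i, c i • x i) (x j) = 0 := by
      -- The Gram map of the pairs is injective, hence bijective, which provides orthogonal
      -- projection.
      let Φ : (Fin (2 * m) → k) →ₗ[k] (Fin (2 * m) → k) :=
        LinearMap.pi fun j => f ∘ₗ μ.flip (x j) ∘ₗ Fintype.linearCombination k x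
      have hΦ : ∀ c j, Φ c j = f (μ (∑ i, c i • x i) (x j)) := fun c j => rfl
      have hinj : Function.Injective Φ := by
        rw [injective_iff_map_eq_zero]
        intro c hc
        funext j
        refine hx.coeff_eq_zero hμ (fun j => ?_) j
        rw [hfz, ← hΦ, hc, Pi.zero_apply, zero_smul]
      intro y
      obtain ⟨c, hc⟩ := LinearMap.injective_iff_surjective.1 hinj fun j => f (μ y (x j))
      refine ⟨c, fun j => ?_⟩
      have := congrFun hc j
      rw [hΦ] at this
      rw [map_sub, LinearMap.sub_apply, hfz y, ← this, ← hfz, sub_self]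
    obtain ⟨u, v, hu, hv, huv⟩ : ∃ u v, (∀ j, μ u (x j) = 0) ∧ (∀ j, μ v (x j) = 0) ∧
        μ u v ≠ 0 := by
      by_contra hall
      push Not at hall
      refine hno (eta_mem_orbit hμ hx fun y => ?_)
      obtain ⟨c, hc⟩ := hproj y
      refine ⟨c, LinearMap.ext fun w => ?_⟩
      obtain ⟨c', hc'⟩ := hproj w
      have hw : w = (∑ i, c' i • x i) + (w - ∑ i, c' i • x i) := by abel
      rw [hw, map_add, hall _ _ hc hc', map_sum]
      simp only [map_smul, hc, smul_zero, Finset.sum_const_zero, add_zero, LinearMap.zero_apply]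
    obtain ⟨s, hs⟩ := hI u v
    have hs0 : s ≠ 0 := by
      rintro rfl
      exact huv (by rw [hs, zero_smul])
    have hu' : ∀ j, μ (x j) u = 0 := fun j => by rw [hμ.swap, hu, neg_zero]
    have hv' : ∀ j, μ (x j) v = 0 := fun j => by rw [hμ.swap, hv, neg_zero]
    refine ⟨fun i => if h : i.val < 2 * m then x ⟨i, h⟩ else
      if i.val = 2 * m then s⁻¹ • u else v, hz, hann, fun i j hij => ?_⟩
    have hj := j.isLt
    by_cases hjm : j.val < 2 * m
    · rw [dif_pos (hij.trans hjm), dif_pos hjm, hx.mul _ _ hij]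
    · rw [dif_neg hjm]
      by_cases him : i.val < 2 * m
      · rw [dif_pos him, if_neg (by omega : ¬ (i.val % 2 = 0 ∧ j.val = i.val + 1))]
        split_ifs
        · rw [map_smul, hu', smul_zero]
        · exact hv' _
      · rw [dif_neg him, if_pos (by omega), if_neg (by omega), if_pos (by omega), map_smul,
          LinearMap.smul_apply, hs, smul_smul, inv_mul_cancel₀ hs0, one_smul]
  by_contra hcon
  push Not at hcon
  have hall : ∀ m, ∃ x : Fin (2 * m) → Fin n → k, HyperbolicPairs μ z m x := by
    intro m
    induction m with
    | zero => exact ⟨fun i => 0, hz, hann, fun i => i.elim0⟩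
    | succ m ih =>
      obtain ⟨x, hx⟩ := ih
      exact step m x hx (hcon m x hx)
  obtain ⟨x, hx⟩ := hall n
  have := hx.two_mul_lt hμ
  omega

/-- Every alternating Engel structure is zero, or isomorphic to some `eta` or to `T22`, or it
contains one of four configurations. -/
theorem Engel.classification (hμ : Alternating μ) (hE : Engel μ) :
    μ = 0 ∨
    (∃ (m : ℕ) (z : Fin n → k) (x : Fin (2 * m) → Fin n → k), 1 ≤ m ∧ HyperbolicPairs μ z m x ∧
      eta k n m ∈ orbit μ) ∨
    (T22 k n ∈ orbit μ ∧ ∃ a b c, LinearIndependent k ![a, b, c, μ a b, μ a c]) ∨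
    (∃ a b, LinearIndependent k ![a, b, μ a b, μ a (μ a b)]) ∨
    (∃ a b c d, LinearIndependent k ![a, b, c, d, μ a b, μ a c, μ a d]) ∨
    (∃ a b c, LinearIndependent k ![a, b, c, μ b c, μ a b, μ a c]) ∨
    (∃ a b c d, LinearIndependent k ![a, b, c, d, μ a b, μ a c] ∧ μ a d = 0 ∧
      μ b d = μ a c) := by
  by_cases hT : TwoEngel μ
  swap
  · unfold TwoEngel at hT
    push Not at hT
    obtain ⟨a, b, hab⟩ := hT
    obtain ⟨b, hb, -⟩ := hE.exists_T3_family hμ hab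
    exact Or.inr (Or.inr (Or.inr (Or.inl ⟨a, b, hb⟩)))
  by_cases hr : ∀ a b c d, ¬ LinearIndependent k ![μ a b, μ a c, μ a d]
  swap
  · push Not at hr
    obtain ⟨a, b, c, d, h⟩ := hr
    exact Or.inr (Or.inr (Or.inr (Or.inr (Or.inl
      ⟨a, b, c, d, hE.linearIndependent_T222 hμ hT h⟩))))
  by_cases hD : ∀ a b c, ¬ LinearIndependent k ![μ a b, μ a c, μ b c]
  swap
  · push Not at hD
    obtain ⟨a, b, c, h⟩ := hD
    exact Or.inr (Or.inr (Or.inr (Or.inr (Or.inr (Or.inl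
      ⟨a, b, c, linearIndependent_T22eps23 hμ hT hr h⟩)))))
  by_cases hr1 : ∀ a b c, ¬ LinearIndependent k ![μ a b, μ a c]
  swap
  · push Not at hr1
    obtain ⟨a, b, c, h⟩ := hr1
    rcases T22_or_T22eps24 hμ hE hT hr hD h with h1 | h1
    · exact Or.inr (Or.inr (Or.inl ⟨h1, a, b, c, hE.linearIndependent_T22 hμ hT h⟩))
    · exact Or.inr (Or.inr (Or.inr (Or.inr (Or.inr (Or.inr h1)))))
  by_cases h0 : μ = 0
  · exact Or.inl h0
  obtain ⟨z, hz, hI⟩ := exists_products_eq_smul hr1 hμ h0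
  -- Every `x z` is a multiple of `z`, so the Engel condition makes it zero.
  have hann : μ z = 0 := by
    refine LinearMap.ext fun x => ?_
    obtain ⟨c, hc⟩ := hI x z
    rw [hμ.swap, hc, hE.eq_zero_of_eigen hc hz, zero_smul, neg_zero, LinearMap.zero_apply]
  obtain ⟨m, x, hx, hm⟩ := exists_hyperbolicPairs hμ hz hann hI
  refine Or.inr (Or.inl ⟨m, z, x, ?_, hx, hm⟩)
  rcases Nat.eq_zero_or_pos m with rfl | hm'
  · exfalso
    obtain ⟨g, hg⟩ := mem_orbit_iff.1 (orbit_symm hm)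
    have : eta k n 0 = 0 := by simp [eta]
    refine h0 (LinearMap.ext₂ fun x y => ?_)
    obtain ⟨x, rfl⟩ := g.surjective x
    obtain ⟨y, rfl⟩ := g.surjective y
    rw [hg, this]
    simp
  · exact hm'

end Classification
-- Linear functionals separating vectors
section Functionals

variable {k : Type*} [Field k] {V : Type*} [AddCommGroup V] [Module k V]

theorem exists_functional_eq {ι : Type*} [Fintype ι] {v : ι → V} (hv : LinearIndependent k v)
    (g : ι → k) : ∃ f : V →ₗ[k] k, ∀ i, f (v i) = g i := by
  classical
  obtain ⟨φ, hφ⟩ := (Fintype.linearCombination k v).exists_leftInverse_of_injective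
    (LinearMap.ker_eq_bot.2 hv.fintypeLinearCombination_injective)
  refine ⟨Fintype.linearCombination k g ∘ₗ φ, fun i => ?_⟩
  have := LinearMap.congr_fun hφ (Pi.single i 1)
  simp only [LinearMap.comp_apply, Fintype.linearCombination_apply_single, one_smul,
    LinearMap.id_apply] at this
  simp [this, Fintype.linearCombination_apply_single]

/-- A dual space is not the union of two proper subspaces. -/
theorem exists_functional_ne_zero {p q : V} (hp : p ≠ 0) (hq : q ≠ 0) :
    ∃ f : V →ₗ[k] k, f p ≠ 0 ∧ f q ≠ 0 := by
  have h1 : ∀ {p : V}, p ≠ 0 → ∃ f : V →ₗ[k] k, f p = 1 := fun {p} hp => by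
    obtain ⟨f, hf⟩ := exists_functional_eq (k := k) (v := fun _ : Unit => p)
      (linearIndependent_unique_iff.2 hp) (fun _ => 1)
    exact ⟨f, hf ()⟩
  obtain ⟨f, hf⟩ := h1 hp
  obtain ⟨g, hg⟩ := h1 hq
  by_cases hfq : f q = 0
  · by_cases hgp : g p = 0
    · exact ⟨f + g, by simp [hf, hgp], by simp [hg, hfq]⟩
    · exact ⟨g, hgp, by simp [hg]⟩
  · exact ⟨f, by simp [hf], hfq⟩

theorem exists_functional_ker {y p q : V} (hp : ∀ c : k, p ≠ c • y) (hq : ∀ c : k, q ≠ c • y) :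
    ∃ f : V →ₗ[k] k, f y = 0 ∧ f p ≠ 0 ∧ f q ≠ 0 := by
  have h : ∀ {p : V}, (∀ c : k, p ≠ c • y) → (Submodule.span k {y}).mkQ p ≠ 0 := by
    intro p hp h0
    rw [Submodule.mkQ_apply, Submodule.Quotient.mk_eq_zero, Submodule.mem_span_singleton] at h0
    obtain ⟨c, hc⟩ := h0
    exact hp c hc.symm
  obtain ⟨f, hfp, hfq⟩ := exists_functional_ne_zero (k := k) (h hp) (h hq)
  refine ⟨f ∘ₗ (Submodule.span k {y}).mkQ, ?_, hfp, hfq⟩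
  rw [LinearMap.comp_apply, Submodule.mkQ_apply,
    (Submodule.Quotient.mk_eq_zero _).2 (Submodule.mem_span_singleton_self y), map_zero]

end Functionals

/-! ### Closed conditions that identify a model -/

section Recognition

variable {k : Type*} [Field k] {n : ℕ} {μ : AlgStr k n}

theorem AnnCorankLE.exists_sub {r : ℕ} (h : AnnCorankLE r μ) {y : Fin r → Fin n → k}
    (hy : LinearIndependent k fun i => μ (y i)) (x : Fin n → k) :
    ∃ c : Fin r → k, μ (x - ∑ i, c i • y i) = 0 := by
  have h1 := h (Fin.snoc y x)
  have h2 : (fun i => μ ((Fin.snoc y x : Fin (r + 1) → Fin n → k) i)) =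
      Fin.snoc (fun i => μ (y i)) (μ x) := by
    funext i
    refine Fin.lastCases ?_ (fun i => ?_) i <;> simp
  rw [h2, linearIndependent_finSnoc, not_and, not_not] at h1
  obtain ⟨c, hc⟩ := (Submodule.mem_span_range_iff_exists_fun k).1 (h1 hy)
  refine ⟨c, ?_⟩
  rw [map_sub, map_sum, ← hc]
  simp

theorem DerivedRankLE.exists_eq {r : ℕ} (h : DerivedRankLE r μ) {a b : Fin r → Fin n → k}
    (hy : LinearIndependent k fun i => μ (a i) (b i)) (x y : Fin n → k) :
    ∃ c : Fin r → k, μ x y = ∑ i, c i • μ (a i) (b i) := by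
  have h1 := h (Fin.snoc a x) (Fin.snoc b y)
  have h2 : (fun i => μ ((Fin.snoc a x : Fin (r + 1) → Fin n → k) i)
      ((Fin.snoc b y : Fin (r + 1) → Fin n → k) i)) =
      Fin.snoc (fun i => μ (a i) (b i)) (μ x y) := by
    funext i
    refine Fin.lastCases ?_ (fun i => ?_) i <;> simp
  rw [h2, linearIndependent_finSnoc, not_and, not_not] at h1
  obtain ⟨c, hc⟩ := (Submodule.mem_span_range_iff_exists_fun k).1 (h1 hy)
  exact ⟨c, hc.symm⟩

theorem DerivedRankLE.not_pair (h : DerivedRankLE 1 μ) (a b c d : Fin n → k) :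
    ¬ LinearIndependent k ![μ a b, μ c d] := by
  have := h ![a, c] ![b, d]
  convert this using 2
  funext i
  fin_cases i <;> rfl

theorem DerivedRankLE.not_triple (h : DerivedRankLE 2 μ) (a b c d e f : Fin n → k) :
    ¬ LinearIndependent k ![μ a b, μ c d, μ e f] := by
  have := h ![a, c, e] ![b, d, f]
  convert this using 2
  funext i
  fin_cases i <;> rfl

theorem DerivedRankLE.exists_eq_pair (h : DerivedRankLE 2 μ) {a b c d : Fin n → k}
    (hli : LinearIndependent k ![μ a b, μ c d]) (x y : Fin n → k) :
    ∃ p q : k, μ x y = p • μ a b + q • μ c d :=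
  exists_eq_of_dependent_three hli (h.not_triple _ _ _ _ _ _)

theorem DerivedRankLE.exists_eq_triple (h : DerivedRankLE 3 μ) {a b c d : Fin n → k}
    (hli : LinearIndependent k ![μ a b, μ a c, μ a d]) (x y : Fin n → k) :
    ∃ p q r : k, μ x y = p • μ a b + q • μ a c + r • μ a d := by
  obtain ⟨g, hg⟩ := h.exists_eq (a := fun _ => a) (b := ![b, c, d]) (by
    convert hli using 2 with i
    fin_cases i <;> rfl) x y
  exact ⟨g 0, g 1, g 2, by rw [hg, Fin.sum_univ_three]; rfl⟩

theorem triangleDep_iff : TriangleDep μ ↔ ∀ a b c, ¬ LinearIndependent k ![μ a b, μ a c, μ b c] := by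
  have key : ∀ x : Fin 3 → Fin n → k,
      (fun i : Fin 3 => μ (x (![0, 0, 1] i)) (x (![1, 2, 2] i))) =
        ![μ (x 0) (x 1), μ (x 0) (x 2), μ (x 1) (x 2)] := by
    intro x
    funext i
    fin_cases i <;> rfl
  constructor
  · intro h a b c
    have := h ![a, b, c]
    rwa [key] at this
  · intro h x
    rw [key]
    exact h _ _ _

theorem linearIndependent_pair_of_T22 {a b c : Fin n → k}
    (h : LinearIndependent k ![a, b, c, μ a b, μ a c]) :
    LinearIndependent k ![μ a b, μ a c] := by
  have := h.comp ![3, 4] (by decide)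
  convert this using 1
  funext i
  fin_cases i <;> rfl

theorem linearIndependent_pair_of_T3 {a b : Fin n → k}
    (h : LinearIndependent k ![a, b, μ a b, μ a (μ a b)]) :
    LinearIndependent k ![μ a b, μ a (μ a b)] := by
  have := h.comp ![2, 3] (by decide)
  convert this using 1
  funext i
  fin_cases i <;> rfl

theorem linearIndependent_pair_of_T22eps24 {a b c d : Fin n → k}
    (h : LinearIndependent k ![a, b, c, d, μ a b, μ a c]) :
    LinearIndependent k ![μ a b, μ a c] := by
  have := h.comp ![4, 5] (by decide)
  convert this using 1
  funext i
  fin_cases i <;> rfl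

theorem linearIndependent_triple_of_T22eps23 {a b c : Fin n → k}
    (h : LinearIndependent k ![a, b, c, μ b c, μ a b, μ a c]) :
    LinearIndependent k ![μ a b, μ a c, μ b c] := by
  have := h.comp ![4, 5, 3] (by decide)
  convert this using 1
  funext i
  fin_cases i <;> rfl

theorem linearIndependent_triple_of_T222 {a b c d : Fin n → k}
    (h : LinearIndependent k ![a, b, c, d, μ a b, μ a c, μ a d]) :
    LinearIndependent k ![μ a b, μ a c, μ a d] := by
  have := h.comp ![4, 5, 6] (by decide)
  convert this using 1
  funext i
  fin_cases i <;> rfl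

theorem linearIndependent_mul_T22eps23 (hμ : Alternating μ) {a b c : Fin n → k}
    (h : LinearIndependent k ![μ a b, μ a c, μ b c]) :
    LinearIndependent k fun i => μ (![a, b, c] i) := by
  have h3 := linearIndependent_three_iff.1 h
  rw [Fintype.linearIndependent_iff]
  intro g hg
  rw [Fin.sum_univ_three] at hg
  have e1 := LinearMap.congr_fun hg b
  have e2 := LinearMap.congr_fun hg a
  simp only [Matrix.cons_val, LinearMap.add_apply, LinearMap.smul_apply, hμ b, hμ a, hμ.swap c b,
    hμ.swap b a, hμ.swap c a, LinearMap.zero_apply] at e1 e2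
  have f1 := h3 (g 0) 0 (- g 2) (by rw [← e1]; module)
  have f2 := h3 (- g 1) (- g 2) 0 (by rw [← e2]; module)
  intro i
  fin_cases i
  exacts [f1.1, by simpa using f2.1, by simpa using f2.2.1]

theorem linearIndependent_mul_T22eps24 (hμ : Alternating μ) {a b c d : Fin n → k}
    (h : LinearIndependent k ![μ a b, μ a c]) (had : μ a d = 0) (hbd : μ b d = μ a c) :
    LinearIndependent k fun i => μ (![a, b, c, d] i) := by
  have h3 := linearIndependent_two_iff.1 h
  rw [Fintype.linearIndependent_iff]
  intro g hg
  rw [Fin.sum_univ_four] at hg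
  have e1 := LinearMap.congr_fun hg a
  have e2 := LinearMap.congr_fun hg b
  simp only [Matrix.cons_val, LinearMap.add_apply, LinearMap.smul_apply, hμ b, hμ a,
    hμ.swap b a, hμ.swap c a, hμ.swap d a, hμ.swap d b, had, hbd, LinearMap.zero_apply] at e1 e2
  have f1 := h3 (- g 1) (- g 2) (by rw [← e1]; module)
  have g1 : g 1 = 0 := by simpa using f1.1
  have g2 : g 2 = 0 := by simpa using f1.2
  rw [g1, g2] at e2
  have f2 := h3 (g 0) (- g 3) (by rw [← e2]; module)
  intro i
  fin_cases i
  exacts [f2.1, g1, g2, by simpa using f2.2]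

theorem linearIndependent_mul_T222 (hμ : Alternating μ) {a b c d : Fin n → k}
    (h : LinearIndependent k ![μ a b, μ a c, μ a d]) :
    LinearIndependent k fun i => μ (![a, b, c, d] i) := by
  have h3 := linearIndependent_three_iff.1 h
  rw [Fintype.linearIndependent_iff]
  intro g hg
  rw [Fin.sum_univ_four] at hg
  have e1 := LinearMap.congr_fun hg a
  have e2 := LinearMap.congr_fun hg b
  simp only [Matrix.cons_val, LinearMap.add_apply, LinearMap.smul_apply, hμ b, hμ a,
    hμ.swap b a, hμ.swap c a, hμ.swap d a, LinearMap.zero_apply] at e1 e2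
  have f1 := h3 (- g 1) (- g 2) (- g 3) (by rw [← e1]; module)
  have g1 : g 1 = 0 := by simpa using f1.1
  have g2 : g 2 = 0 := by simpa using f1.2.1
  have g3 : g 3 = 0 := by simpa using f1.2.2
  rw [g1, g2, g3] at e2
  have f2 := h3 (g 0) 0 0 (by rw [← e2]; module)
  intro i
  fin_cases i
  exacts [f2.1, g1, g2, g3]

theorem HyperbolicPairs.two_mul_le {z : Fin n → k} {m r : ℕ} {x : Fin (2 * m) → Fin n → k}
    (h : HyperbolicPairs μ z m x) (hμ : Alternating μ) (hr : AnnCorankLE r μ) : 2 * m ≤ r := by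
  by_contra hlt
  push Not at hlt
  have hli : LinearIndependent k fun i => μ (x i) := by
    rw [Fintype.linearIndependent_iff]
    intro c hc
    refine h.coeff_eq_zero hμ fun j => ?_
    rw [map_sum]
    simp only [map_smul]
    rw [hc, LinearMap.zero_apply]
  exact hr (fun i => x (Fin.castLE hlt i)) (hli.comp _ (Fin.castLE_injective hlt))

/-- On two hyperbolic pairs the Pfaffian is `f z ^ 2`. -/
theorem PfZero.not_hyperbolicPairs (hP : PfZero μ) {z : Fin n → k} {m : ℕ}
    {x : Fin (2 * m) → Fin n → k} (h : HyperbolicPairs μ z m x) : m ≤ 1 := by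
  by_contra hm
  push Not at hm
  obtain ⟨f, hf, -⟩ := exists_functional_ne_zero (k := k) h.ne_zero h.ne_zero
  have := hP f (x ⟨0, by omega⟩) (x ⟨1, by omega⟩) (x ⟨2, by omega⟩) (x ⟨3, by omega⟩)
  rw [pf, h.mul _ _ (by simp), h.mul _ _ (by simp), h.mul _ _ (by simp),
    h.mul _ _ (by simp), h.mul _ _ (by simp), h.mul _ _ (by simp)] at this
  simp [hf] at this

theorem PfZero.not_T22eps24 (hP : PfZero μ) {a b c d : Fin n → k}
    (h : LinearIndependent k ![μ a b, μ a c]) (had : μ a d = 0) (hbd : μ b d = μ a c) : False := by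
  obtain ⟨f, hf⟩ := exists_functional_eq h ![0, 1]
  have h0 : f (μ a b) = 0 := hf 0
  have h1 : f (μ a c) = 1 := hf 1
  have := hP f a b c d
  rw [pf, h0, hbd, h1, had] at this
  simp at this

theorem T22eps23_mem_orbit_of_config (hμ : Alternating μ) (h2 : TwoStep μ)
    (hA : AnnCorankLE 3 μ) {a b c : Fin n → k}
    (h : LinearIndependent k ![a, b, c, μ b c, μ a b, μ a c]) : T22eps23 k n ∈ orbit μ := by
  refine T22eps23_mem_orbit hμ (le_of_linearIndependent h) h (h2.ann _ _) (h2.ann _ _) (h2.ann _ _)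
    fun x => ?_
  obtain ⟨g, hg⟩ := hA.exists_sub
    (linearIndependent_mul_T22eps23 hμ (linearIndependent_triple_of_T22eps23 h)) x
  rw [Fin.sum_univ_three] at hg
  exact ⟨_, _, _, hg⟩

/-- The form `p X² + q X Y - Y²` has zero discriminant, hence equals `-(Y - m X)²`. In
characteristic two the hypothesis says only `q = 0`, and `m` is a square root of `-p`. -/
theorem exists_sq_root [IsAlgClosed k] {p q : k} (h : q ^ 2 = 4 * p * (-1)) :
    ∃ m : k, p = - m ^ 2 ∧ q = 2 * m := by
  by_cases h2 : (2 : k) = 0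
  · obtain ⟨m, hm⟩ := IsAlgClosed.exists_pow_nat_eq (-p) (n := 2) (by norm_num)
    refine ⟨m, by rw [hm, neg_neg], ?_⟩
    have h4 : (4 : k) = 0 := by
      have : (4 : k) = 2 * 2 := by norm_num
      rw [this, h2, zero_mul]
    rw [h4, zero_mul, zero_mul] at h
    rw [h2, zero_mul]
    exact pow_eq_zero_iff (two_ne_zero) |>.1 h
  · refine ⟨q / 2, ?_, by field_simp⟩
    have h4 : (4 : k) ≠ 0 := by
      have : (4 : k) = 2 * 2 := by norm_num
      rw [this]
      exact mul_ne_zero h2 h2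
    rw [div_pow, h]
    have : (2 : k) ^ 2 = 4 := by norm_num
    rw [this]
    field_simp

/-- After normalising `bc = 0`, only `cd = p ab + q ac` is left to remove. The Pfaffian on `a, b, c,
d` is `p X² + q X Y - Y²` with `X = f (ab)`, `Y = f (ac)`, so `PfSquare` makes it `-(Y - m X)²`, and
replacing `c, d` by `c - m b, d + m a` gives `cd = 0`. -/
theorem T22eps24_mem_orbit_of_config [IsAlgClosed k] (hμ : Alternating μ) (h2 : TwoStep μ)
    (hD : DerivedRankLE 2 μ) (hA : AnnCorankLE 4 μ) (hP : PfSquare μ) {a b c d : Fin n → k}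
    (h : LinearIndependent k ![a, b, c, d, μ a b, μ a c]) (had : μ a d = 0)
    (hbd : μ b d = μ a c) : T22eps24 k n ∈ orbit μ := by
  have hli := linearIndependent_pair_of_T22eps24 h
  have hn := le_of_linearIndependent h
  obtain ⟨u, v, hbc⟩ := hD.exists_eq_pair hli b c
  obtain ⟨p₀, q₀, hcd₀⟩ := hD.exists_eq_pair hli c d
  obtain ⟨b', hb', eb, eb2⟩ : ∃ b', b' = b - v • a ∧ μ a b' = μ a b ∧ μ b' d = μ b d := by
    refine ⟨_, rfl, ?_, ?_⟩
    · rw [map_sub, map_smul, hμ a, smul_zero, sub_zero]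
    · rw [map_sub, map_smul, LinearMap.sub_apply, LinearMap.smul_apply, had, smul_zero, sub_zero]
  obtain ⟨c', hc', ec⟩ : ∃ c', c' = c + u • a ∧ μ a c' = μ a c :=
    ⟨_, rfl, by rw [map_add, map_smul, hμ a, smul_zero, add_zero]⟩
  have ebc : μ b' c' = 0 := by
    rw [hb', hc']
    simp only [map_sub, map_add, map_smul, LinearMap.sub_apply, LinearMap.smul_apply, hμ a, hbc,
      hμ.swap b a]
    module
  rw [← eb, ← ec] at hli
  rw [← eb2, ← ec] at hbd
  clear hb' hc' hcd₀ hbc h eb ec eb2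
  obtain ⟨p, q, hcd⟩ := hD.exists_eq_pair hli c' d
  have hq : q ^ 2 = 4 * p * (-1) := by
    obtain ⟨f, hf⟩ := exists_functional_eq hli ![1, 0]
    obtain ⟨g, hg⟩ := exists_functional_eq hli ![0, 1]
    have f1 : f (μ a b') = 1 := hf 0
    have f2 : f (μ a c') = 0 := hf 1
    have g1 : g (μ a b') = 0 := hg 0
    have g2 : g (μ a c') = 1 := hg 1
    have := hP f g a b' c' d
    simp only [pf, hcd, hbd, ebc, had, LinearMap.add_apply, map_add, map_smul, map_zero, f1, f2, g1,
      g2, smul_eq_mul] at this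
    ring_nf at this ⊢
    exact this
  obtain ⟨m, hp, hq'⟩ := exists_sq_root hq
  have ecm : μ a (c' - m • b') = μ a c' - m • μ a b' := by rw [map_sub, map_smul]
  have hcb : μ c' b' = 0 := by rw [hμ.swap, ebc, neg_zero]
  have hli2 : LinearIndependent k ![μ a b', μ a (c' - m • b')] := by
    rw [ecm]
    rw [linearIndependent_two_iff] at hli ⊢
    intro s t hst
    have := hli (s - t * m) t (by rw [← hst]; module)
    exact ⟨by simpa [this.2] using this.1, this.2⟩
  have e1 : μ a (d + m • a) = 0 := by rw [map_add, map_smul, hμ a, had, smul_zero, add_zero]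
  have e2 : μ b' (d + m • a) = μ a (c' - m • b') := by
    rw [ecm, map_add, map_smul, hbd, hμ.swap b' a, smul_neg, sub_eq_add_neg]
  have e3 : μ b' (c' - m • b') = 0 := by rw [map_sub, map_smul, hμ b', ebc, smul_zero, sub_zero]
  have e4 : μ (c' - m • b') (d + m • a) = 0 := by
    rw [map_sub, LinearMap.sub_apply, map_smul, LinearMap.smul_apply, e2, ecm, map_add, map_smul,
      hcd, hμ.swap c' a, hp, hq']
    module
  refine T22eps24_mem_orbit hμ hn (h2.linearIndependent_T22eps24 hμ hli2 e1 e2) e3 e1 e2 e4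
    (h2.ann _ _) (h2.ann _ _) fun x => ?_
  obtain ⟨g, hg⟩ := hA.exists_sub (linearIndependent_mul_T22eps24 hμ hli2 e1 e2) x
  rw [Fin.sum_univ_four] at hg
  exact ⟨_, _, _, _, hg⟩

/-- Here the Pfaffian reduces to `f (ab) * f (w w')`. -/
theorem PfZero.mul_eq_zero (hP : PfZero μ) {a b w w' : Fin n → k} (hab : μ a b ≠ 0)
    (hw : μ a w = 0) (hw' : μ a w' = 0) : μ w w' = 0 := by
  by_contra hne
  obtain ⟨f, h1, h2⟩ := exists_functional_ne_zero (k := k) hab hne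
  have := hP f a b w w'
  rw [pf, hw, hw'] at this
  simp [h1, h2] at this

/-- The Pfaffian gives `f (ab) f (cw) = f (ac) f (bw)` for all `f`. A functional vanishing on `ab`
but on neither `ac` nor `bw` shows that `bw` is a multiple of `ab`; symmetrically for `c`, and one
more functional equates the scalars. -/
theorem PfZero.exists_smul (hP : PfZero μ) {a b c w : Fin n → k}
    (hli : LinearIndependent k ![μ a b, μ a c]) (hw : μ a w = 0) :
    ∃ l : k, μ b w = l • μ a b ∧ μ c w = l • μ a c := by
  rw [linearIndependent_two_iff] at hli
  have hpf : ∀ f : (Fin n → k) →ₗ[k] k, f (μ a b) * f (μ c w) = f (μ a c) * f (μ b w) := by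
    intro f
    have := hP f a b c w
    rw [pf, hw, map_zero, zero_mul, add_zero] at this
    exact sub_eq_zero.1 this
  have h1 : ∃ l : k, μ b w = l • μ a b := by
    by_contra hall
    push Not at hall
    obtain ⟨f, f0, f1, f2⟩ := exists_functional_ker (q := μ a c) hall (fun l hl => by
      have := (hli l (-1) (by rw [hl]; module)).2
      simp at this)
    have := hpf f
    rw [f0, zero_mul] at this
    exact mul_ne_zero f2 f1 this.symm
  have h2 : ∃ l : k, μ c w = l • μ a c := by
    by_contra hall
    push Not at hall
    obtain ⟨f, f0, f1, f2⟩ := exists_functional_ker (q := μ a b) hall (fun l hl => by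
      have := (hli (-1) l (by rw [hl]; module)).1
      simp at this)
    have := hpf f
    rw [f0, zero_mul] at this
    exact mul_ne_zero f2 f1 this
  obtain ⟨l, hl⟩ := h1
  obtain ⟨l', hl'⟩ := h2
  have hb : μ a b ≠ 0 := fun h0 => by simpa using (hli 1 0 (by rw [h0]; module)).1
  have hc : μ a c ≠ 0 := fun h0 => by simpa using (hli 0 1 (by rw [h0]; module)).2
  obtain ⟨f, f1, f2⟩ := exists_functional_ne_zero (k := k) hb hc
  have := hpf f
  rw [hl, hl', map_smul, map_smul, smul_eq_mul, smul_eq_mul] at this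
  have hll : l' = l := by
    have h3 : (f (μ a b) * f (μ a c)) * l' = (f (μ a b) * f (μ a c)) * l := by
      linear_combination this
    exact mul_left_cancel₀ (mul_ne_zero f1 f2) h3
  exact ⟨l, hl, by rw [hl', hll]⟩

/-- Vanishing Pfaffians make every element of the kernel of `L_a` annihilating up to a multiple of
`a`, so `a, b, c, d` span modulo the annihilator. `TriangleDep` expresses `bc, bd, cd` through the
products with `a`, and the Pfaffian on `a, b, c, d` relates the coefficients so that shifting `b, c,
d` by multiples of `a` kills all three products at once. -/
theorem T222_mem_orbit_of_config (hμ : Alternating μ) (hE : Engel μ) (hT : TwoEngel μ)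
    (hP : PfZero μ) (hD : TriangleDep μ) (hR : DerivedRankLE 3 μ) {a b c d : Fin n → k}
    (h : LinearIndependent k ![a, b, c, d, μ a b, μ a c, μ a d]) : T222 k n ∈ orbit μ := by
  have hli := linearIndependent_triple_of_T222 h
  have hn := le_of_linearIndependent h
  have h3 := linearIndependent_three_iff.1 hli
  have hbc := linearIndependent_of_three_left hli
  have hcd : LinearIndependent k ![μ a c, μ a d] := by
    rw [linearIndependent_two_iff]
    intro s t hst
    have := h3 0 s t (by rw [← hst]; module)
    exact this.2
  have hbd : LinearIndependent k ![μ a b, μ a d] := by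
    rw [linearIndependent_two_iff]
    intro s t hst
    have := h3 s 0 t (by rw [← hst]; module)
    exact ⟨this.1, this.2.2⟩
  have hb0 : μ a b ≠ 0 := fun h0 => by simpa using (h3 1 0 0 (by rw [h0]; module)).1
  have hc0 : μ a c ≠ 0 := fun h0 => by simpa using (h3 0 1 0 (by rw [h0]; module)).2.1
  have hK : ∀ x, ∃ β γ δ : k, μ a (x - (β • b + γ • c + δ • d)) = 0 := by
    intro x
    obtain ⟨p, q, r, hx⟩ := hR.exists_eq_triple hli a x
    refine ⟨p, q, r, ?_⟩
    rw [map_sub, hx, map_add, map_add, map_smul, map_smul, map_smul, sub_self]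
  have hann : ∀ w, μ a w = 0 → ∃ l : k, μ (w + l • a) = 0 := by
    intro w hw
    obtain ⟨l, hb, hc⟩ := hP.exists_smul hbc hw
    obtain ⟨l', hc', hd⟩ := hP.exists_smul hcd hw
    have hl : l' = l := smul_left_injective k hc0 (hc'.symm.trans hc)
    rw [hl] at hd
    have hw2 : μ a (w + l • a) = 0 := by rw [map_add, map_smul, hμ a, hw, smul_zero, add_zero]
    refine ⟨l, LinearMap.ext fun y => ?_⟩
    obtain ⟨β, γ, δ, hy⟩ := hK y
    have e : y = (β • b + γ • c + δ • d) + (y - (β • b + γ • c + δ • d)) := by abel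
    rw [e, map_add, hP.mul_eq_zero hb0 hw2 hy, hμ.swap]
    simp only [map_add, map_smul, LinearMap.add_apply, LinearMap.smul_apply, hb, hc, hd,
      hμ.swap b a, hμ.swap c a, hμ.swap d a, LinearMap.zero_apply]
    module
  -- Evaluating the annihilating element `a y + l a` at `y` leaves `l (a y) = 0`, because `(a y) y =
  -- 0` by the 2-Engel identity.
  have hann2 : ∀ y, μ a y ≠ 0 → μ (μ a y) = 0 := by
    intro y hy0
    obtain ⟨l, hl⟩ := hann (μ a y) (hT a y)
    have := LinearMap.congr_fun hl y
    rw [map_add, map_smul, LinearMap.add_apply, LinearMap.smul_apply, hμ.swap (μ a y), hμ.swap a y,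
      map_neg, hT y a, neg_zero, neg_zero, zero_add, LinearMap.zero_apply, smul_neg,
      neg_eq_zero, smul_eq_zero, hμ.swap y a, neg_eq_zero] at this
    rw [this.resolve_right hy0, zero_smul, add_zero] at hl
    exact hl
  rw [triangleDep_iff] at hD
  obtain ⟨p1, q1, e1⟩ := exists_eq_of_dependent_three hbc (hD a b c)
  obtain ⟨p2, q2, e2⟩ := exists_eq_of_dependent_three hbd (hD a b d)
  obtain ⟨p3, q3, e3⟩ := exists_eq_of_dependent_three hcd (hD a c d)
  have hpf : ∀ fb fc fd : k, fb * (p3 * fc + q3 * fd) - fc * (p2 * fb + q2 * fd) +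
      fd * (p1 * fb + q1 * fc) = 0 := by
    intro fb fc fd
    obtain ⟨f, hf⟩ := exists_functional_eq hli ![fb, fc, fd]
    have f1 : f (μ a b) = fb := hf 0
    have f2 : f (μ a c) = fc := hf 1
    have f3 : f (μ a d) = fd := hf 2
    have := hP f a b c d
    simpa only [pf, e1, e2, e3, map_add, map_smul, f1, f2, f3, smul_eq_mul] using this
  have r1 : p3 = p2 := by linear_combination hpf 1 1 0
  have r2 : q3 = -p1 := by linear_combination hpf 1 0 1
  have r3 : q2 = q1 := by linear_combination - hpf 0 1 1
  have eb : ∀ (y : Fin n → k) (t : k), μ a (y - t • a) = μ a y := fun y t => by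
    rw [map_sub, map_smul, hμ a, smul_zero, sub_zero]
  have hd0 : μ a d ≠ 0 := fun h0 => by simpa using (h3 0 0 1 (by rw [h0]; module)).2.2
  refine T222_mem_orbit hμ hn (a := a) (b := b - q1 • a) (c := c - (-p1) • a) (d := d - (-p2) • a)
    (hE.linearIndependent_T222 hμ hT (by rwa [eb, eb, eb])) ?_ ?_ ?_ (by rw [eb, hann2 b hb0])
    (by rw [eb, hann2 c hc0]) (by rw [eb, hann2 d hd0]) fun x => ?_
  · simp only [map_sub, map_smul, LinearMap.sub_apply, LinearMap.smul_apply, hμ a, e1, hμ.swap b a]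
    module
  · simp only [map_sub, map_smul, LinearMap.sub_apply, LinearMap.smul_apply, hμ a, e2, hμ.swap b a,
      r3]
    module
  · simp only [map_sub, map_smul, LinearMap.sub_apply, LinearMap.smul_apply, hμ a, e3, hμ.swap c a,
      r1, r2]
    module
  · obtain ⟨β, γ, δ, hx⟩ := hK x
    obtain ⟨l, hl⟩ := hann _ hx
    refine ⟨-l + β * q1 + γ * (-p1) + δ * (-p2), β, γ, δ, ?_⟩
    rw [← hl]
    congr 1
    module

/-- The argument for `T222` with `ab` in the role of a third vector; where that one uses the 2-Engel
identity, nilpotency of left multiplications takes over. -/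
theorem T3_mem_orbit_of_config (hμ : Alternating μ) (hE : Engel μ) (hP : PfZero μ)
    (hD : TriangleDep μ) (hR : DerivedRankLE 2 μ) {a b : Fin n → k}
    (h : LinearIndependent k ![a, b, μ a b, μ a (μ a b)]) (hab : μ a (μ a (μ a b)) = 0) :
    T3 k n ∈ orbit μ := by
  have hn := le_of_linearIndependent h
  have hli := linearIndependent_pair_of_T3 h
  have h2 := linearIndependent_two_iff.1 hli
  have hb0 : μ a b ≠ 0 := fun h0 => by simpa using (h2 1 0 (by rw [h0]; module)).1
  have hc0 : μ a (μ a b) ≠ 0 := fun h0 => by simpa using (h2 0 1 (by rw [h0]; module)).2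
  have hK : ∀ x, ∃ β γ : k, μ a (x - (β • b + γ • μ a b)) = 0 := by
    intro x
    obtain ⟨p, q, hx⟩ := hR.exists_eq_pair hli a x
    refine ⟨p, q, ?_⟩
    rw [map_sub, hx, map_add, map_smul, map_smul, sub_self]
  have hann : ∀ w, μ a w = 0 → ∃ l : k, μ (w + l • a) = 0 := by
    intro w hw
    obtain ⟨l, hb, hc⟩ := hP.exists_smul hli hw
    have hw2 : μ a (w + l • a) = 0 := by rw [map_add, map_smul, hμ a, hw, smul_zero, add_zero]
    refine ⟨l, LinearMap.ext fun y => ?_⟩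
    obtain ⟨β, γ, hy⟩ := hK y
    have e : y = (β • b + γ • μ a b) + (y - (β • b + γ • μ a b)) := by abel
    rw [e, map_add, hP.mul_eq_zero hb0 hw2 hy, hμ.swap]
    simp only [map_add, map_smul, LinearMap.add_apply, LinearMap.smul_apply, hb, hc,
      hμ.swap b a, hμ.swap (μ a b) a, LinearMap.zero_apply]
    module
  have hann2 : μ (μ a (μ a b)) = 0 := by
    obtain ⟨l, hl⟩ := hann _ hab
    have := LinearMap.congr_fun hl (μ a b)
    rw [map_add, map_smul, LinearMap.add_apply, LinearMap.smul_apply, hμ.swap (μ a (μ a b)),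
      LinearMap.zero_apply, neg_add_eq_zero] at this
    rw [hE.eq_zero_of_eigen this hc0, zero_smul, add_zero] at hl
    exact hl
  rw [triangleDep_iff] at hD
  obtain ⟨p, q, e⟩ := exists_eq_of_dependent_three hli (hD a b (μ a b))
  have hbz : μ b (μ a (μ a b)) = 0 := by rw [hμ.swap, hann2, LinearMap.zero_apply, neg_zero]
  -- Since `a (ab)` annihilates, `b (ab) = p ab + q a (ab)` is an eigenvector of `L_b` with
  -- eigenvalue `p` unless it is zero.
  have hp : p = 0 := by
    by_contra hp
    refine hp (hE.eq_zero_of_eigen (x := b) (y := p • μ a b + q • μ a (μ a b)) (c := p) ?_ ?_)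
    · rw [map_add, map_smul, map_smul, hbz, smul_zero, add_zero, e]
    · intro h0
      exact hp (h2 _ _ h0).1
  rw [hp, zero_smul, zero_add] at e
  have eb : μ a (b - q • a) = μ a b := by rw [map_sub, map_smul, hμ a, smul_zero, sub_zero]
  refine T3_mem_orbit hμ hn (a := a) (b := b - q • a) ?_ ?_ (by rw [eb, hann2]) fun x => ?_
  · rw [eb]
    rw [Fintype.linearIndependent_iff] at h ⊢
    intro g hg
    have := h ![g 0 - q * g 1, g 1, g 2, g 3] (by
      rw [← hg, Fin.sum_univ_four, Fin.sum_univ_four]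
      simp only [Matrix.cons_val]
      module)
    have g1 : g 1 = 0 := this 1
    have g0 : g 0 - q * g 1 = 0 := this 0
    rw [g1, mul_zero, sub_zero] at g0
    intro i
    fin_cases i
    exacts [g0, g1, this 2, this 3]
  · rw [eb, map_sub, map_smul, LinearMap.sub_apply, LinearMap.smul_apply, e, sub_self]
  · obtain ⟨β, γ, hx⟩ := hK x
    obtain ⟨l, hl⟩ := hann _ hx
    refine ⟨-l + β * q, β, γ, ?_⟩
    rw [← hl, eb]
    congr 1
    module

end Recognition
-- Dimension four
section DimensionFour

variable {k : Type*} [Field k] {n : ℕ} {μ : AlgStr k n}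

theorem exists_pow_ne_zero {V : Type*} [AddCommGroup V] [Module k V] {N : Module.End k V}
    (hN : IsNilpotent N) {j : ℕ} {y : V} (h : (N ^ j) y ≠ 0) :
    ∃ y, (N ^ j) y ≠ 0 ∧ (N ^ (j + 1)) y = 0 := by
  classical
  have hex : ∃ m, (N ^ (j + m)) y = 0 := by
    obtain ⟨m, hm⟩ := hN
    exact ⟨m, by rw [pow_add, hm, mul_zero, LinearMap.zero_apply]⟩
  have hsp := Nat.find_spec hex
  have hpos : Nat.find hex ≠ 0 := by
    intro h0
    rw [h0] at hsp
    exact h hsp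
  obtain ⟨m, hm⟩ := Nat.exists_eq_succ_of_ne_zero hpos
  have hmin := Nat.find_min hex (m := m) (by omega)
  rw [hm, Nat.succ_eq_add_one, add_comm m 1, ← add_assoc, pow_add, Module.End.mul_apply] at hsp
  rw [pow_add, Module.End.mul_apply] at hmin
  exact ⟨(N ^ m) y, hmin, hsp⟩

/-- Otherwise `y`, `L_x y`, `L_x² y`, `L_x³ y` form a basis for a suitable `y`. Since `L_x x = 0`,
expanding `x` in it shows that `x` is a multiple of `L_x³ y`, which the Engel condition forbids. -/
theorem Engel.cube_eq_zero (hn : n = 4) (hμ : Alternating μ) (hE : Engel μ)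
    (x y : Fin n → k) : μ x (μ x (μ x y)) = 0 := by
  by_contra hne
  obtain ⟨y, h3, h4⟩ := exists_pow_ne_zero (hE x) (j := 3) (y := y)
    (by simpa [pow_succ', Module.End.mul_apply] using hne)
  simp only [pow_succ', pow_zero, mul_one, Module.End.mul_apply] at h3 h4
  have coeffs : ∀ g0 g1 g2 : k, g0 • μ x y + g1 • μ x (μ x y) + g2 • μ x (μ x (μ x y)) = 0 →
      g0 = 0 ∧ g1 = 0 ∧ g2 = 0 := by
    intro g0 g1 g2 hg
    have e1 := congrArg (μ x) hg
    simp only [map_add, map_smul, h4, smul_zero, add_zero, map_zero] at e1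
    have e2 := congrArg (μ x) e1
    simp only [map_add, map_smul, h4, smul_zero, add_zero, map_zero] at e2
    have f0 : g0 = 0 := (smul_eq_zero.1 e2).resolve_right h3
    rw [f0, zero_smul, zero_add] at e1
    have f1 : g1 = 0 := (smul_eq_zero.1 e1).resolve_right h3
    rw [f0, f1, zero_smul, zero_smul, zero_add, zero_add] at hg
    exact ⟨f0, f1, (smul_eq_zero.1 hg).resolve_right h3⟩
  have hli : LinearIndependent k ![y, μ x y, μ x (μ x y), μ x (μ x (μ x y))] := by
    rw [Fintype.linearIndependent_iff]
    intro g hg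
    rw [Fin.sum_univ_four] at hg
    simp only [Matrix.cons_val] at hg
    have e1 := congrArg (μ x) hg
    simp only [map_add, map_smul, h4, smul_zero, add_zero, map_zero] at e1
    obtain ⟨f0, f1, f2⟩ := coeffs _ _ _ e1
    rw [f0, f1, f2] at hg
    have f3 : g 3 = 0 := (smul_eq_zero.1 (by rw [← hg]; module)).resolve_right h3
    intro i
    fin_cases i <;> assumption
  have hx : x ∈ Submodule.span k (Set.range ![y, μ x y, μ x (μ x y), μ x (μ x (μ x y))]) := by
    rw [hli.span_eq_top_of_card_eq_finrank (by simp [hn])]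
    trivial
  obtain ⟨g, hg⟩ := (Submodule.mem_span_range_iff_exists_fun k).1 hx
  rw [Fin.sum_univ_four] at hg
  simp only [Matrix.cons_val] at hg
  have e1 := congrArg (μ x) hg
  simp only [map_add, map_smul, h4, smul_zero, add_zero, hμ x] at e1
  obtain ⟨f0, f1, f2⟩ := coeffs _ _ _ e1
  have hx0 : x ≠ 0 := by
    rintro rfl
    simp at h3
  rw [f0, f1, f2] at hg
  have := hE.coeff_eq_zero hμ hx0 (α := -1) (u := g 3 • μ x (μ x y)) (by
    rw [map_smul]
    nth_rewrite 1 [← hg]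
    module)
  simp at this

/-- The terms of degree one and two in `t` of the identity at `a + t v` are separated by taking `t =
1` and some `t` outside `{0, 1}`. -/
theorem cube_linearization [Infinite k] (hc : ∀ x y, μ x (μ x (μ x y)) = 0)
    (a v y : Fin n → k) : μ a (μ a (μ v y)) + μ a (μ v (μ a y)) + μ v (μ a (μ a y)) = 0 := by
  set X := μ a (μ a (μ v y)) + μ a (μ v (μ a y)) + μ v (μ a (μ a y)) with hX
  set Y := μ a (μ v (μ v y)) + μ v (μ a (μ v y)) + μ v (μ v (μ a y)) with hY
  have key : ∀ t : k, t • X + (t * t) • Y = 0 := by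
    intro t
    have h1 := hc (a + t • v) y
    simp only [map_add, map_smul, LinearMap.add_apply, LinearMap.smul_apply, hc] at h1
    rw [← h1, hX, hY]
    module
  classical
  obtain ⟨s, hs⟩ := Infinite.exists_notMem_finset ({0, 1} : Finset k)
  simp only [Finset.mem_insert, Finset.mem_singleton, not_or] at hs
  have h1 := key 1
  have h2 := key s
  have h3 : (s * s - s) • Y = 0 := by
    have : (s * s - s) • Y = (s • X + (s * s) • Y) - s • ((1 : k) • X + (1 * 1 : k) • Y) := by
      module
    rw [this, h1, h2, smul_zero, sub_zero]
  have hss : s * s - s ≠ 0 := by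
    have : s * s - s = s * (s - 1) := by ring
    rw [this]
    exact mul_ne_zero hs.1 (sub_ne_zero.2 hs.2)
  have hY0 := (smul_eq_zero.1 h3).resolve_left hss
  rw [hY0, one_smul, smul_zero, add_zero] at h1
  exact h1

/-- The family is a basis, and the unknown products follow from `b (ab) = p a + q b + r ab + s a
(ab)`. The linearised identity turns `q` and then `-r` into eigenvalues of left multiplications on
`a (ab)`; `L_b³ a = 0` gives `p = 0`; the shift `b - s a` removes `s`. -/
theorem T3_mem_orbit_of_dim_four [Infinite k] (hn : n = 4) (hμ : Alternating μ)
    (hE : Engel μ) {a b : Fin n → k} (h : LinearIndependent k ![a, b, μ a b, μ a (μ a b)]) :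
    T3 k n ∈ orbit μ := by
  have hc := hE.cube_eq_zero hn hμ
  have hlin := cube_linearization hc
  have hspan : ∀ x, ∃ p q r s : k, x = p • a + q • b + r • μ a b + s • μ a (μ a b) := by
    intro x
    have hx : x ∈ Submodule.span k (Set.range ![a, b, μ a b, μ a (μ a b)]) := by
      rw [h.span_eq_top_of_card_eq_finrank (by simp [hn])]
      trivial
    obtain ⟨g, hg⟩ := (Submodule.mem_span_range_iff_exists_fun k).1 hx
    rw [Fin.sum_univ_four] at hg
    exact ⟨_, _, _, _, hg.symm⟩
  have hli := linearIndependent_pair_of_T3 h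
  have h2 := linearIndependent_two_iff.1 hli
  have hc0 : μ a (μ a b) ≠ 0 := fun h0 =>
    one_ne_zero (h2 0 1 (by rw [h0, zero_smul, smul_zero, add_zero])).2
  have hb0 : μ a b ≠ 0 := fun h0 => hc0 (by rw [h0, map_zero])
  obtain ⟨p, q, r, s, e⟩ := hspan (μ b (μ a b))
  have ae : μ a (μ b (μ a b)) = q • μ a b + r • μ a (μ a b) := by
    rw [e]
    simp only [map_add, map_smul, hμ a, hc a, smul_zero, zero_add, add_zero]
  have e1 : μ b (μ a (μ a b)) = - (q • μ a b + r • μ a (μ a b)) := by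
    have := hlin a b b
    rw [hμ b, map_zero, map_zero, zero_add, ae] at this
    exact eq_neg_of_add_eq_zero_right this
  have e2 : μ (μ a b) (μ a (μ a b)) = q • μ a (μ a b) := by
    have := hlin a (μ a b) b
    rw [hμ (μ a b), map_zero, add_zero, hμ.swap (μ a b) b, map_neg, map_neg, ae, map_add, map_smul,
      map_smul, hc a, smul_zero, add_zero, neg_add_eq_zero] at this
    exact this.symm
  have hq : q = 0 := hE.eq_zero_of_eigen e2 hc0
  rw [hq, zero_smul, zero_add, ← neg_smul] at e1
  rw [hq, zero_smul] at e2
  have hr : r = 0 := by simpa using hE.eq_zero_of_eigen e1 hc0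
  rw [hr, neg_zero, zero_smul] at e1
  rw [hq, hr, zero_smul, zero_smul, add_zero, add_zero] at e
  have hp : p = 0 := by
    have := hc b a
    rw [hμ.swap b a, map_neg, map_neg, e, map_add, map_smul, map_smul, e1, smul_zero, add_zero,
      hμ.swap b a, neg_eq_zero, smul_eq_zero, neg_eq_zero] at this
    exact this.resolve_right hb0
  rw [hp, zero_smul, zero_add] at e
  have eb : μ a (b - s • a) = μ a b := by rw [map_sub, map_smul, hμ a, smul_zero, sub_zero]
  have hann : μ (μ a (μ a b)) = 0 := by
    refine LinearMap.ext fun x => ?_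
    obtain ⟨p, q, r, s, rfl⟩ := hspan x
    rw [hμ.swap]
    simp [e1, e2, hc a, hμ (μ a (μ a b))]
  refine T3_mem_orbit hμ hn.ge (a := a) (b := b - s • a) ?_ ?_ (by rw [eb, hann]) fun x => ?_
  · rw [eb]
    rw [Fintype.linearIndependent_iff] at h ⊢
    intro g hg
    have := h ![g 0 - s * g 1, g 1, g 2, g 3] (by
      rw [← hg, Fin.sum_univ_four, Fin.sum_univ_four]
      simp only [Matrix.cons_val]
      module)
    have g1 : g 1 = 0 := this 1
    have g0 : g 0 - s * g 1 = 0 := this 0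
    rw [g1, mul_zero, sub_zero] at g0
    intro i
    fin_cases i
    exacts [g0, g1, this 2, this 3]
  · rw [eb, map_sub, map_smul, LinearMap.sub_apply, LinearMap.smul_apply, e, sub_self]
  · obtain ⟨p', q', r', s', rfl⟩ := hspan x
    refine ⟨p' + q' * s, q', r', ?_⟩
    have : p' • a + q' • b + r' • μ a b + s' • μ a (μ a b) -
        ((p' + q' * s) • a + q' • (b - s • a) + r' • μ a (b - s • a)) = s' • μ a (μ a b) := by
      rw [eb]
      module
    rw [this, map_smul, hann, smul_zero]

end DimensionFour

/-! ### The closed conditions satisfied by the models -/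

section Models

variable {k : Type*} [Field k] {n : ℕ}

theorem derivedRankLE_of_span {μ : AlgStr k n} {r : ℕ} (W : Fin r → Fin n → k)
    (h : ∀ x y, ∃ c : Fin r → k, μ x y = ∑ i, c i • W i) : DerivedRankLE r μ := by
  intro x y hli
  have h1 : Submodule.span k (Set.range fun i => μ (x i) (y i)) ≤
      Submodule.span k (Set.range W) := by
    rw [Submodule.span_le]
    rintro _ ⟨i, rfl⟩
    obtain ⟨c, hc⟩ := h (x i) (y i)
    exact (Submodule.mem_span_range_iff_exists_fun k).2 ⟨c, hc.symm⟩
  have h2 := Submodule.finrank_mono h1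
  rw [finrank_span_eq_card hli, Fintype.card_fin] at h2
  have h3 := finrank_range_le_card (R := k) W
  rw [Set.finrank, Fintype.card_fin] at h3
  omega

/-- The coordinate as a linear functional. -/
def coordLin (k : Type*) [Field k] (n i : ℕ) : (Fin n → k) →ₗ[k] k where
  toFun := coord i
  map_add' := coord_add i
  map_smul' := coord_smul i

/-- Left multiplication factors through the first `r` coordinates. -/
theorem annCorankLE_of_coord {μ : AlgStr k n} {r : ℕ}
    (h : ∀ x, (∀ i, 1 ≤ i → i ≤ r → coord i x = 0) → μ x = 0) : AnnCorankLE r μ := by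
  intro x hli
  let π : (Fin n → k) →ₗ[k] (Fin r → k) := LinearMap.pi fun i => coordLin k n (i.val + 1)
  have hπ : ∀ y, π y = 0 → μ y = 0 := by
    intro y hy
    refine h y fun i h1 hr => ?_
    have := congrFun hy ⟨i - 1, by omega⟩
    obtain ⟨i, rfl⟩ := Nat.exists_eq_add_of_le' h1
    exact this
  have : LinearIndependent k fun i => π (x i) := by
    rw [Fintype.linearIndependent_iff] at hli ⊢
    intro c hc
    refine hli c ?_
    have := hπ (∑ i, c i • x i) (by simpa using hc)
    simpa using this
  have := this.fintype_card_le_finrank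
  simp at this

theorem eps_eq_zero {i j l : ℕ} {x : Fin n → k} (hi : coord i x = 0) (hj : coord j x = 0) :
    eps k n i j l x = 0 := by
  refine LinearMap.ext fun y => ?_
  rw [eps_apply, hi, hj]
  simp

theorem T3_apply (x y : Fin n → k) : T3 k n x y =
    (coord 1 x * coord 2 y - coord 2 x * coord 1 y) • vec k n 3 +
      (coord 1 x * coord 3 y - coord 3 x * coord 1 y) • vec k n n := by
  simp only [T3, LinearMap.add_apply, eps_apply]

theorem T22_apply (x y : Fin n → k) : T22 k n x y =
    (coord 1 x * coord 2 y - coord 2 x * coord 1 y) • vec k n (n - 1) +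
      (coord 1 x * coord 3 y - coord 3 x * coord 1 y) • vec k n n := by
  simp only [T22, LinearMap.add_apply, eps_apply]

theorem T22eps23_apply (x y : Fin n → k) : T22eps23 k n x y =
    (coord 1 x * coord 2 y - coord 2 x * coord 1 y) • vec k n (n - 1) +
      (coord 1 x * coord 3 y - coord 3 x * coord 1 y) • vec k n n +
      (coord 2 x * coord 3 y - coord 3 x * coord 2 y) • vec k n (n - 2) := by
  simp only [T22eps23, LinearMap.add_apply, eps_apply, T22_apply]

theorem T22eps24_apply (x y : Fin n → k) : T22eps24 k n x y =
    (coord 1 x * coord 2 y - coord 2 x * coord 1 y) • vec k n (n - 1) +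
      (coord 1 x * coord 3 y - coord 3 x * coord 1 y) • vec k n n +
      (coord 2 x * coord 4 y - coord 4 x * coord 2 y) • vec k n n := by
  simp only [T22eps24, LinearMap.add_apply, eps_apply, T22_apply]

theorem T222_apply (x y : Fin n → k) : T222 k n x y =
    (coord 1 x * coord 2 y - coord 2 x * coord 1 y) • vec k n (n - 2) +
      (coord 1 x * coord 3 y - coord 3 x * coord 1 y) • vec k n (n - 1) +
      (coord 1 x * coord 4 y - coord 4 x * coord 1 y) • vec k n n := by
  simp only [T222, LinearMap.add_apply, eps_apply]

theorem annCorankLE_T22 : AnnCorankLE 3 (T22 k n) := by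
  refine annCorankLE_of_coord fun x hx => ?_
  rw [T22, LinearMap.add_apply, eps_eq_zero (hx 1 (by norm_num) (by norm_num)) (hx 2 (by norm_num) (by norm_num)),
    eps_eq_zero (hx 1 (by norm_num) (by norm_num)) (hx 3 (by norm_num) (by norm_num)), add_zero]

theorem annCorankLE_T22eps23 : AnnCorankLE 3 (T22eps23 k n) := by
  refine annCorankLE_of_coord fun x hx => ?_
  have h1 := hx 1 (by norm_num) (by norm_num)
  have h2 := hx 2 (by norm_num) (by norm_num)
  have h3 := hx 3 (by norm_num) (by norm_num)
  rw [T22eps23, T22, LinearMap.add_apply, LinearMap.add_apply, eps_eq_zero h1 h2,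
    eps_eq_zero h1 h3, eps_eq_zero h2 h3, add_zero, add_zero]

theorem annCorankLE_T22eps24 : AnnCorankLE 4 (T22eps24 k n) := by
  refine annCorankLE_of_coord fun x hx => ?_
  have h1 := hx 1 (by norm_num) (by norm_num)
  have h2 := hx 2 (by norm_num) (by norm_num)
  have h3 := hx 3 (by norm_num) (by norm_num)
  have h4 := hx 4 (by norm_num) (by norm_num)
  rw [T22eps24, T22, LinearMap.add_apply, LinearMap.add_apply, eps_eq_zero h1 h2,
    eps_eq_zero h1 h3, eps_eq_zero h2 h4, add_zero, add_zero]

theorem annCorankLE_eta (m : ℕ) : AnnCorankLE (2 * m) (eta k n m) := by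
  refine annCorankLE_of_coord fun x hx => ?_
  rw [eta, LinearMap.sum_apply]
  refine Finset.sum_eq_zero fun i hi => ?_
  rw [Finset.mem_Icc] at hi
  exact eps_eq_zero (hx _ (by omega) (by omega)) (hx _ (by omega) (by omega))

theorem derivedRankLE_eta (m : ℕ) : DerivedRankLE 1 (eta k n m) := by
  refine derivedRankLE_of_span (fun _ => vec k n (2 * m + 1)) fun x y => ?_
  refine ⟨fun _ => ∑ i ∈ Finset.Icc 1 m, (coord (2 * i - 1) x * coord (2 * i) y -
    coord (2 * i) x * coord (2 * i - 1) y), ?_⟩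
  rw [eta, LinearMap.sum_apply, LinearMap.sum_apply, Fin.sum_univ_one, Finset.sum_smul]
  simp only [eps_apply]

theorem derivedRankLE_T3 : DerivedRankLE 2 (T3 k n) :=
  derivedRankLE_of_span ![vec k n 3, vec k n n] fun x y =>
    ⟨![_, _], by rw [T3_apply, Fin.sum_univ_two]; rfl⟩

theorem derivedRankLE_T22 : DerivedRankLE 2 (T22 k n) :=
  derivedRankLE_of_span ![vec k n (n - 1), vec k n n] fun x y =>
    ⟨![_, _], by rw [T22_apply, Fin.sum_univ_two]; rfl⟩

theorem derivedRankLE_T22eps24 : DerivedRankLE 2 (T22eps24 k n) :=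
  derivedRankLE_of_span ![vec k n (n - 1), vec k n n] fun x y =>
    ⟨![_, _], by rw [T22eps24_apply, Fin.sum_univ_two, add_assoc, ← add_smul]; rfl⟩

theorem derivedRankLE_T222 : DerivedRankLE 3 (T222 k n) :=
  derivedRankLE_of_span ![vec k n (n - 2), vec k n (n - 1), vec k n n] fun x y =>
    ⟨![_, _, _], by rw [T222_apply, Fin.sum_univ_three]; rfl⟩

theorem coord_vec_eq_zero {i l : ℕ} (hi : i ≠ l) : coord i (vec k n l) = 0 := by
  rw [coord]
  refine Finset.sum_eq_zero fun p _ => ?_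
  split_ifs with h
  · rw [vec, if_neg (by omega)]
  · rfl

theorem twoStep_T22 (hn : 5 ≤ n) : TwoStep (T22 k n) := by
  have h : ∀ i, i ≤ 3 → ∀ x y, coord i (T22 k n x y) = 0 := by
    intro i hi x y
    rw [T22_apply, coord_add, coord_smul, coord_smul, coord_vec_eq_zero (by omega),
      coord_vec_eq_zero (by omega)]
    simp
  intro x y z
  rw [T22_apply (T22 k n x y), h 1 (by norm_num), h 2 (by norm_num), h 3 (by norm_num)]
  simp

theorem twoStep_T22eps23 (hn : 6 ≤ n) : TwoStep (T22eps23 k n) := by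
  have h : ∀ i, i ≤ 3 → ∀ x y, coord i (T22eps23 k n x y) = 0 := by
    intro i hi x y
    rw [T22eps23_apply, coord_add, coord_add, coord_smul, coord_smul, coord_smul,
      coord_vec_eq_zero (by omega), coord_vec_eq_zero (by omega), coord_vec_eq_zero (by omega)]
    simp
  intro x y z
  rw [T22eps23_apply (T22eps23 k n x y), h 1 (by norm_num), h 2 (by norm_num), h 3 (by norm_num)]
  simp

theorem twoStep_T22eps24 (hn : 6 ≤ n) : TwoStep (T22eps24 k n) := by
  have h : ∀ i, i ≤ 4 → ∀ x y, coord i (T22eps24 k n x y) = 0 := by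
    intro i hi x y
    rw [T22eps24_apply, coord_add, coord_add, coord_smul, coord_smul, coord_smul,
      coord_vec_eq_zero (by omega), coord_vec_eq_zero (by omega)]
    simp
  intro x y z
  rw [T22eps24_apply (T22eps24 k n x y), h 1 (by norm_num), h 2 (by norm_num), h 3 (by norm_num),
    h 4 (by norm_num)]
  simp

theorem twoStep_T222 (hn : 7 ≤ n) : TwoStep (T222 k n) := by
  have h : ∀ i, i ≤ 4 → ∀ x y, coord i (T222 k n x y) = 0 := by
    intro i hi x y
    rw [T222_apply, coord_add, coord_add, coord_smul, coord_smul, coord_smul,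
      coord_vec_eq_zero (by omega), coord_vec_eq_zero (by omega), coord_vec_eq_zero (by omega)]
    simp
  intro x y z
  rw [T222_apply (T222 k n x y), h 1 (by norm_num), h 2 (by norm_num), h 3 (by norm_num),
    h 4 (by norm_num)]
  simp

/-- Each form `f (xy)` is a wedge of the first coordinate with another functional, hence of rank at
most two; the same holds for `T222`. -/
theorem pfZero_T3 : PfZero (T3 k n) := by
  intro f x y z w
  simp only [pf, T3_apply, map_add, map_smul, smul_eq_mul]
  ring

theorem pfZero_T222 : PfZero (T222 k n) := by
  intro f x y z w
  simp only [pf, T222_apply, map_add, map_smul, smul_eq_mul]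
  ring

/-- The part of `f (xy)` along `e_{n-1}` is the wedge of coordinates 1 and 2. It contributes nothing
to the Pfaffian, since it shares a factor with each term of the part along `e_n`. -/
theorem pfSquare_T22eps24 : PfSquare (T22eps24 k n) := by
  intro f g x y z w
  have key : ∃ c : k, ∀ f, pf (T22eps24 k n) f x y z w = c * f (vec k n n) ^ 2 := by
    let θ : (Fin n → k) → (Fin n → k) → k := fun x y =>
      (coord 1 x * coord 3 y - coord 3 x * coord 1 y) +
        (coord 2 x * coord 4 y - coord 4 x * coord 2 y)
    refine ⟨θ x y * θ z w - θ x z * θ y w + θ x w * θ y z, fun f => ?_⟩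
    simp only [pf, T22eps24_apply, map_add, map_smul, smul_eq_mul, θ]
    ring
  obtain ⟨c, hc⟩ := key
  rw [hc, hc, hc, LinearMap.add_apply]
  ring

/-- Structures of the form `x y = ℓ(x) N(y) - ℓ(y) N(x)`. -/
theorem triangleDep_of_wedge {μ : AlgStr k n} (l : (Fin n → k) → k) (N : (Fin n → k) → Fin n → k)
    (h : ∀ x y, μ x y = l x • N y - l y • N x) : TriangleDep μ := by
  rw [triangleDep_iff]
  intro a b c hli
  have h3 := linearIndependent_three_iff.1 hli
  -- The identity `l(c) ab - l(b) ac + l(a) bc = 0` forces all values of `l` to vanish, and then `ab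
  -- = 0`.
  have h0 := h3 (l c) (- l b) (l a) (by rw [h, h, h]; module)
  have h1 := h3 1 0 0 (by
    rw [h a b, h0.2.2, neg_eq_zero.1 h0.2.1]
    module)
  exact one_ne_zero h1.1

theorem triangleDep_T3 : TriangleDep (T3 k n) :=
  triangleDep_of_wedge (coord 1) (fun y => coord 2 y • vec k n 3 + coord 3 y • vec k n n)
    fun x y => by rw [T3_apply]; module

theorem triangleDep_T222 : TriangleDep (T222 k n) :=
  triangleDep_of_wedge (coord 1)
    (fun y => coord 2 y • vec k n (n - 2) + coord 3 y • vec k n (n - 1) + coord 4 y • vec k n n)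
    fun x y => by rw [T222_apply]; module

end Models
-- Chains of proper degenerations
section Chains

variable {k : Type*} [Field k] {n : ℕ}

theorem orbit_eq {μ χ : AlgStr k n} (h : χ ∈ orbit μ) : orbit χ = orbit μ :=
  Set.ext fun _ => ⟨orbit_trans h, orbit_trans (orbit_symm h)⟩

theorem ProperlyDegenerates.of_orbit {μ μ' χ : AlgStr k n} (h : ProperlyDegenerates μ χ)
    (hμ : μ' ∈ orbit μ) : ProperlyDegenerates μ' χ := by
  rw [ProperlyDegenerates, Degenerates, orbit_eq hμ]
  exact h

/-- There is a sequence of `m` non-trivial degenerations starting at `μ`. -/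
def HasChain : ℕ → AlgStr k n → Prop
  | 0, _ => True
  | m + 1, μ => ∃ χ, ProperlyDegenerates μ χ ∧ HasChain m χ

theorem HasChain.of_orbit {m : ℕ} {μ μ' : AlgStr k n} (h : HasChain m μ) (hμ : μ' ∈ orbit μ) :
    HasChain m μ' := by
  cases m with
  | zero => trivial
  | succ m =>
    obtain ⟨χ, h1, h2⟩ := h
    exact ⟨χ, h1.of_orbit hμ, h2⟩

theorem HasChain.of_succ {m : ℕ} {μ : AlgStr k n} (h : HasChain (m + 1) μ) : HasChain m μ := by
  induction m generalizing μ with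
  | zero => trivial
  | succ m ih =>
    obtain ⟨χ, h1, h2⟩ := h
    exact ⟨χ, h1, ih h2⟩

theorem HasChain.of_le {m m' : ℕ} {μ : AlgStr k n} (h : HasChain m μ) (hm : m' ≤ m) :
    HasChain m' μ := by
  induction m, hm using Nat.le_induction with
  | base => exact h
  | succ m _ ih => exact ih h.of_succ

theorem hasChain_iff {m : ℕ} {μ : AlgStr k n} : HasChain m μ ↔
    ∃ c : ℕ → AlgStr k n, c 0 = μ ∧ ∀ i < m, ProperlyDegenerates (c i) (c (i + 1)) := by
  induction m generalizing μ with
  | zero => exact ⟨fun _ => ⟨fun _ => μ, rfl, by simp⟩, fun _ => trivial⟩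
  | succ m ih =>
    constructor
    · rintro ⟨χ, h1, h2⟩
      obtain ⟨c, rfl, hc⟩ := ih.1 h2
      refine ⟨fun i => Nat.casesOn i μ c, rfl, fun i hi => ?_⟩
      cases i with
      | zero => exact h1
      | succ i => exact hc i (by omega)
    · rintro ⟨c, rfl, hc⟩
      exact ⟨c 1, hc 0 (by omega), ih.2 ⟨fun i => c (i + 1), rfl, fun i hi => hc _ (by omega)⟩⟩

end Chains

/-! ### From algebras to structures on `k ^ n` -/

section Representations

variable {k : Type*} [Field k] {n : ℕ} {A : Type*} [NonUnitalNonAssocRing A] [Module k A]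

theorem Represents.iff_mem_orbit {μ χ : AlgStr k n} (h : Represents μ A) :
    Represents χ A ↔ χ ∈ orbit μ := by
  obtain ⟨f, hf⟩ := h
  rw [mem_orbit_iff]
  constructor
  · rintro ⟨f', hf'⟩
    refine ⟨f.trans f'.symm, fun x y => ?_⟩
    rw [LinearEquiv.trans_apply, LinearEquiv.trans_apply, LinearEquiv.trans_apply,
      LinearEquiv.eq_symm_apply, hf', hf]
    simp
  · rintro ⟨g, hg⟩
    refine ⟨g.symm.trans f, fun x y => ?_⟩
    obtain ⟨x, rfl⟩ := g.surjective x
    obtain ⟨y, rfl⟩ := g.surjective y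
    rw [hg]
    simp [hf]

theorem Represents.alternating {μ : AlgStr k n} (h : Represents μ A)
    (hA : IsAnticommutative A) : Alternating μ := by
  obtain ⟨f, hf⟩ := h
  intro x
  rw [← f.map_eq_zero_iff, hf, hA]

theorem Represents.exists_engelOf [SMulCommClass k A A] {μ : AlgStr k n} (h : Represents μ A)
    (hA : IsEngel k A) : ∃ m, EngelOf m μ := by
  obtain ⟨f, hf⟩ := h
  obtain ⟨m, -, hm⟩ := hA
  refine ⟨m, fun x => LinearMap.ext fun y => ?_⟩
  have key : ∀ m, f ((μ x ^ m) y) = (LinearMap.mulLeft k (f x) ^ m) (f y) := by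
    intro m
    induction m with
    | zero => rfl
    | succ m ih =>
      rw [pow_succ', pow_succ', Module.End.mul_apply, Module.End.mul_apply, hf, ih,
        LinearMap.mulLeft_apply]
  have h0 : f ((μ x ^ m) y) = 0 := by
    rw [key, hm]
    rfl
  exact f.map_eq_zero_iff.1 h0

theorem exists_represents [IsScalarTower k A A] [SMulCommClass k A A] [FiniteDimensional k A]
    (hn : Module.finrank k A = n) : ∃ μ : AlgStr k n, Represents μ A := by
  let f : (Fin n → k) ≃ₗ[k] A := (Module.finBasisOfFinrankEq k A hn).equivFun.symm
  refine ⟨((LinearMap.mul k A).compl₁₂ f.toLinearMap f.toLinearMap).compr₂ f.symm.toLinearMap,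
    f, fun x y => ?_⟩
  simp

/-- Truncating a chain gives shorter ones, so a maximum is detected at the next length. -/
theorem hasLevel_iff {μ : AlgStr k (Module.finrank k A)} (h : Represents μ A) {m : ℕ} :
    HasLevel k A m ↔ HasChain m μ ∧ ¬ HasChain (m + 1) μ := by
  have hmem : ∀ j, j ∈ chainLengths k A ↔ HasChain j μ := by
    intro j
    constructor
    · rintro ⟨c, h0, hc⟩
      exact (hasChain_iff.2 ⟨c, rfl, hc⟩).of_orbit (orbit_symm (h.iff_mem_orbit.1 h0))
    · intro hj
      obtain ⟨c, rfl, hc⟩ := hasChain_iff.1 hj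
      exact ⟨c, h, hc⟩
  constructor
  · rintro ⟨h1, h2⟩
    refine ⟨(hmem m).1 h1, fun h3 => ?_⟩
    have := h2 ((hmem (m + 1)).2 h3)
    omega
  · rintro ⟨h1, h2⟩
    refine ⟨(hmem m).2 h1, fun j hj => ?_⟩
    by_contra hlt
    exact h2 (((hmem j).1 hj).of_le (by omega))

end Representations

/-! ### Proper degenerations of the low structures and of the models -/

section UpperBounds

variable {k : Type*} [Field k] {n : ℕ}

/-- Alternating structures whose left multiplications have a common vanishing power. -/
def AlternatingEngel (μ : AlgStr k n) : Prop := Alternating μ ∧ ∃ m, EngelOf m μ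

theorem AlternatingEngel.engel {μ : AlgStr k n} (h : AlternatingEngel μ) : Engel μ := by
  obtain ⟨-, m, hm⟩ := h
  exact fun x => ⟨m, hm x⟩

theorem closed_alternatingEngel : Closed (AlternatingEngel : AlgStr k n → Prop) := by
  rintro μ χ ⟨h1, m, h2⟩ hd
  exact ⟨closed_alternating μ χ h1 hd, m, closed_engelOf m μ χ h2 hd⟩

theorem eq_zero_of_degenerates_zero {χ : AlgStr k n} (h : Degenerates 0 χ) : χ = 0 := by
  refine LinearMap.ext₂ fun x y => funext fun l => ?_
  refine eq_zero_of_degenerates (apply_mem_polyFun (LinearMap.proj l) x y) ?_ h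
  intro ν hν
  obtain ⟨g, rfl⟩ := hν
  simp [act_apply]

theorem TwoStep.not_T3 {μ : AlgStr k n} (hμ : Alternating μ) (h : TwoStep μ) {a b : Fin n → k}
    (hli : LinearIndependent k ![a, b, μ a b, μ a (μ a b)]) : False :=
  hli.ne_zero 3 (h.right hμ a b a)

/-- A closed property of `X` passes to the degenerations of structures isomorphic to `X`. -/
theorem Closed.transfer {P : AlgStr k n → Prop} (h : Closed P) {X μ χ : AlgStr k n} (hX : P X)
    (hμ : X ∈ orbit μ) (hd : ProperlyDegenerates μ χ) : P χ :=
  h μ χ (h.of_orbit hX (orbit_symm hμ)) hd.1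

theorem ProperlyDegenerates.not_mem {X μ χ : AlgStr k n} (hd : ProperlyDegenerates μ χ)
    (hμ : X ∈ orbit μ) (hχ : X ∈ orbit χ) : False :=
  hd.2 (orbit_trans hμ (orbit_symm hχ))

/-- All products stay on a line, which excludes `T22` and every configuration; the annihilator of
codimension at most `2 * m` bounds the number of pairs. -/
theorem eq_zero_or_eta_of_eta {μ χ : AlgStr k n} (hμ : AlternatingEngel μ) {m : ℕ}
    (h : eta k n m ∈ orbit μ) (hd : ProperlyDegenerates μ χ) :
    χ = 0 ∨ ∃ m', 1 ≤ m' ∧ m' < m ∧ eta k n m' ∈ orbit χ := by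
  have hχ := closed_alternatingEngel μ χ hμ hd.1
  have hD := (closed_derivedRankLE 1).transfer (derivedRankLE_eta m) h hd
  have hA := (closed_annCorankLE (2 * m)).transfer (annCorankLE_eta m) h hd
  rcases Engel.classification hχ.1 hχ.engel with h0 | ⟨m', z, x, h1, hx, h2⟩ |
    ⟨-, a, b, c, hli⟩ | ⟨a, b, hli⟩ | ⟨a, b, c, d, hli⟩ | ⟨a, b, c, hli⟩ |
    ⟨a, b, c, d, hli, -, -⟩
  · exact Or.inl h0
  · refine Or.inr ⟨m', h1, lt_of_le_of_ne ?_ fun he => ?_, h2⟩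
    · have := hx.two_mul_le hχ.1 hA
      omega
    · subst he
      exact hd.not_mem h h2
  · exact (hD.not_pair _ _ _ _ (linearIndependent_pair_of_T22 hli)).elim
  · exact (hD.not_pair _ _ _ _ (linearIndependent_pair_of_T3 hli)).elim
  · exact (hD.not_pair _ _ _ _ (linearIndependent_of_three_left
      (linearIndependent_triple_of_T222 hli))).elim
  · exact (hD.not_pair _ _ _ _ (linearIndependent_of_three_left
      (linearIndependent_triple_of_T22eps23 hli))).elim
  · exact (hD.not_pair _ _ _ _ (linearIndependent_pair_of_T22eps24 hli)).elim

theorem eq_zero_or_eta_of_T22 {μ χ : AlgStr k n} (hμ : AlternatingEngel μ) (hn : 5 ≤ n)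
    (h : T22 k n ∈ orbit μ) (hd : ProperlyDegenerates μ χ) :
    χ = 0 ∨ eta k n 1 ∈ orbit χ := by
  have hχ := closed_alternatingEngel μ χ hμ hd.1
  have hS := (closed_twoStep.transfer ⟨alternating_T22, twoStep_T22 hn⟩ h hd).2
  have hD := (closed_derivedRankLE 2).transfer derivedRankLE_T22 h hd
  have hA := (closed_annCorankLE 3).transfer annCorankLE_T22 h hd
  rcases Engel.classification hχ.1 hχ.engel with h0 | ⟨m', z, x, h1, hx, h2⟩ |
    ⟨hT, -⟩ | ⟨a, b, hli⟩ | ⟨a, b, c, d, hli⟩ | ⟨a, b, c, hli⟩ |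
    ⟨a, b, c, d, hli, had, hbd⟩
  · exact Or.inl h0
  · have := hx.two_mul_le hχ.1 hA
    obtain rfl : m' = 1 := by omega
    exact Or.inr h2
  · exact (hd.not_mem h hT).elim
  · exact (hS.not_T3 hχ.1 hli).elim
  · exact (hD.not_triple _ _ _ _ _ _ (linearIndependent_triple_of_T222 hli)).elim
  · exact (hD.not_triple _ _ _ _ _ _ (linearIndependent_triple_of_T22eps23 hli)).elim
  · exact (hA _ (linearIndependent_mul_T22eps24 hχ.1 (linearIndependent_pair_of_T22eps24 hli)
      had hbd)).elim

/-- The structures of level at most two in dimension at least five. -/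
def LowModel (μ : AlgStr k n) : Prop :=
  μ = 0 ∨ eta k n 1 ∈ orbit μ ∨ eta k n 2 ∈ orbit μ ∨ (5 ≤ n ∧ T22 k n ∈ orbit μ)

theorem lowModel_of_eta {μ : AlgStr k n} {m : ℕ} (h1 : 1 ≤ m) (h2 : m ≤ 2)
    (h : eta k n m ∈ orbit μ) : LowModel μ := by
  interval_cases m
  · exact Or.inr (Or.inl h)
  · exact Or.inr (Or.inr (Or.inl h))

theorem not_hasChain_one_zero : ¬ HasChain 1 (0 : AlgStr k n) := by
  rintro ⟨χ, hd, -⟩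
  rw [eq_zero_of_degenerates_zero hd.1] at hd
  exact hd.2 (orbit_refl 0)

theorem not_hasChain_two_of_eta {μ : AlgStr k n} (hμ : AlternatingEngel μ)
    (h : μ = 0 ∨ eta k n 1 ∈ orbit μ) : ¬ HasChain 2 μ := by
  rcases h with rfl | h
  · exact fun h => not_hasChain_one_zero h.of_succ
  · rintro ⟨χ, hd, hc⟩
    rcases eq_zero_or_eta_of_eta hμ h hd with rfl | ⟨m, _, _, _⟩
    · exact not_hasChain_one_zero hc
    · omega

theorem LowModel.not_hasChain_three {μ : AlgStr k n} (hμ : AlternatingEngel μ)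
    (h : LowModel μ) : ¬ HasChain 3 μ := by
  rcases h with h | h | h | ⟨hn, h⟩
  · exact fun h' => not_hasChain_two_of_eta hμ (Or.inl h) h'.of_succ
  · exact fun h' => not_hasChain_two_of_eta hμ (Or.inr h) h'.of_succ
  · rintro ⟨χ, hd, hc⟩
    refine not_hasChain_two_of_eta (closed_alternatingEngel μ χ hμ hd.1) ?_ hc
    rcases eq_zero_or_eta_of_eta hμ h hd with h0 | ⟨m, h1, h2, h3⟩
    · exact Or.inl h0
    · obtain rfl : m = 1 := by omega
      exact Or.inr h3
  · rintro ⟨χ, hd, hc⟩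
    exact not_hasChain_two_of_eta (closed_alternatingEngel μ χ hμ hd.1)
      (eq_zero_or_eta_of_T22 hμ hn h hd) hc

/-- Vanishing Pfaffians exclude two hyperbolic pairs and `T22eps24`; two-dimensional products
exclude `T222` and `T22eps23`. -/
theorem lowModel_of_T3 {μ χ : AlgStr k n} (hμ : AlternatingEngel μ)
    (h : T3 k n ∈ orbit μ) (hd : ProperlyDegenerates μ χ) : LowModel χ := by
  have hχ := closed_alternatingEngel μ χ hμ hd.1
  have hP := closed_pfZero.transfer pfZero_T3 h hd
  have hT := closed_triangleDep.transfer triangleDep_T3 h hd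
  have hD := (closed_derivedRankLE 2).transfer derivedRankLE_T3 h hd
  rcases Engel.classification hχ.1 hχ.engel with h0 | ⟨m', z, x, h1, hx, h2⟩ |
    ⟨hT, a, b, c, hli⟩ | ⟨a, b, hli⟩ | ⟨a, b, c, d, hli⟩ | ⟨a, b, c, hli⟩ |
    ⟨a, b, c, d, hli, had, hbd⟩
  · exact Or.inl h0
  · exact lowModel_of_eta h1 ((hP.not_hyperbolicPairs hx).trans one_le_two) h2
  · exact Or.inr (Or.inr (Or.inr ⟨le_of_linearIndependent hli, hT⟩))
  · obtain ⟨b, hli, h0⟩ := hχ.engel.exists_T3_family hχ.1 (hli.ne_zero 3)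
    exact (hd.not_mem h (T3_mem_orbit_of_config hχ.1 hχ.engel hP hT hD hli h0)).elim
  · exact (hD.not_triple _ _ _ _ _ _ (linearIndependent_triple_of_T222 hli)).elim
  · exact (hD.not_triple _ _ _ _ _ _ (linearIndependent_triple_of_T22eps23 hli)).elim
  · exact (hP.not_T22eps24 (linearIndependent_pair_of_T22eps24 hli) had hbd).elim

theorem lowModel_of_T222 {μ χ : AlgStr k n} (hμ : AlternatingEngel μ) (hn : 7 ≤ n)
    (h : T222 k n ∈ orbit μ) (hd : ProperlyDegenerates μ χ) : LowModel χ := by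
  have hχ := closed_alternatingEngel μ χ hμ hd.1
  have hS := (closed_twoStep.transfer ⟨alternating_T222, twoStep_T222 hn⟩ h hd).2
  have hP := closed_pfZero.transfer pfZero_T222 h hd
  have hT := closed_triangleDep.transfer triangleDep_T222 h hd
  have hD := (closed_derivedRankLE 3).transfer derivedRankLE_T222 h hd
  rcases Engel.classification hχ.1 hχ.engel with h0 | ⟨m', z, x, h1, hx, h2⟩ |
    ⟨hT, a, b, c, hli⟩ | ⟨a, b, hli⟩ | ⟨a, b, c, d, hli⟩ | ⟨a, b, c, hli⟩ |
    ⟨a, b, c, d, hli, had, hbd⟩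
  · exact Or.inl h0
  · exact lowModel_of_eta h1 ((hP.not_hyperbolicPairs hx).trans one_le_two) h2
  · exact Or.inr (Or.inr (Or.inr ⟨le_of_linearIndependent hli, hT⟩))
  · exact (hS.not_T3 hχ.1 hli).elim
  · exact (hd.not_mem h (T222_mem_orbit_of_config hχ.1 hχ.engel
      (fun a b => hS.right hχ.1 a b a) hP hT hD hli)).elim
  · exact (triangleDep_iff.1 hT _ _ _ (linearIndependent_triple_of_T22eps23 hli)).elim
  · exact (hP.not_T22eps24 (linearIndependent_pair_of_T22eps24 hli) had hbd).elim

/-- The bound three on the codimension of the annihilator decides: two hyperbolic pairs, `T222` and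
`T22eps24` each give four independent left multiplications. -/
theorem lowModel_of_T22eps23 {μ χ : AlgStr k n} (hμ : AlternatingEngel μ) (hn : 6 ≤ n)
    (h : T22eps23 k n ∈ orbit μ) (hd : ProperlyDegenerates μ χ) : LowModel χ := by
  have hχ := closed_alternatingEngel μ χ hμ hd.1
  have hS := (closed_twoStep.transfer ⟨alternating_T22eps23, twoStep_T22eps23 hn⟩ h hd).2
  have hA := (closed_annCorankLE 3).transfer annCorankLE_T22eps23 h hd
  rcases Engel.classification hχ.1 hχ.engel with h0 | ⟨m', z, x, h1, hx, h2⟩ |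
    ⟨hT, a, b, c, hli⟩ | ⟨a, b, hli⟩ | ⟨a, b, c, d, hli⟩ | ⟨a, b, c, hli⟩ |
    ⟨a, b, c, d, hli, had, hbd⟩
  · exact Or.inl h0
  · have := hx.two_mul_le hχ.1 hA
    exact lowModel_of_eta h1 (by omega) h2
  · exact Or.inr (Or.inr (Or.inr ⟨le_of_linearIndependent hli, hT⟩))
  · exact (hS.not_T3 hχ.1 hli).elim
  · exact (hA _ (linearIndependent_mul_T222 hχ.1 (linearIndependent_triple_of_T222 hli))).elim
  · exact (hd.not_mem h (T22eps23_mem_orbit_of_config hχ.1 hS hA hli)).elim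
  · exact (hA _ (linearIndependent_mul_T22eps24 hχ.1 (linearIndependent_pair_of_T22eps24 hli)
      had hbd)).elim

/-- Here `eta 2` is not excluded; the annihilator of codimension at most four only forbids a third
pair. -/
theorem lowModel_of_T22eps24 [IsAlgClosed k] {μ χ : AlgStr k n} (hμ : AlternatingEngel μ)
    (hn : 6 ≤ n) (h : T22eps24 k n ∈ orbit μ) (hd : ProperlyDegenerates μ χ) : LowModel χ := by
  have hχ := closed_alternatingEngel μ χ hμ hd.1
  have hS := (closed_twoStep.transfer ⟨alternating_T22eps24, twoStep_T22eps24 hn⟩ h hd).2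
  have hA := (closed_annCorankLE 4).transfer annCorankLE_T22eps24 h hd
  have hD := (closed_derivedRankLE 2).transfer derivedRankLE_T22eps24 h hd
  have hP := closed_pfSquare.transfer pfSquare_T22eps24 h hd
  rcases Engel.classification hχ.1 hχ.engel with h0 | ⟨m', z, x, h1, hx, h2⟩ |
    ⟨hT, a, b, c, hli⟩ | ⟨a, b, hli⟩ | ⟨a, b, c, d, hli⟩ | ⟨a, b, c, hli⟩ |
    ⟨a, b, c, d, hli, had, hbd⟩
  · exact Or.inl h0
  · have := hx.two_mul_le hχ.1 hA
    exact lowModel_of_eta h1 (by omega) h2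
  · exact Or.inr (Or.inr (Or.inr ⟨le_of_linearIndependent hli, hT⟩))
  · exact (hS.not_T3 hχ.1 hli).elim
  · exact (hD.not_triple _ _ _ _ _ _ (linearIndependent_triple_of_T222 hli)).elim
  · exact (hD.not_triple _ _ _ _ _ _ (linearIndependent_triple_of_T22eps23 hli)).elim
  · exact (hd.not_mem h (T22eps24_mem_orbit_of_config hχ.1 hS hD hA hP hli had hbd)).elim

/-- In dimension at most four, no chain of non-trivial degenerations has length three. -/
theorem not_hasChain_three_of_le_four [Infinite k] {μ : AlgStr k n} (hμ : AlternatingEngel μ)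
    (hn : n ≤ 4) : ¬ HasChain 3 μ := by
  have key : ∀ χ : AlgStr k n, AlternatingEngel χ →
      (χ = 0 ∨ eta k n 1 ∈ orbit χ) ∨ T3 k n ∈ orbit χ := by
    intro χ hχ
    rcases Engel.classification hχ.1 hχ.engel with h0 | ⟨m', z, x, h1, hx, h2⟩ |
      ⟨-, a, b, c, hli⟩ | ⟨a, b, hli⟩ | ⟨a, b, c, d, hli⟩ | ⟨a, b, c, hli⟩ |
      ⟨a, b, c, d, hli, -, -⟩
    · exact Or.inl (Or.inl h0)
    · have := hx.two_mul_lt hχ.1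
      obtain rfl : m' = 1 := by omega
      exact Or.inl (Or.inr h2)
    · have := le_of_linearIndependent hli
      omega
    · have := le_of_linearIndependent hli
      exact Or.inr (T3_mem_orbit_of_dim_four (by omega) hχ.1 hχ.engel hli)
    · have := le_of_linearIndependent hli
      omega
    · have := le_of_linearIndependent hli
      omega
    · have := le_of_linearIndependent hli
      omega
  rcases key μ hμ with h | h
  · exact fun h' => not_hasChain_two_of_eta hμ h h'.of_succ
  · rintro ⟨χ, hd, hc⟩
    have hχ := closed_alternatingEngel μ χ hμ hd.1
    rcases key χ hχ with h' | h'
    · exact not_hasChain_two_of_eta hχ h' hc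
    · exact hd.not_mem h h'

end UpperBounds

/-! ### Chains starting at the models, and degenerations to them -/

section LowerBounds

variable {k : Type*} [Field k] {n : ℕ}

theorem linearIndependent_vec {p : ℕ} (l : Fin p → ℕ) (hl : Function.Injective l)
    (h1 : ∀ i, 1 ≤ l i) (hn : ∀ i, l i ≤ n) : LinearIndependent k fun i => vec k n (l i) := by
  have h := (Pi.basisFun k (Fin n)).linearIndependent.comp
    (fun i => (⟨l i - 1, by have := h1 i; have := hn i; omega⟩ : Fin n)) (fun i j hij => hl (by
      have h0 := congrArg Fin.val hij
      have := h1 i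
      have := h1 j
      simp only at h0
      omega))
  convert h using 1
  funext i r
  have := h1 i
  simp only [vec, Function.comp_apply, Pi.basisFun_apply, Pi.single_apply, Fin.ext_iff]
  congr 1
  exact propext (by omega)

theorem hyperbolicPairs_eta {m : ℕ} (hn : 2 * m < n) :
    HyperbolicPairs (eta k n m) (vec k n (2 * m + 1)) m
      (fun i => Pi.single ⟨i.val, by omega⟩ 1) where
  ne_zero h := one_ne_zero (α := k) (by simpa [vec] using congrFun h ⟨2 * m, hn⟩)
  ann := by
    have : vec k n (2 * m + 1) = Pi.single ⟨2 * m, hn⟩ 1 := by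
      funext r
      simp [vec, Pi.single_apply, Fin.ext_iff]
    rw [this, eta_single_eq_zero le_rfl]
  mul i j hij := eta_single_single hij j.isLt

theorem T22_vec_mul (hn : 5 ≤ n) :
    T22 k n (vec k n 1) (vec k n 2) = vec k n (n - 1) ∧
      T22 k n (vec k n 1) (vec k n 3) = vec k n n := by
  have h1 : 1 ≤ n := by omega
  have h2 : 2 ≤ n := by omega
  have h3 : 3 ≤ n := by omega
  constructor <;> simp [T22_apply, coord_vec, h1, h2, h3]

theorem T22eps23_vec_mul (hn : 6 ≤ n) :
    T22eps23 k n (vec k n 1) (vec k n 2) = vec k n (n - 1) ∧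
      T22eps23 k n (vec k n 1) (vec k n 3) = vec k n n ∧
      T22eps23 k n (vec k n 2) (vec k n 3) = vec k n (n - 2) := by
  have h1 : 1 ≤ n := by omega
  have h2 : 2 ≤ n := by omega
  have h3 : 3 ≤ n := by omega
  refine ⟨?_, ?_, ?_⟩ <;> simp [T22eps23_apply, coord_vec, h1, h2, h3]

theorem T22eps24_vec_mul (hn : 6 ≤ n) :
    T22eps24 k n (vec k n 1) (vec k n 2) = vec k n (n - 1) ∧
      T22eps24 k n (vec k n 1) (vec k n 3) = vec k n n ∧
      T22eps24 k n (vec k n 1) (vec k n 4) = 0 ∧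
      T22eps24 k n (vec k n 2) (vec k n 4) = vec k n n := by
  have h1 : 1 ≤ n := by omega
  have h2 : 2 ≤ n := by omega
  have h3 : 3 ≤ n := by omega
  have h4 : 4 ≤ n := by omega
  refine ⟨?_, ?_, ?_, ?_⟩ <;> simp [T22eps24_apply, coord_vec, h1, h2, h3, h4]

theorem T222_vec_mul (hn : 7 ≤ n) :
    T222 k n (vec k n 1) (vec k n 2) = vec k n (n - 2) ∧
      T222 k n (vec k n 1) (vec k n 3) = vec k n (n - 1) ∧
      T222 k n (vec k n 1) (vec k n 4) = vec k n n := by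
  have h1 : 1 ≤ n := by omega
  have h2 : 2 ≤ n := by omega
  have h3 : 3 ≤ n := by omega
  have h4 : 4 ≤ n := by omega
  refine ⟨?_, ?_, ?_⟩ <;> simp [T222_apply, coord_vec, h1, h2, h3, h4]

theorem T3_vec_mul (hn : 4 ≤ n) :
    T3 k n (vec k n 1) (vec k n 2) = vec k n 3 ∧
      T3 k n (vec k n 1) (vec k n 3) = vec k n n ∧
      T3 k n (vec k n 1) (vec k n 3 + vec k n 4) = vec k n n := by
  have h1 : 1 ≤ n := by omega
  have h2 : 2 ≤ n := by omega
  have h3 : 3 ≤ n := by omega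
  refine ⟨?_, ?_, ?_⟩ <;> simp [T3_apply, coord_vec, coord_add, h1, h2, h3, hn]

theorem linearIndependent_vec_five {p q : ℕ} (hp : 3 < p) (hpq : p < q) (hq : q ≤ n) :
    LinearIndependent k ![vec k n 1, vec k n 2, vec k n 3, vec k n p, vec k n q] := by
  convert linearIndependent_vec (k := k) (n := n) ![1, 2, 3, p, q] ?_ ?_ ?_ using 1
  · funext i
    fin_cases i <;> rfl
  · refine StrictMono.injective (Fin.strictMono_iff_lt_succ.2 fun i => ?_)
    fin_cases i <;> simp <;> omega
  · intro i
    fin_cases i <;> simp <;> omega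
  · intro i
    fin_cases i <;> simp <;> omega

theorem linearIndependent_vec_three (hn : 3 ≤ n) :
    LinearIndependent k ![vec k n (n - 2), vec k n (n - 1), vec k n n] := by
  convert linearIndependent_vec (k := k) (n := n) ![n - 2, n - 1, n] ?_ ?_ ?_ using 1
  · funext i
    fin_cases i <;> rfl
  · refine StrictMono.injective (Fin.strictMono_iff_lt_succ.2 fun i => ?_)
    fin_cases i <;> simp <;> omega
  · intro i
    fin_cases i <;> simp <;> omega
  · intro i
    fin_cases i <;> simp

theorem linearIndependent_T22 (hn : 5 ≤ n) : LinearIndependent k ![vec k n 1, vec k n 2,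
    vec k n 3, T22 k n (vec k n 1) (vec k n 2), T22 k n (vec k n 1) (vec k n 3)] := by
  rw [(T22_vec_mul hn).1, (T22_vec_mul hn).2]
  exact linearIndependent_vec_five (by omega) (by omega) le_rfl

variable [Infinite k]

/-- Forgetting one pair is a degeneration; it is proper because the codimension of the annihilator
drops. -/
theorem hasChain_eta {m : ℕ} (hn : 2 * m < n) : HasChain m (eta k n m) := by
  induction m with
  | zero => trivial
  | succ m ih =>
    refine ⟨eta k n m, ⟨?_, fun h => ?_⟩, ih (by omega)⟩
    · exact degenerates_eta (alternating_eta _) ((hyperbolicPairs_eta hn).castLE (by omega))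
    · have := (hyperbolicPairs_eta hn).two_mul_le (alternating_eta _)
        ((closed_annCorankLE (2 * m)).of_orbit (annCorankLE_eta m) (orbit_symm h))
      omega

theorem hasChain_T22 (hn : 5 ≤ n) : HasChain 2 (T22 k n) := by
  have hli := linearIndependent_T22 (k := k) hn
  refine ⟨eta k n 1, ⟨degenerates_eta alternating_T22 (m := 1)
    (z := T22 k n (vec k n 1) (vec k n 2)) (x := ![vec k n 1, vec k n 2])
    ⟨hli.ne_zero 3, (twoStep_T22 hn).ann _ _, fun i j hij => ?_⟩, fun h => ?_⟩,
    hasChain_eta (m := 1) (by omega)⟩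
  · obtain ⟨rfl, rfl⟩ : i = 0 ∧ j = 1 := by
      constructor <;> ext <;> simp <;> omega
    rfl
  · exact ((closed_derivedRankLE 1).of_orbit (derivedRankLE_eta 1) (orbit_symm h)).not_pair _ _ _ _
      (linearIndependent_pair_of_T22 hli)

theorem hasChain_T22eps23 (hn : 6 ≤ n) : HasChain 3 (T22eps23 k n) := by
  obtain ⟨h1, h2, h3⟩ := T22eps23_vec_mul (k := k) hn
  refine ⟨T22 k n, ⟨degenerates_T22 alternating_T22eps23 (by omega) (a := vec k n 1)
    (b := vec k n 2) (c := vec k n 3) ?_, fun h => ?_⟩, hasChain_T22 (by omega)⟩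
  · rw [h1, h2]
    exact linearIndependent_vec_five (by omega) (by omega) le_rfl
  · refine ((closed_derivedRankLE 2).of_orbit derivedRankLE_T22 (orbit_symm h)).not_triple
      (vec k n 2) (vec k n 3) (vec k n 1) (vec k n 2) (vec k n 1) (vec k n 3) ?_
    rw [h1, h2, h3]
    exact linearIndependent_vec_three (by omega)

theorem hasChain_T222 (hn : 7 ≤ n) : HasChain 3 (T222 k n) := by
  obtain ⟨h1, h2, h3⟩ := T222_vec_mul (k := k) hn
  refine ⟨T22 k n, ⟨degenerates_T22 alternating_T222 (by omega) (a := vec k n 1)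
    (b := vec k n 2) (c := vec k n 3) ?_, fun h => ?_⟩, hasChain_T22 (by omega)⟩
  · rw [h1, h2]
    exact linearIndependent_vec_five (by omega) (by omega) (by omega)
  · refine ((closed_derivedRankLE 2).of_orbit derivedRankLE_T22 (orbit_symm h)).not_triple
      (vec k n 1) (vec k n 2) (vec k n 1) (vec k n 3) (vec k n 1) (vec k n 4) ?_
    rw [h1, h2, h3]
    exact linearIndependent_vec_three (by omega)

theorem hasChain_T22eps24 (hn : 6 ≤ n) : HasChain 3 (T22eps24 k n) := by
  obtain ⟨h1, h2, h3, h4⟩ := T22eps24_vec_mul (k := k) hn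
  have hli : LinearIndependent k ![vec k n 1, vec k n 2, vec k n 3,
      T22eps24 k n (vec k n 1) (vec k n 2), T22eps24 k n (vec k n 1) (vec k n 3)] := by
    rw [h1, h2]
    exact linearIndependent_vec_five (by omega) (by omega) le_rfl
  refine ⟨T22 k n, ⟨degenerates_T22 alternating_T22eps24 (by omega) hli, fun h => ?_⟩,
    hasChain_T22 (by omega)⟩
  exact (closed_annCorankLE 3).of_orbit annCorankLE_T22 (orbit_symm h) _
    (linearIndependent_mul_T22eps24 alternating_T22eps24 (linearIndependent_pair_of_T22 hli)
      h3 (h4.trans h2.symm))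

theorem hasChain_T3 (hn : 5 ≤ n) : HasChain 3 (T3 k n) := by
  obtain ⟨h1, h2, h3⟩ := T3_vec_mul (k := k) (n := n) (by omega)
  -- The choice `c = e_3` would coincide with `ab`; adding `e_4`, which annihilates and differs from
  -- `e_n` because `n ≥ 5`, restores independence without changing `ac = e_n`.
  refine ⟨T22 k n, ⟨degenerates_T22 alternating_T3 hn (a := vec k n 1)
    (b := vec k n 2) (c := vec k n 3 + vec k n 4) ?_, fun h => ?_⟩, hasChain_T22 hn⟩
  · have hli := Fintype.linearIndependent_iff.1
      (linearIndependent_vec_five (k := k) (p := 4) (by omega) (show 4 < n by omega) le_rfl)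
    rw [h1, h3, Fintype.linearIndependent_iff]
    intro g hg
    have := hli ![g 0, g 1, g 2 + g 3, g 2, g 4] (by
      rw [← hg]
      simp only [Fin.sum_univ_five]
      simp
      module)
    have e0 := this 0
    have e1 := this 1
    have e2 := this 2
    have e3 := this 3
    have e4 := this 4
    simp only [Matrix.cons_val] at e0 e1 e2 e3 e4
    rw [e3, zero_add] at e2
    intro i
    fin_cases i <;> assumption
  · have h0 := (closed_twoStep.of_orbit ⟨alternating_T22, twoStep_T22 hn⟩
      (orbit_symm h)).2.right alternating_T3 (vec k n 1) (vec k n 2) (vec k n 1)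
    rw [h1, h2] at h0
    exact (linearIndependent_vec_three (k := k) (n := n) (by omega)).ne_zero 2 h0

/-- The structures of level three. -/
def LevelThreeModel (X : AlgStr k n) : Prop :=
  (7 ≤ n ∧ X = eta k n 3) ∨ (6 ≤ n ∧ X = T22eps23 k n) ∨ (6 ≤ n ∧ X = T22eps24 k n) ∨
    (5 ≤ n ∧ X = T3 k n) ∨ (7 ≤ n ∧ X = T222 k n)

theorem LevelThreeModel.hasChain {X : AlgStr k n} (h : LevelThreeModel X) : HasChain 3 X := by
  rcases h with ⟨hn, rfl⟩ | ⟨hn, rfl⟩ | ⟨hn, rfl⟩ | ⟨hn, rfl⟩ | ⟨hn, rfl⟩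
  · exact hasChain_eta (by omega)
  · exact hasChain_T22eps23 hn
  · exact hasChain_T22eps24 hn
  · exact hasChain_T3 hn
  · exact hasChain_T222 hn

theorem lowModel_or_degenerates (hn : 5 ≤ n) {μ : AlgStr k n} (hμ : AlternatingEngel μ) :
    LowModel μ ∨ ∃ X, LevelThreeModel X ∧ Degenerates μ X := by
  rcases Engel.classification hμ.1 hμ.engel with h0 | ⟨m, z, x, h1, hx, h2⟩ |
    ⟨hT, -⟩ | ⟨a, b, hli⟩ | ⟨a, b, c, d, hli⟩ | ⟨a, b, c, hli⟩ | ⟨a, b, c, d, hli, had, hbd⟩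
  · exact Or.inl (Or.inl h0)
  · rcases le_or_gt m 2 with hm | hm
    · exact Or.inl (lowModel_of_eta h1 hm h2)
    · have := hx.two_mul_lt hμ.1
      exact Or.inr ⟨_, Or.inl ⟨by omega, rfl⟩, degenerates_eta hμ.1 (hx.castLE hm)⟩
  · exact Or.inl (Or.inr (Or.inr (Or.inr ⟨hn, hT⟩)))
  · exact Or.inr ⟨_, Or.inr (Or.inr (Or.inr (Or.inl ⟨hn, rfl⟩))),
      degenerates_T3 hμ.1 (by omega) hli⟩
  · have := le_of_linearIndependent hli
    exact Or.inr ⟨_, Or.inr (Or.inr (Or.inr (Or.inr ⟨this, rfl⟩))), degenerates_T222 hμ.1 this hli⟩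
  · have := le_of_linearIndependent hli
    exact Or.inr ⟨_, Or.inr (Or.inl ⟨this, rfl⟩), degenerates_T22eps23 hμ.1 this hli⟩
  · have := le_of_linearIndependent hli
    exact Or.inr ⟨_, Or.inr (Or.inr (Or.inl ⟨this, rfl⟩)),
      degenerates_T22eps24 hμ.1 this hli had hbd⟩

end LowerBounds

/-! ### Level three -/

section Level

variable {k : Type*} [Field k] [IsAlgClosed k] {n : ℕ}

theorem LevelThreeModel.lowModel {X μ χ : AlgStr k n} (h : LevelThreeModel X)
    (hX : X ∈ orbit μ) (hμ : AlternatingEngel μ) (hd : ProperlyDegenerates μ χ) :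
    LowModel χ := by
  rcases h with ⟨hn, rfl⟩ | ⟨hn, rfl⟩ | ⟨hn, rfl⟩ | ⟨hn, rfl⟩ | ⟨hn, rfl⟩
  · rcases eq_zero_or_eta_of_eta hμ hX hd with h0 | ⟨m, h1, h2, h3⟩
    · exact Or.inl h0
    · exact lowModel_of_eta h1 (by omega) h3
  · exact lowModel_of_T22eps23 hμ hn hX hd
  · exact lowModel_of_T22eps24 hμ hn hX hd
  · exact lowModel_of_T3 hμ hX hd
  · exact lowModel_of_T222 hμ hn hX hd

/-- A structure with a chain of length three is not low, so it degenerates to a model; were this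
degeneration proper, the model's own chain would give one of length four. Conversely, anything
properly below a model is low and has no chain of length three. -/
theorem level_three_iff (hn : 5 ≤ n) {μ : AlgStr k n} (hμ : AlternatingEngel μ) :
    (HasChain 3 μ ∧ ¬ HasChain 4 μ) ↔ ∃ X, LevelThreeModel X ∧ X ∈ orbit μ := by
  have : Infinite k := IsAlgClosed.instInfinite
  constructor
  · rintro ⟨h3, h4⟩
    rcases lowModel_or_degenerates hn hμ with h | ⟨X, hX, hd⟩
    · exact (h.not_hasChain_three hμ h3).elim
    · refine ⟨X, hX, ?_⟩
      by_contra h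
      exact h4 ⟨X, ⟨hd, h⟩, hX.hasChain⟩
  · rintro ⟨X, hX, hXμ⟩
    refine ⟨hX.hasChain.of_orbit (orbit_symm hXμ), ?_⟩
    rintro ⟨χ, hd, hc⟩
    exact (hX.lowModel hXμ hμ hd).not_hasChain_three (closed_alternatingEngel μ χ hμ hd.1) hc

end Level
end EngelLevel

theorem theorem1 {k : Type*} [Field k] [IsAlgClosed k]
    {A : Type*} [NonUnitalNonAssocRing A] [Module k A] [IsScalarTower k A A]
    [SMulCommClass k A A] [FiniteDimensional k A]
    (hanti : EngelLevel.IsAnticommutative A) (hengel : EngelLevel.IsEngel k A)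
    (n : ℕ) (hn : Module.finrank k A = n) :
    (n ≤ 4 → ∃ m ≤ 2, EngelLevel.HasLevel k A m) ∧
    (n = 5 → (EngelLevel.HasLevel k A 3 ↔ EngelLevel.Represents (EngelLevel.T3 k n) A)) ∧
    (n = 6 → (EngelLevel.HasLevel k A 3 ↔
      EngelLevel.Represents (EngelLevel.T22eps23 k n) A ∨
      EngelLevel.Represents (EngelLevel.T22eps24 k n) A ∨
      EngelLevel.Represents (EngelLevel.T3 k n) A)) ∧
    (7 ≤ n → (EngelLevel.HasLevel k A 3 ↔
      EngelLevel.Represents (EngelLevel.eta k n 3) A ∨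
      EngelLevel.Represents (EngelLevel.T22eps23 k n) A ∨
      EngelLevel.Represents (EngelLevel.T22eps24 k n) A ∨
      EngelLevel.Represents (EngelLevel.T3 k n) A ∨
      EngelLevel.Represents (EngelLevel.T222 k n) A)) := by
  open EngelLevel in
  subst hn
  obtain ⟨μ, hA⟩ := exists_represents (k := k) (A := A) rfl
  have hμ : AlternatingEngel μ := ⟨hA.alternating hanti, hA.exists_engelOf hengel⟩
  have hR : ∀ X, Represents X A ↔ X ∈ orbit μ := fun X => hA.iff_mem_orbit
  simp only [hR, hasLevel_iff hA]
  refine ⟨fun h => ?_, fun h => ?_, fun h => ?_, fun h => ?_⟩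
  · have : Infinite k := IsAlgClosed.instInfinite
    -- With chains of length three excluded, the level is the largest of `0, 1, 2` for which a chain
    -- exists.
    have h3 := not_hasChain_three_of_le_four hμ h
    by_cases h2 : HasChain 2 μ
    · exact ⟨2, le_rfl, h2, h3⟩
    by_cases h1 : HasChain 1 μ
    · exact ⟨1, by norm_num, h1, h2⟩
    · exact ⟨0, by norm_num, trivial, h1⟩
  · rw [level_three_iff h.ge hμ]
    simp [LevelThreeModel, h]
  · rw [level_three_iff (by omega) hμ]
    simp [LevelThreeModel, h, or_and_right, exists_or]
  · have h5 : 5 ≤ Module.finrank k A := by omega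
    have h6 : 6 ≤ Module.finrank k A := by omega
    rw [level_three_iff h5 hμ]
    simp [LevelThreeModel, h, h5, h6, or_and_right, exists_or]
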